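/- **Setting.** Let $\Lambda=\operatorname{diag}(\lambda_1,\lambda_2)$ with $\lambda_1,\lambda_2\in C^1([0,1])$, $\lambda_1(z)>\lambda_2(z)>0$; let $A\in C([0,1];\mathbb R^{4\times4})$ have zero diagonal and let $B\in\mathbb R^{2\times2}$ be invertible. Consider, for $x=(x^-,x^+)$, $x^\pm(z,t)\in\mathbb R^2$, the system in Riemann coordinates (which contains the Timoshenko beam clamped at $z=0$ and actuated at $z=1$ as the special case where $\Lambda,A,B$ are computed from the beam parameters) $$\partial_t x^-=\Lambda\,\partial_z x^-+A^{--}x^-+A^{-+}x^+,\qquad \partial_t x^+=-\Lambda\,\partial_z x^++A^{+-}x^-+A^{++}x^+,$$ $$x^+(0,t)=-x^-(0,t),\qquad x^-(1,t)=x^+(1,t)+B\,u(t),\qquad z\in[0,1],\ t\ge0.$$ Solutions are Borel, locally bounded functions that satisfy the equations integrated along characteristics. Let $\phi_i(z)=\int_0^z d\zeta/\lambda_i(\zeta)$, $\psi_i=\phi_i^{-1}$, $\tau_i=\phi_i(1)$, $\Delta\tau=\tau_2-\tau_1$, $\tilde\Lambda=\operatorname{diag}(\Lambda,-\Lambda)$.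 Let $K(z,\zeta)\in\mathbb R^{4\times4}$, $0\le\zeta\le z\le1$, be a bounded Borel solution (along characteristics) of the kernel equations $$\tilde\Lambda(z)\partial_zK(z,\zeta)+\partial_\zeta\big(K(z,\zeta)\tilde\Lambda(\zeta)\big)=K(z,\zeta)A(\zeta),\qquad K(z,z)\tilde\Lambda(z)-\tilde\Lambda(z)K(z,z)=A(z),$$ $$\big(K^{--}(z,0)+K^{-+}(z,0)\big)\Lambda(0)=\begin{bmatrix}0&0\\a_0^-(z)&0\end{bmatrix},\qquad -\big(K^{+-}(z,0)+K^{++}(z,0)\big)\Lambda(0)=\begin{bmatrix}0&0\\a_0^+(z)&0\end{bmatrix}\quad(0<z\le1),$$ the last two equations defining $a_0^\mp$. Put $\bar a_0^\mp=a_0^\mp\circ\psi_2$, $\tilde a_0(\tau)=\bar a_0^-(\Delta\tau-\tau)h(\Delta\tau-\tau)+\bar a_0^+(\tau-\Delta\tau)h(\tau-\Delta\tau)$ with the Heaviside function $h$, and $$\bar x(z,t)=x(z,t)-\int_0^zK(z,\zeta)x(\zeta,t)\,d\zeta,\qquad y(t)=\bar x^+(1,t),\qquad \eta_i(\tau,t)=y_i(t+\tau),\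 \tau\in[0,2\tau_i].$$ The input $\bar u$ is introduced by $u(t)=B^{-1}\big(\bar u(t)-x^+(1,t)+\int_0^1[K^{--}(1,\zeta)x^-(\zeta,t)+K^{-+}(1,\zeta)x^+(\zeta,t)]\,d\zeta\big)$. The hyperbolic controller form (HCF) is $$\partial_t\eta_i=\partial_\tau\eta_i\ \ (0\le\tau<2\tau_i),\qquad \eta_1(2\tau_1,t)=-\bar u_1(t),$$ $$\eta_2(2\tau_2,t)=-\bar u_2(t)+\int_{\tau_1}^{2\tau_1}\bar a_0^-(\tau_1+\tau_2-\tau)\eta_1(\tau,t)\,d\tau-\int_0^{\Delta\tau+\tau_2}\tilde a_0(\tau)\bar u_1(t+\tau)\,d\tau .$$ **Reference.** Let $t_0<t_T$, let $p_i$ be continuous on $[t_0,t_T]$, and let $y_{i,r}(t)=p_i(t_0)$ for $t<t_0$, $p_i(t)$ on $[t_0,t_T]$, $p_i(t_T)$ for $t>t_T$. **Controller.** With gains $|\gamma_i|<1$, $i=1,2$, let $v_i(t)=y_{i,r}(t+2\tau_i)-\gamma_i(\eta_i(0,t)-y_{i,r}(t))$ and $$\bar u_1(t)=-v_1(t),\qquad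 \bar u_2(t)=-v_2(t)+\int_{\tau_1}^{2\tau_1}\bar a_0^-(\tau_1+\tau_2-\tau)\eta_1(\tau,t)\,d\tau+\int_0^{\Delta\tau+\tau_2}\tilde a_0(\tau)\,v_1(t+\tau)\,d\tau,$$ where $v_1(t+\tau)$ stands for $y_{1,r}(t+2\tau_1+\tau)-\gamma_1(\hat\eta(\tau)-y_{1,r}(t+\tau))$ and the prediction $\hat\eta(\tau)$ of $\eta_1(0,t+\tau)$ is computed from $\eta_1(\cdot,t)$ recursively by $$\hat\eta(\tau)=\eta_1(\tau,t)\ (0\le\tau\le2\tau_1),\qquad \hat\eta(\tau)=-\gamma_1\hat\eta(\tau-2\tau_1)+y_{1,r}(t+\tau)+\gamma_1y_{1,r}(t+\tau-2\tau_1)\ (\tau>2\tau_1).$$ **Theorem.** There is $\mu>0$ such that for every such reference the following holds. 1. Every solution $(\eta,\bar u)$ of the HCF for which $\bar u$ is given by the controller satisfies, with $e_i(t+\tau)=\eta_i(\tau,t)-y_{i,r}(t+\tau)$, the error dynamics $e_i(t+2\tau_i)=-\gamma_ie_i(t)$ for $t\ge0$, and there is $C$ with $|\eta_i(\tau,t)-y_{i,r}(t+\tau)|\le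 Ce^{-\mu t}$ for all $t\ge0$, $\tau\in[0,2\tau_i]$, $i=1,2$. 2. There is a unique function $x_r$ on $[0,1]\times[0,\infty)$, bounded and Borel in $z$ for each $t$, with $x_r(z,t)-\int_0^zK(z,\zeta)x_r(\zeta,t)\,d\zeta=\bar x_r(z,t)$, where $$\bar x_{1,r}^-(z,t)=-y_{1,r}(t+\tau_1+\phi_1(z)),\qquad \bar x_{1,r}^+(z,t)=y_{1,r}(t+\tau_1-\phi_1(z)),$$ $$\begin{aligned}\bar x_{2,r}^-(z,t)={}&-y_{2,r}(t+\tau_2+\phi_2(z))+\int_0^1\tfrac{a_0^+(\zeta)}{\lambda_2(\zeta)}y_{1,r}(t+\tau_1+\phi_2(z)+\phi_2(\zeta))\,d\zeta\\&+\int_0^z\tfrac{a_0^-(\zeta)}{\lambda_2(\zeta)}y_{1,r}(t+\tau_1+\phi_2(z)-\phi_2(\zeta))\,d\zeta,\end{aligned}$$ $$\bar x_{2,r}^+(z,t)=y_{2,r}(t+\tau_2-\phi_2(z))-\int_z^1\tfrac{a_0^+(\zeta)}{\lambda_2(\zeta)}y_{1,r}(t+\tau_1-\phi_2(z)+\phi_2(\zeta))\,d\zeta.$$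 For every solution $x$ of the system in Riemann coordinates in closed loop with the controller, the functions $\eta_i(\tau,t)=y_i(t+\tau)$ solve the HCF, satisfy the error dynamics and converge to the reference with rate $\mu$ as in 1, and there is $C$ with $|x(z,t)-x_r(z,t)|\le Ce^{-\mu t}$ for all $t\ge0$, $z\in[0,1]$. -/

import Mathlib

open Set MeasureTheory

noncomputable section

namespace Beam

/-- Index set of the four Riemann coordinates: `Sum.inl i` is the component `x⁻` number `i + 1`
(travelling in the negative `z`-direction), `Sum.inr i` is the component `x⁺` number `i + 1`. -/
abbrev Idx : Type := Fin 2 ⊕ Fin 2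

/-- Coefficients of the beam equations in Riemann coordinates
`∂ₜ x⁻ = Λ ∂_z x⁻ + A⁻⁻ x⁻ + A⁻⁺ x⁺`, `∂ₜ x⁺ = -Λ ∂_z x⁺ + A⁺⁻ x⁻ + A⁺⁺ x⁺` on `0 ≤ z ≤ 1`,
`x⁺(0,t) = -x⁻(0,t)`, `x⁻(1,t) = x⁺(1,t) + B u(t)`, where `Λ = diag (lam 0, lam 1)`.
The clamped Timoshenko beam, actuated at `z = 1`, is the special case in which the coefficients
are the known expressions in the beam parameters. -/
structure RiemannSystem where
  lam : Fin 2 → ℝ → ℝ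
  A : ℝ → Matrix Idx Idx ℝ
  B : Matrix (Fin 2) (Fin 2) ℝ
  lam_contDiffOn : ∀ i, ContDiffOn ℝ 1 (lam i) (Icc 0 1)
  lam_pos : ∀ z ∈ Icc (0 : ℝ) 1, 0 < lam 1 z
  lam_lt : ∀ z ∈ Icc (0 : ℝ) 1, lam 1 z < lam 0 z
  A_continuousOn : ∀ k j, ContinuousOn (fun z => A z k j) (Icc 0 1)
  A_diag : ∀ z ∈ Icc (0 : ℝ) 1, ∀ k, A z k k = 0
  B_isUnit : IsUnit B.det

namespace RiemannSystem

variable (S : RiemannSystem)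

/-- `φ_i(z) = ∫₀ᶻ dζ / λ_i(ζ)`. -/
def phi (i : Fin 2) (z : ℝ) : ℝ := ∫ ζ in (0 : ℝ)..z, 1 / S.lam i ζ

/-- The transport time `τ_i = φ_i(1)`. -/
def tau (i : Fin 2) : ℝ := S.phi i 1

/-- `ψ_i`, the inverse of `φ_i : [0,1] → [0, τ_i]`. -/
def psi (i : Fin 2) : ℝ → ℝ := Function.invFunOn (S.phi i) (Icc 0 1)

/-- The diagonal of `diag (Λ, -Λ)`. -/
def slam : Idx → ℝ → ℝ
  | Sum.inl i, z => S.lam i z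
  | Sum.inr i, z => -S.lam i z

/-- Signed travel times, `∫₀ᶻ dζ / slam k ζ`. -/
def sphi : Idx → ℝ → ℝ
  | Sum.inl i, z => S.phi i z
  | Sum.inr i, z => -S.phi i z

/-- `x` (with `x k z t` the component `k` at position `z` and time `t`) is a solution on
`[0,1] × [0,∞)` of the system with input `u`, in the broad sense: `x` is Borel and locally bounded
(jumps are allowed), satisfies the boundary conditions, and each component satisfies its transport
equation `∂ₜ x_k = slam k ∂_z x_k + (A x)_k`, integrated along every characteristic line
`t = T - sphi k z`. -/
structure IsSolution (x : Idx → ℝ → ℝ → ℝ) (u : ℝ → Fin 2 → ℝ) : Prop where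
  measurable : ∀ k, Measurable
    ((Icc (0 : ℝ) 1 ×ˢ Ici (0 : ℝ)).domRestrict fun q : ℝ × ℝ => x k q.1 q.2)
  bounded : ∀ T : ℝ, ∃ C : ℝ, ∀ k, ∀ z ∈ Icc (0 : ℝ) 1, ∀ t ∈ Icc (0 : ℝ) T, |x k z t| ≤ C
  transport : ∀ (k : Idx) (T : ℝ), ∀ z₁ ∈ Icc (0 : ℝ) 1, ∀ z₂ ∈ Icc (0 : ℝ) 1,
    0 ≤ T - S.sphi k z₁ → 0 ≤ T - S.sphi k z₂ →
      x k z₂ (T - S.sphi k z₂) - x k z₁ (T - S.sphi k z₁) =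
        -∫ ζ in z₁..z₂, (∑ j, S.A ζ k j * x j ζ (T - S.sphi k ζ)) / S.slam k ζ
  bc_zero : ∀ t, 0 ≤ t → ∀ i, x (Sum.inr i) 0 t = -x (Sum.inl i) 0 t
  bc_one : ∀ t, 0 ≤ t → ∀ i, x (Sum.inl i) 1 t = x (Sum.inr i) 1 t + (S.B.mulVec (u t)) i

/-! ### Volterra kernel -/

/-- The entry `a₀⁻(z)` of the strictly lower triangular matrix `A₀⁻(z)`,
read off from `(K⁻⁻(z,0) + K⁻⁺(z,0)) Λ(0) = A₀⁻(z)`. -/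
def a0m (K : ℝ → ℝ → Matrix Idx Idx ℝ) (z : ℝ) : ℝ :=
  (K z 0 (Sum.inl 1) (Sum.inl 0) + K z 0 (Sum.inl 1) (Sum.inr 0)) * S.lam 0 0

/-- The entry `a₀⁺(z)` of the strictly lower triangular matrix `A₀⁺(z)`,
read off from `-(K⁺⁻(z,0) + K⁺⁺(z,0)) Λ(0) = A₀⁺(z)`. -/
def a0p (K : ℝ → ℝ → Matrix Idx Idx ℝ) (z : ℝ) : ℝ :=
  -(K z 0 (Sum.inr 1) (Sum.inl 0) + K z 0 (Sum.inr 1) (Sum.inr 0)) * S.lam 0 0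

/-- `K` solves the kernel equations on the triangle `0 ≤ ζ ≤ z ≤ 1`, in the broad sense:
`K` is Borel and bounded, and with `Λ̃ = diag (Λ, -Λ)` each entry of
`Λ̃(z) ∂_z K(z,ζ) + ∂_ζ (K(z,ζ) Λ̃(ζ)) = K(z,ζ) A(ζ)` holds integrated along every characteristic
curve `s ↦ (Z s, W s)`, `Z' = slam k Z`, `W' = slam j W`, in the triangle (the curves are given by
`sphi k (Z s) - s` and `sphi j (W s) - s` being constant). The condition on `ζ = 0` says
that `A₀⁻` and `A₀⁺` are strictly lower triangular; it is not imposed at the corner `z = ζ = 0`,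
where a (generally discontinuous) kernel cannot satisfy it together with the diagonal condition. -/
structure IsKernel (K : ℝ → ℝ → Matrix Idx Idx ℝ) : Prop where
  measurable : ∀ k j, Measurable
    ({q : ℝ × ℝ | 0 ≤ q.2 ∧ q.2 ≤ q.1 ∧ q.1 ≤ 1}.domRestrict fun q : ℝ × ℝ => K q.1 q.2 k j)
  bounded : ∃ C : ℝ, ∀ z ζ : ℝ, 0 ≤ ζ → ζ ≤ z → z ≤ 1 → ∀ k j, |K z ζ k j| ≤ C
  pde : ∀ (k j : Idx) (a b : ℝ) (Z W : ℝ → ℝ), a ≤ b →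
    (∀ s ∈ Icc a b, 0 ≤ W s ∧ W s ≤ Z s ∧ Z s ≤ 1) →
    (∀ s ∈ Icc a b, S.sphi k (Z s) = S.sphi k (Z a) + (s - a)) →
    (∀ s ∈ Icc a b, S.sphi j (W s) = S.sphi j (W a) + (s - a)) →
      K (Z b) (W b) k j * S.slam j (W b) - K (Z a) (W a) k j * S.slam j (W a) =
        ∫ s in a..b, S.slam j (W s) * (K (Z s) (W s) * S.A (W s)) k j
  bc_minus : ∀ z ∈ Ioc (0 : ℝ) 1,
    ((K z 0).toBlocks₁₁ + (K z 0).toBlocks₁₂) * Matrix.diagonal (fun i => S.lam i 0) =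
      !![0, 0; S.a0m K z, 0]
  bc_plus : ∀ z ∈ Ioc (0 : ℝ) 1,
    -(((K z 0).toBlocks₂₁ + (K z 0).toBlocks₂₂) * Matrix.diagonal (fun i => S.lam i 0)) =
      !![0, 0; S.a0p K z, 0]
  bc_diag : ∀ z ∈ Icc (0 : ℝ) 1,
    K z z * Matrix.diagonal (fun k => S.slam k z) - Matrix.diagonal (fun k => S.slam k z) * K z z =
      S.A z

/-- The Volterra transformation `x̄(z) = x(z) - ∫₀ᶻ K(z,ζ) x(ζ) dζ` of a spatial profile. -/
def volterra (K : ℝ → ℝ → Matrix Idx Idx ℝ) (x : Idx → ℝ → ℝ) (k : Idx) (z : ℝ) : ℝ :=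
  x k z - ∫ ζ in (0 : ℝ)..z, ∑ j, K z ζ k j * x j ζ

/-- `ā₀⁻(τ) = a₀⁻(ψ₂(τ))`. -/
def abm (K : ℝ → ℝ → Matrix Idx Idx ℝ) (τ : ℝ) : ℝ := S.a0m K (S.psi 1 τ)

/-- `ā₀⁺(τ) = a₀⁺(ψ₂(τ))`. -/
def abp (K : ℝ → ℝ → Matrix Idx Idx ℝ) (τ : ℝ) : ℝ := S.a0p K (S.psi 1 τ)

/-- `Δτ = τ₂ - τ₁`. -/
def dtau : ℝ := S.tau 1 - S.tau 0

/-- The Heaviside function. -/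
def heaviside (s : ℝ) : ℝ := if 0 ≤ s then 1 else 0

/-- `ã₀(τ) = ā₀⁻(Δτ - τ) h(Δτ - τ) + ā₀⁺(τ - Δτ) h(τ - Δτ)`. -/
def atil (K : ℝ → ℝ → Matrix Idx Idx ℝ) (τ : ℝ) : ℝ :=
  S.abm K (S.dtau - τ) * heaviside (S.dtau - τ) + S.abp K (τ - S.dtau) * heaviside (τ - S.dtau)

/-! ### Flat output and hyperbolic controller form (HCF) -/

/-- The flat output `y(t) = x̄⁺(1,t)`. -/
def flatOutput (K : ℝ → ℝ → Matrix Idx Idx ℝ) (x : Idx → ℝ → ℝ → ℝ) (i : Fin 2) (t : ℝ) : ℝ :=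
  volterra K (fun k z => x k z t) (Sum.inr i) 1

/-- The HCF state `η_i(τ,t) = y_i(t + τ)` (used for `τ ∈ [0, 2 τ_i]`). -/
def hcfState (K : ℝ → ℝ → Matrix Idx Idx ℝ) (x : Idx → ℝ → ℝ → ℝ) (i : Fin 2) (τ t : ℝ) : ℝ :=
  flatOutput K x i (t + τ)

/-- `(η, ū)` is a solution for `t ≥ 0` of the HCF: `∂ₜ η_i = ∂_τ η_i` on `[0, 2 τ_i]`, i.e. `η_i`
is constant on the lines `τ + t = const`, together with the boundary conditions at `τ = 2 τ_i`,
the second of which contains predictions `ū₁(t + τ)` of the input. -/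
structure IsHCFSolution (K : ℝ → ℝ → Matrix Idx Idx ℝ) (η : Fin 2 → ℝ → ℝ → ℝ)
    (ubar : ℝ → Fin 2 → ℝ) : Prop where
  measurable : ∀ i, Measurable
    ((Icc (0 : ℝ) (2 * S.tau i) ×ˢ Ici (0 : ℝ)).domRestrict fun q : ℝ × ℝ => η i q.1 q.2)
  bounded : ∀ T : ℝ, ∃ C : ℝ, ∀ i, ∀ τ ∈ Icc 0 (2 * S.tau i), ∀ t ∈ Icc (0 : ℝ) T, |η i τ t| ≤ C
  transport : ∀ i, ∀ τ ∈ Icc 0 (2 * S.tau i), ∀ τ' ∈ Icc 0 (2 * S.tau i), ∀ t t' : ℝ,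
    0 ≤ t → 0 ≤ t' → τ + t = τ' + t' → η i τ t = η i τ' t'
  bc_one : ∀ t, 0 ≤ t → η 0 (2 * S.tau 0) t = -ubar t 0
  bc_two : ∀ t, 0 ≤ t → η 1 (2 * S.tau 1) t =
    -ubar t 1
      + (∫ τ in (S.tau 0)..(2 * S.tau 0), S.abm K (S.tau 0 + S.tau 1 - τ) * η 0 τ t)
      - ∫ τ in (0 : ℝ)..(S.dtau + S.tau 1), S.atil K τ * ubar (t + τ) 0

/-! ### Reference and controller -/

/-- Reference trajectory: `y0` before `t0`, `p` on `[t0, tT]`, `yT` after `tT`. -/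
def reference (t0 tT : ℝ) (y0 yT : Fin 2 → ℝ) (p : Fin 2 → ℝ → ℝ) (i : Fin 2) (t : ℝ) : ℝ :=
  if t < t0 then y0 i else if t ≤ tT then p i t else yT i

/-- The substitution rule for `η₁(0, t + σ)` applied at most `n` times: it is `prof σ` (where
`prof` is the profile `η₁(·,t)`) if `σ ≤ 2 τ₁`, and otherwise
`-γ₁ η₁(0, t + σ - 2 τ₁) + y_{1,r}(t + σ) + γ₁ y_{1,r}(t + σ - 2 τ₁)`. -/
def predictAux (g : ℝ) (yr : ℝ → ℝ) (t : ℝ) (prof : ℝ → ℝ) : ℕ → ℝ → ℝ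
  | 0, σ => prof σ
  | n + 1, σ =>
    if σ ≤ 2 * S.tau 0 then prof σ
    else -g * predictAux g yr t prof n (σ - 2 * S.tau 0)
      + (yr (t + σ) + g * yr (t + σ - 2 * S.tau 0))

/-- The prediction of `η₁(0, t + σ)`, `σ ≥ 0`, from the profile `prof = η₁(·,t)` by successive
substitution; `⌈σ / (2 τ₁)⌉` steps suffice. -/
def predict (g : ℝ) (yr : ℝ → ℝ) (t : ℝ) (prof : ℝ → ℝ) (σ : ℝ) : ℝ :=
  S.predictAux g yr t prof ⌈σ / (2 * S.tau 0)⌉₊ σ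

/-- The tracking law `v_i(t) = y_{i,r}(t + 2 τ_i) - γ_i (η_i(0,t) - y_{i,r}(t))`, where
`η` is the profile `η(·,t)`. -/
def trackV (γ : Fin 2 → ℝ) (yr : Fin 2 → ℝ → ℝ) (t : ℝ) (η : Fin 2 → ℝ → ℝ) (i : Fin 2) : ℝ :=
  yr i (t + 2 * S.tau i) - γ i * (η i 0 - yr i t)

/-- The prediction of `v₁(t + τ)` from the profile `η(·,t)`. -/
def predictV (γ : Fin 2 → ℝ) (yr : Fin 2 → ℝ → ℝ) (t : ℝ) (η : Fin 2 → ℝ → ℝ) (τ : ℝ) : ℝ :=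
  yr 0 (t + 2 * S.tau 0 + τ) - γ 0 * (S.predict (γ 0) (yr 0) t (η 0) τ - yr 0 (t + τ))

/-- The controller: `ū(t)` as a feedback of the HCF profile `η = η(·,t)`, i.e. the decoupling
feedback with the tracking law and the predictions inserted. -/
def controller (K : ℝ → ℝ → Matrix Idx Idx ℝ) (γ : Fin 2 → ℝ) (yr : Fin 2 → ℝ → ℝ) (t : ℝ)
    (η : Fin 2 → ℝ → ℝ) : Fin 2 → ℝ :=
  ![-S.trackV γ yr t η 0,
    -S.trackV γ yr t η 1
      + (∫ τ in (S.tau 0)..(2 * S.tau 0), S.abm K (S.tau 0 + S.tau 1 - τ) * η 0 τ)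
      + ∫ τ in (0 : ℝ)..(S.dtau + S.tau 1), S.atil K τ * S.predictV γ yr t η τ]

/-- The feedback `u = B⁻¹ (ū - x⁺(1) + ∫₀¹ (K⁻⁻(1,ζ) x⁻(ζ) + K⁻⁺(1,ζ) x⁺(ζ)) dζ)` introducing
the input `ū`. -/
def inputFeedback (K : ℝ → ℝ → Matrix Idx Idx ℝ) (x : Idx → ℝ → ℝ) (ubar : Fin 2 → ℝ) :
    Fin 2 → ℝ :=
  S.B⁻¹.mulVec fun i =>
    ubar i - x (Sum.inr i) 1 + ∫ ζ in (0 : ℝ)..1, ∑ j, K 1 ζ (Sum.inl i) j * x j ζ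

/-- The input `ū(t)` that the controller generates along the trajectory `x`. -/
def loopInput (K : ℝ → ℝ → Matrix Idx Idx ℝ) (γ : Fin 2 → ℝ) (yr : Fin 2 → ℝ → ℝ)
    (x : Idx → ℝ → ℝ → ℝ) (t : ℝ) : Fin 2 → ℝ :=
  S.controller K γ yr t fun i τ => hcfState K x i τ t

/-- `x` is a trajectory of the closed loop in the original coordinates, for some initial state. -/
def IsClosedLoop (K : ℝ → ℝ → Matrix Idx Idx ℝ) (γ : Fin 2 → ℝ) (yr : Fin 2 → ℝ → ℝ)
    (x : Idx → ℝ → ℝ → ℝ) : Prop :=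
  S.IsSolution x fun t => S.inputFeedback K (fun k z => x k z t) (S.loopInput K γ yr x t)

/-- The flatness-based parametrization of the state `x̄` by the flat output `y`. -/
def flatState (K : ℝ → ℝ → Matrix Idx Idx ℝ) (y : Fin 2 → ℝ → ℝ) (z t : ℝ) : Idx → ℝ :=
  Sum.elim
    ![-y 0 (t + S.tau 0 + S.phi 0 z),
      -y 1 (t + S.tau 1 + S.phi 1 z)
        + (∫ ζ in (0 : ℝ)..1,
            S.a0p K ζ / S.lam 1 ζ * y 0 (t + S.tau 0 + S.phi 1 z + S.phi 1 ζ))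
        + ∫ ζ in (0 : ℝ)..z,
            S.a0m K ζ / S.lam 1 ζ * y 0 (t + S.tau 0 + S.phi 1 z - S.phi 1 ζ)]
    ![y 0 (t + S.tau 0 - S.phi 0 z),
      y 1 (t + S.tau 1 - S.phi 1 z)
        - ∫ ζ in z..1,
            S.a0p K ζ / S.lam 1 ζ * y 0 (t + S.tau 0 - S.phi 1 z + S.phi 1 ζ)]

/-- `xr` is the reference state belonging to `yr`: at each time a bounded Borel profile whose
Volterra transform is the flatness-based parametrization evaluated at `yr`. -/
structure IsReferenceState (K : ℝ → ℝ → Matrix Idx Idx ℝ) (yr : Fin 2 → ℝ → ℝ)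
    (xr : Idx → ℝ → ℝ → ℝ) : Prop where
  measurable : ∀ t, 0 ≤ t → ∀ k, Measurable ((Icc (0 : ℝ) 1).domRestrict fun z => xr k z t)
  bounded : ∀ t, 0 ≤ t → ∃ C : ℝ, ∀ k, ∀ z ∈ Icc (0 : ℝ) 1, |xr k z t| ≤ C
  transform : ∀ t, 0 ≤ t → ∀ z ∈ Icc (0 : ℝ) 1, ∀ k,
    volterra K (fun j ζ => xr j ζ t) k z = S.flatState K yr z t k

/-- The error dynamics `e_i(t + 2 τ_i) = -γ_i e_i(t)`, `t ≥ 0`, for the tracking error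
`e_i(t + τ) = η_i(τ,t) - y_{i,r}(t + τ)`. -/
def ErrorDynamics (γ : Fin 2 → ℝ) (yr : Fin 2 → ℝ → ℝ) (η : Fin 2 → ℝ → ℝ → ℝ) : Prop :=
  ∀ i t, 0 ≤ t → η i (2 * S.tau i) t - yr i (t + 2 * S.tau i) = -γ i * (η i 0 t - yr i t)

/-- Exponential convergence with rate `μ`, uniformly on `[0, 2 τ_i]`, of `η_i(·,t)` to
`y_{i,r}(t + ·)`. -/
def HCFConverges (μ : ℝ) (yr : Fin 2 → ℝ → ℝ) (η : Fin 2 → ℝ → ℝ → ℝ) : Prop :=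
  ∃ C : ℝ, ∀ t, 0 ≤ t → ∀ i, ∀ τ ∈ Icc 0 (2 * S.tau i),
    |η i τ t - yr i (t + τ)| ≤ C * Real.exp (-μ * t)

/-- Exponential convergence with rate `μ`, uniformly on `[0,1]`, of `x(·,t)` to `xr(·,t)`. -/
def StateConverges (μ : ℝ) (x xr : Idx → ℝ → ℝ → ℝ) : Prop :=
  ∃ C : ℝ, ∀ t, 0 ≤ t → ∀ k, ∀ z ∈ Icc (0 : ℝ) 1,
    |x k z t - xr k z t| ≤ C * Real.exp (-μ * t)

end RiemannSystem

end Beam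

end

/-!
The Volterra transformation `x̄ = x - ∫₀ᶻ K x` decouples the system. Along a characteristic of a
component of `x̄`, a summand `∫₀ᶻ K k j x j` is an integral of a product of two functions, each of
which is absolutely continuous along its own family of lines: `x j` along the characteristics of
the system and `K k j` along those of the kernel equations. A Leibniz rule for such integrals
(`leibniz_one_boundary`, `leibniz_two_boundaries`) needs no further regularity of either factor; it
gives `IsKernel.volterra_summand_charCurve`. After summation over `j` the kernel equations cancel
the interior terms and the terms at `ζ = z`, and what is left of the variation of `x̄ k` is
the boundary term at `ζ = 0`, which by the boundary conditions on `K` only involves `x₁⁻(0, ·)` and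
only acts on the second family.

The first family is thus purely transported and reflected at `z = 0`, and the second is transported
with a source that is a known function of the first. Hence every value of `x̄` at times `t ≥ 0` is
an explicit expression in the trace `y = x̄⁺(1, ·)` on `[t, ∞)`, namely `flatState`
(`IsKernel.volterra_eq_flatState`). Evaluated in `x̄⁻(1, t) = ū(t)`, this is the hyperbolic
controller form, up to the rearrangement of integrals in `IsKernel.hcf_integral_identity`.

In the hyperbolic controller form the controller cancels every integral except those over predicted
values of the first output, and the prediction is exact because it iterates the error recursion of
the first output (`IsHCFSolution.predict_eq`). What remains is `e i (t + 2 τ i) = -γ i * e i t`, so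
the errors decay at a rate fixed by the gains and the travel times (`exists_exp_bound`,
`exists_rate`). The map `flatState` is bounded by the supremum of its argument on `[t, ∞)`, weighted
by the exponential, and a Volterra equation of the second kind with bounded kernel has a unique
bounded measurable solution, obtained by Picard iteration (`exists_volterra_eq`) and controlled by
the right-hand side through a Gronwall estimate (`abs_le_of_volterra_le`). This yields the
reference state and transfers the decay from the outputs to the state.
-/

namespace Beam

/-! ### Bounded measurable functions and their integrals -/

lemma measurable_indicator_of_domRestrict {α : Type*} [MeasurableSpace α] {s : Set α}
    (hs : MeasurableSet s) {f : α → ℝ} (hf : Measurable (s.domRestrict f)) :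
    Measurable (s.indicator f) := by
  refine measurable_of_restrict_of_restrict_compl hs ?_ ?_
  · convert hf using 1
    ext x
    simp
  · convert measurable_const (a := (0 : ℝ)) using 1
    ext x
    simp [Set.indicator_of_notMem x.2]

lemma measurable_domRestrict_of_eqOn {α : Type*} [MeasurableSpace α] {s : Set α} {f g : α → ℝ}
    (hg : Measurable g) (h : ∀ a ∈ s, f a = g a) : Measurable (s.domRestrict f) := by
  have : s.domRestrict f = fun a : s => g a := by
    ext a
    simp [h a a.2]
  rw [this]
  exact hg.comp measurable_subtype_coe

lemma measurable_intervalIntegral {α : Type*} [MeasurableSpace α] {F : α → ℝ → ℝ}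
    (hF : Measurable (Function.uncurry F)) {u v : α → ℝ} (hu : Measurable u) (hv : Measurable v) :
    Measurable fun a => ∫ r in u a..v a, F a r := by
  have key : ∀ p q : α → ℝ, Measurable p → Measurable q →
      Measurable fun a => ∫ r in Ioc (p a) (q a), F a r := by
    intro p q hp hq
    have hs : MeasurableSet {z : α × ℝ | p z.1 < z.2 ∧ z.2 ≤ q z.1} :=
      (measurableSet_lt (hp.comp measurable_fst) measurable_snd).inter
        (measurableSet_le measurable_snd (hq.comp measurable_fst))
    have h := (hF.indicator hs).stronglyMeasurable.integral_prod_right' (ν := volume)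
    convert h.measurable using 2 with a
    rw [← integral_indicator measurableSet_Ioc]
    rfl
  exact (key u v hu hv).sub (key v u hv hu)

/-- Borel measurable and bounded. -/
def BddMeas {α : Type*} [MeasurableSpace α] (f : α → ℝ) : Prop :=
  Measurable f ∧ ∃ C, ∀ a, |f a| ≤ C

namespace BddMeas

variable {α β : Type*} [MeasurableSpace α] [MeasurableSpace β] {f g : α → ℝ}

lemma const (c : ℝ) : BddMeas fun _ : α => c := ⟨measurable_const, |c|, fun _ => le_rfl⟩

lemma add (hf : BddMeas f) (hg : BddMeas g) : BddMeas fun a => f a + g a := by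
  obtain ⟨C, hC⟩ := hf.2
  obtain ⟨D, hD⟩ := hg.2
  exact ⟨hf.1.add hg.1, C + D, fun a => (abs_add_le _ _).trans (add_le_add (hC a) (hD a))⟩

lemma neg (hf : BddMeas f) : BddMeas fun a => -f a := by
  obtain ⟨C, hC⟩ := hf.2
  exact ⟨hf.1.neg, C, fun a => by rw [abs_neg]; exact hC a⟩

lemma sub (hf : BddMeas f) (hg : BddMeas g) : BddMeas fun a => f a - g a := by
  simpa only [sub_eq_add_neg] using hf.add hg.neg

lemma mul (hf : BddMeas f) (hg : BddMeas g) : BddMeas fun a => f a * g a := by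
  obtain ⟨C, hC⟩ := hf.2
  obtain ⟨D, hD⟩ := hg.2
  refine ⟨hf.1.mul hg.1, C * D, fun a => ?_⟩
  rw [abs_mul]
  exact mul_le_mul (hC a) (hD a) (abs_nonneg _) ((abs_nonneg _).trans (hC a))

lemma sum {ι : Type*} {s : Finset ι} {F : ι → α → ℝ} (h : ∀ i ∈ s, BddMeas (F i)) :
    BddMeas fun a => ∑ i ∈ s, F i a := by
  classical
  induction s using Finset.induction_on with
  | empty => simpa using const (α := α) 0
  | insert i s hi ih =>
    simp only [Finset.sum_insert hi]
    exact (h i (by simp)).add (ih fun j hj => h j (by simp [hj]))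

lemma comp (hf : BddMeas f) {u : β → α} (hu : Measurable u) : BddMeas fun b => f (u b) := by
  obtain ⟨C, hC⟩ := hf.2
  exact ⟨hf.1.comp hu, C, fun b => hC _⟩

lemma indicator (hf : BddMeas f) {s : Set α} (hs : MeasurableSet s) :
    BddMeas (s.indicator f) := by
  obtain ⟨C, hC⟩ := hf.2
  refine ⟨hf.1.indicator hs, C, fun a => ?_⟩
  by_cases h : a ∈ s
  · rw [indicator_of_mem h]; exact hC a
  · rw [indicator_of_notMem h, abs_zero]; exact (abs_nonneg _).trans (hC a)

lemma of_indicator {h : α → ℝ} {s : Set α} (hs : MeasurableSet s) {C : ℝ}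
    (hm : Measurable (s.domRestrict h)) (hC : ∀ a ∈ s, |h a| ≤ C) :
    BddMeas (s.indicator h) := by
  refine ⟨measurable_indicator_of_domRestrict hs hm, |C|, fun a => ?_⟩
  by_cases ha : a ∈ s
  · rw [indicator_of_mem ha]; exact (hC a ha).trans (le_abs_self C)
  · rw [indicator_of_notMem ha, abs_zero]; exact abs_nonneg C

lemma section_left {F : α → β → ℝ} (hF : BddMeas (Function.uncurry F)) (a : α) :
    BddMeas (F a) := hF.comp (measurable_prodMk_left (x := a))

lemma section_right {F : α → β → ℝ} (hF : BddMeas (Function.uncurry F)) (b : β) :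
    BddMeas fun a => F a b := hF.comp (measurable_prodMk_right (y := b))

lemma intervalIntegrable {f : ℝ → ℝ} (hf : BddMeas f) (a b : ℝ) :
    IntervalIntegrable f volume a b := by
  obtain ⟨C, hC⟩ := hf.2
  refine (intervalIntegrable_const (c := C)).mono_fun' hf.1.aestronglyMeasurable ?_
  exact Filter.Eventually.of_forall fun x => hC x

lemma integrableOn {f : α → ℝ} (hf : BddMeas f) {μ : Measure α} {s : Set α} (hs : μ s < ⊤) :
    IntegrableOn f s μ := by
  obtain ⟨C, hC⟩ := hf.2
  exact IntegrableOn.of_bound hs hf.1.aestronglyMeasurable C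
    (Filter.Eventually.of_forall fun x => hC x)

lemma intervalIntegral {F : α → ℝ → ℝ} (hF : BddMeas (Function.uncurry F)) {u v : α → ℝ}
    (hu : Measurable u) (hv : Measurable v) {L : ℝ} (hL : ∀ a, |v a - u a| ≤ L) :
    BddMeas fun a => ∫ r in u a..v a, F a r := by
  obtain ⟨C, hC⟩ := hF.2
  refine ⟨measurable_intervalIntegral hF.1 hu hv, |C| * L, fun a => ?_⟩
  have h := intervalIntegral.norm_integral_le_of_norm_le_const (a := u a) (b := v a) (C := |C|)
    (f := F a) fun r _ => (hC (a, r)).trans (le_abs_self C)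
  exact h.trans (mul_le_mul_of_nonneg_left (hL a) (abs_nonneg C))

lemma swap {F : ℝ → ℝ → ℝ} (hF : BddMeas (Function.uncurry F)) (a b c d : ℝ) :
    ∫ x in a..b, ∫ y in c..d, F x y = ∫ y in c..d, ∫ x in a..b, F x y := by
  refine intervalIntegral_intervalIntegral_swap (hF.integrableOn ?_)
  rw [Measure.volume_eq_prod, Measure.prod_prod]
  refine ENNReal.mul_lt_top ?_ ?_ <;> simp [uIoc]

end BddMeas

/-- Fubini's theorem on the triangle `a ≤ r ≤ s ≤ b`. -/
lemma integral_triangle_swap {F : ℝ → ℝ → ℝ} (hF : BddMeas (Function.uncurry F)) {a b : ℝ}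
    (hab : a ≤ b) :
    ∫ s in a..b, ∫ r in a..s, F s r = ∫ r in a..b, ∫ s in r..b, F s r := by
  have hT : MeasurableSet {q : ℝ × ℝ | q.2 ≤ q.1} := measurableSet_le measurable_snd measurable_fst
  have h := BddMeas.swap
    (F := fun s r => {q : ℝ × ℝ | q.2 ≤ q.1}.indicator (Function.uncurry F) (s, r))
    (hF.indicator hT) a b a b
  convert h using 1
  · refine intervalIntegral.integral_congr fun s hs => ?_
    rw [uIcc_of_le hab] at hs
    have h2 : ∫ r in s..b, {q : ℝ × ℝ | q.2 ≤ q.1}.indicator (Function.uncurry F) (s, r) = 0 := by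
      rw [intervalIntegral.integral_congr_ae (g := fun _ => 0)]
      · simp
      · refine Filter.Eventually.of_forall fun r hr => ?_
        rw [uIoc_of_le hs.2] at hr
        exact indicator_of_notMem (by simpa using hr.1) _
    have hi : BddMeas fun r => {q : ℝ × ℝ | q.2 ≤ q.1}.indicator (Function.uncurry F) (s, r) :=
      (hF.indicator hT).comp measurable_prodMk_left
    rw [← intervalIntegral.integral_add_adjacent_intervals (hi.intervalIntegrable a s)
      (hi.intervalIntegrable s b), h2, add_zero]
    refine intervalIntegral.integral_congr fun r hr => ?_
    rw [uIcc_of_le hs.1] at hr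
    exact (indicator_of_mem (s := {q : ℝ × ℝ | q.2 ≤ q.1}) (a := (s, r)) hr.2
      (Function.uncurry F)).symm
  · refine intervalIntegral.integral_congr fun r hr => ?_
    rw [uIcc_of_le hab] at hr
    have h2 : ∫ s in a..r, {q : ℝ × ℝ | q.2 ≤ q.1}.indicator (Function.uncurry F) (s, r) = 0 := by
      rw [intervalIntegral.integral_congr_ae (g := fun _ => 0)]
      · simp
      · have : ∀ᵐ s : ℝ, s ≠ r := by simp [ae_iff]
        filter_upwards [this] with s hsr hs
        rw [uIoc_of_le hr.1] at hs
        exact indicator_of_notMem (by simpa using lt_of_le_of_ne hs.2 hsr) _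
    have hi : BddMeas fun s => {q : ℝ × ℝ | q.2 ≤ q.1}.indicator (Function.uncurry F) (s, r) :=
      (hF.indicator hT).comp measurable_prodMk_right
    rw [← intervalIntegral.integral_add_adjacent_intervals (hi.intervalIntegrable a r)
      (hi.intervalIntegrable r b), h2, zero_add]
    refine intervalIntegral.integral_congr fun s hs => ?_
    rw [uIcc_of_le hr.2] at hs
    exact (indicator_of_mem (s := {q : ℝ × ℝ | q.2 ≤ q.1}) (a := (s, r)) hs.1
      (Function.uncurry F)).symm

/-- The product rule for primitives of bounded measurable functions. -/
lemma mul_sub_mul_of_primitive {f g f' g' : ℝ → ℝ} {a b : ℝ} (hab : a ≤ b)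
    (hf' : BddMeas f') (hg' : BddMeas g')
    (hf : ∀ s ∈ Icc a b, f s - f a = ∫ r in a..s, f' r)
    (hg : ∀ s ∈ Icc a b, g s - g a = ∫ r in a..s, g' r) :
    f b * g b - f a * g a = ∫ s in a..b, (f' s * g s + f s * g' s) := by
  have hF : BddMeas (Function.uncurry fun s r => f' s * g' r) :=
    (hf'.comp measurable_fst).mul (hg'.comp measurable_snd)
  have h := integral_triangle_swap hF hab
  simp only [intervalIntegral.integral_const_mul, intervalIntegral.integral_mul_const] at h
  have h1 : ∫ s in a..b, f' s * ∫ r in a..s, g' r = ∫ s in a..b, (f' s * g s - f' s * g a) := by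
    refine intervalIntegral.integral_congr fun s hs => ?_
    rw [uIcc_of_le hab] at hs
    rw [← hg s hs]; ring
  have h2 : ∫ r in a..b, (∫ s in r..b, f' s) * g' r = ∫ r in a..b, (f b * g' r - f r * g' r) := by
    refine intervalIntegral.integral_congr fun s hs => ?_
    rw [uIcc_of_le hab] at hs
    rw [← intervalIntegral.integral_interval_sub_left (hf'.intervalIntegrable a b)
      (hf'.intervalIntegrable a s), ← hf b ⟨hab, le_rfl⟩, ← hf s hs]; ring
  -- `f` and `g` agree on `[a, b]` with functions whose products are integrable
  have hP : ∀ {u v : ℝ → ℝ}, BddMeas u → BddMeas v →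
      IntervalIntegrable (fun s => u s * ∫ r in a..s, v r) volume a b := by
    intro u v hu hv
    refine (hu.intervalIntegrable a b).mul_continuousOn ?_
    exact (intervalIntegral.continuous_primitive
      (fun c d => hv.intervalIntegrable c d) a).continuousOn
  have hI1 : IntervalIntegrable (fun s => f' s * g s) volume a b := by
    have := (hP hf' hg').add ((hf'.mul (BddMeas.const (g a))).intervalIntegrable a b)
    refine this.congr fun s hs => ?_
    rw [uIoc_of_le hab] at hs
    rw [← hg s (Ioc_subset_Icc_self hs)]; ring
  have hI2 : IntervalIntegrable (fun s => f s * g' s) volume a b := by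
    have := (hP hg' hf').add ((hg'.mul (BddMeas.const (f a))).intervalIntegrable a b)
    refine this.congr fun s hs => ?_
    rw [uIoc_of_le hab] at hs
    rw [← hf s (Ioc_subset_Icc_self hs)]; ring
  rw [h1, h2,
    intervalIntegral.integral_sub hI1 ((hf'.mul (BddMeas.const _)).intervalIntegrable a b),
    intervalIntegral.integral_sub (((BddMeas.const _).mul hg').intervalIntegrable a b) hI2,
    intervalIntegral.integral_mul_const, intervalIntegral.integral_const_mul,
    ← hf b ⟨hab, le_rfl⟩, ← hg b ⟨hab, le_rfl⟩] at h
  rw [intervalIntegral.integral_add hI1 hI2]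
  linear_combination -h

/-! ### Leibniz rule for functions that are absolutely continuous along lines -/

/-- Substitution along a curve whose derivative has constant sign; the integrand is arbitrary. -/
lemma integral_comp_mul_of_sign {β β' : ℝ → ℝ} (hβ : ∀ s, HasDerivAt β (β' s) s)
    (hs : (∀ s, 0 ≤ β' s) ∨ ∀ s, β' s ≤ 0) (f : ℝ → ℝ) (u v : ℝ) :
    ∫ s in u..v, f (β s) * β' s = ∫ c in β u..β v, f c := by
  have hc : ContinuousOn β (uIcc u v) := fun s _ => (hβ s).continuousAt.continuousWithinAt
  rcases hs with h | h
  · exact intervalIntegral.integral_comp_mul_deriv_of_deriv_nonneg hc (fun x _ => hβ x)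
      fun x _ => h x
  · exact intervalIntegral.integral_comp_mul_deriv_of_deriv_nonpos hc (fun x _ => hβ x)
      fun x _ => h x

lemma intervalIntegrable_integral_of_continuous {h : ℝ → ℝ → ℝ}
    (hh : BddMeas (Function.uncurry h)) {a b : ℝ} (hab : a ≤ b) {u v : ℝ → ℝ}
    (hu : Continuous u) (hv : Continuous v) :
    IntervalIntegrable (fun s => ∫ c in u s..v s, h s c) volume a b := by
  obtain ⟨M, hM⟩ := isCompact_Icc.exists_bound_of_continuousOn (s := Icc a b)
    (hv.sub hu).continuousOn
  have hcl : Continuous fun s : ℝ => max a (min s b) := by fun_prop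
  have this : BddMeas fun s => ∫ c in u (max a (min s b))..v (max a (min s b)), h s c :=
    BddMeas.intervalIntegral hh (hu.comp hcl).measurable (hv.comp hcl).measurable (L := M)
      fun s => hM _ ⟨le_max_left _ _, max_le hab (min_le_right _ _)⟩
  refine (this.intervalIntegrable a b).congr fun s hs => ?_
  rw [uIoc_of_le hab] at hs
  simp only [min_eq_left hs.2, max_eq_right hs.1.le]

/-- Leibniz rule with one moving boundary, for an integrand that is a primitive in `s`
for every `c`. -/
lemma leibniz_one_boundary {g₀ : ℝ → ℝ} {h : ℝ → ℝ → ℝ} (hg₀ : BddMeas g₀)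
    (hh : BddMeas (Function.uncurry h)) {a b : ℝ} (hab : a ≤ b) {β β' : ℝ → ℝ}
    (hβ : ∀ s, HasDerivAt β (β' s) s) (hβc : Continuous β')
    (hs : (∀ s, 0 ≤ β' s) ∨ ∀ s, β' s ≤ 0) :
    (∫ c in (0 : ℝ)..β b, (g₀ c + ∫ r in a..b, h r c)) - (∫ c in (0 : ℝ)..β a, g₀ c) =
      (∫ s in a..b, (g₀ (β s) + ∫ r in a..s, h r (β s)) * β' s)
        + ∫ s in a..b, ∫ c in (0 : ℝ)..β s, h s c := by
  have hβm : Continuous β := continuous_iff_continuousAt.2 fun s => (hβ s).continuousAt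
  have hhT : BddMeas (Function.uncurry fun c r => h r c) := hh.comp measurable_swap
  -- truncation of `β'` outside `[a, b]`, to be bounded
  obtain ⟨C, hC⟩ := isCompact_Icc.exists_bound_of_continuousOn (s := Icc a b) hβc.continuousOn
  set q : ℝ → ℝ := (Icc a b).indicator β' with hq
  have hqm : BddMeas q := BddMeas.of_indicator measurableSet_Icc
    (hβc.measurable.comp measurable_subtype_coe) hC
  have hqe : ∀ s ∈ Icc a b, q s = β' s := fun s hs => indicator_of_mem hs _
  have hin : ∀ c d : ℝ, IntervalIntegrable (fun c => ∫ r in a..b, h r c) volume c d := fun c d =>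
    (BddMeas.intervalIntegral hhT measurable_const measurable_const
      (fun _ => le_rfl)).intervalIntegrable c d
  rw [intervalIntegral.integral_add (hg₀.intervalIntegrable _ _) (hin _ _)]
  have e1 : (∫ c in (0 : ℝ)..β b, g₀ c) - ∫ c in (0 : ℝ)..β a, g₀ c =
      ∫ s in a..b, g₀ (β s) * β' s := by
    rw [integral_comp_mul_of_sign hβ hs, intervalIntegral.integral_interval_sub_left
      (hg₀.intervalIntegrable _ _) (hg₀.intervalIntegrable _ _)]
  have e2 : ∫ c in (0 : ℝ)..β b, ∫ r in a..b, h r c = ∫ r in a..b, ∫ c in (0 : ℝ)..β b, h r c :=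
    (BddMeas.swap hh a b 0 (β b)).symm
  have e3 : ∫ s in a..b, (∫ r in a..s, h r (β s)) * β' s =
      ∫ r in a..b, ∫ c in β r..β b, h r c := by
    have hF : BddMeas (Function.uncurry fun s r => h r (β s) * q s) :=
      (hh.comp (u := fun p : ℝ × ℝ => (p.2, β p.1))
        (measurable_snd.prodMk (hβm.measurable.comp measurable_fst))).mul
        (hqm.comp measurable_fst)
    have := integral_triangle_swap hF hab
    simp only [intervalIntegral.integral_mul_const] at this
    refine Eq.trans ?_ (this.trans ?_)
    · refine intervalIntegral.integral_congr fun s hs => ?_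
      rw [uIcc_of_le hab] at hs
      simp only [hqe s hs]
    · refine intervalIntegral.integral_congr fun r hr => ?_
      rw [uIcc_of_le hab] at hr
      rw [← integral_comp_mul_of_sign hβ hs (fun c => h r c) r b]
      refine intervalIntegral.integral_congr fun s hs => ?_
      rw [uIcc_of_le hr.2] at hs
      simp only [hqe s ⟨hr.1.trans hs.1, hs.2⟩]
  have hr : ∀ r, BddMeas (h r) := fun r => hh.comp measurable_prodMk_left
  have i1 : IntervalIntegrable (fun s => ∫ c in (0 : ℝ)..β s, h s c) volume a b :=
    intervalIntegrable_integral_of_continuous hh hab continuous_const hβm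
  have i2 : IntervalIntegrable (fun s => ∫ c in β s..β b, h s c) volume a b :=
    intervalIntegrable_integral_of_continuous hh hab hβm continuous_const
  have i3 : IntervalIntegrable (fun s => g₀ (β s) * β' s) volume a b := by
    have : BddMeas fun s => g₀ (β s) := hg₀.comp hβm.measurable
    exact (this.intervalIntegrable a b).mul_continuousOn hβc.continuousOn
  have i4 : IntervalIntegrable (fun s => (∫ r in a..s, h r (β s)) * β' s) volume a b := by
    have : IntervalIntegrable (fun s => ∫ r in a..s, h r (β s)) volume a b :=
      intervalIntegrable_integral_of_continuous (h := fun s r => h r (β s))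
        (hh.comp (u := fun p : ℝ × ℝ => (p.2, β p.1))
          (measurable_snd.prodMk (hβm.measurable.comp measurable_fst)))
        hab continuous_const continuous_id
    exact this.mul_continuousOn hβc.continuousOn
  have e4 : ∫ r in a..b, ∫ c in (0 : ℝ)..β b, h r c =
      (∫ s in a..b, ∫ c in (0 : ℝ)..β s, h s c) + ∫ r in a..b, ∫ c in β r..β b, h r c := by
    rw [← intervalIntegral.integral_add i1 i2]
    refine intervalIntegral.integral_congr fun r _ => ?_
    exact (intervalIntegral.integral_add_adjacent_intervals ((hr r).intervalIntegrable _ _)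
      ((hr r).intervalIntegrable _ _)).symm
  have e5 : ∫ s in a..b, (g₀ (β s) + ∫ r in a..s, h r (β s)) * β' s =
      (∫ s in a..b, g₀ (β s) * β' s) + ∫ s in a..b, (∫ r in a..s, h r (β s)) * β' s := by
    rw [← intervalIntegral.integral_add i3 i4]
    simp only [add_mul]
  rw [e5, e3, e2, e4]
  linear_combination e1

/-- Leibniz rule for `∫ c in α s..β s, G s c` when `G` is absolutely continuous with derivative `H`
along the lines `c = const`, as long as they stay in the region `α s ≤ c ≤ β s`. No regularity of
`G` across the lines is needed.

Every line meets the region in an interval. Extending `G` beyond this interval by constants gives a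
function that is a primitive in `s` on all of `[a, b]`, to which `leibniz_one_boundary` applies. -/
lemma leibniz_two_boundaries {G H : ℝ → ℝ → ℝ} (hGm : BddMeas (Function.uncurry G))
    (hHm : BddMeas (Function.uncurry H)) {a b : ℝ} (hab : a ≤ b) {α α' β β' : ℝ → ℝ}
    (hα : ∀ s, HasDerivAt α (α' s) s) (hαc : Continuous α')
    (hαs : (∀ s, 0 ≤ α' s) ∨ ∀ s, α' s ≤ 0)
    (hβ : ∀ s, HasDerivAt β (β' s) s) (hβc : Continuous β')
    (hβs : (∀ s, 0 ≤ β' s) ∨ ∀ s, β' s ≤ 0)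
    (hle : ∀ s ∈ Icc a b, α s ≤ β s)
    (hG : ∀ c, ∀ s₁ ∈ Icc a b, ∀ s₂ ∈ Icc a b, s₁ ≤ s₂ →
      (∀ s ∈ Icc s₁ s₂, α s ≤ c ∧ c ≤ β s) → G s₂ c - G s₁ c = ∫ s in s₁..s₂, H s c) :
    (∫ c in α b..β b, G b c) - (∫ c in α a..β a, G a c) =
      (∫ s in a..b, G s (β s) * β' s) - (∫ s in a..b, G s (α s) * α' s)
        + ∫ s in a..b, ∫ c in α s..β s, H s c := by
  have mono : ∀ {f f' : ℝ → ℝ}, (∀ s, HasDerivAt f (f' s) s) →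
      ((∀ s, 0 ≤ f' s) ∨ ∀ s, f' s ≤ 0) → Monotone f ∨ Antitone f := by
    intro f f' hf h
    have hd : Differentiable ℝ f := fun s => (hf s).differentiableAt
    rcases h with h | h
    · exact Or.inl (monotone_of_deriv_nonneg hd fun s => (hf s).deriv ▸ h s)
    · exact Or.inr (antitone_of_deriv_nonpos hd fun s => (hf s).deriv ▸ h s)
  have hαm : Continuous α := continuous_iff_continuousAt.2 fun s => (hα s).continuousAt
  have hβm : Continuous β := continuous_iff_continuousAt.2 fun s => (hβ s).continuousAt
  set D : Set (ℝ × ℝ) := {q | q.1 ∈ Icc a b ∧ α q.1 ≤ q.2 ∧ q.2 ≤ β q.1} with hD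
  have hDcl : IsClosed D :=
    (isClosed_Icc.preimage continuous_fst).inter
      ((isClosed_le (hαm.comp continuous_fst) continuous_snd).inter
        (isClosed_le continuous_snd (hβm.comp continuous_fst)))
  have hDco : IsCompact D := by
    obtain ⟨M, hM⟩ := isCompact_Icc.exists_bound_of_continuousOn (s := Icc a b) hαm.continuousOn
    obtain ⟨N, hN⟩ := isCompact_Icc.exists_bound_of_continuousOn (s := Icc a b) hβm.continuousOn
    refine (isCompact_Icc (a := a) (b := b) |>.prod (isCompact_Icc (a := -M) (b := N)))
      |>.of_isClosed_subset hDcl ?_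
    rintro ⟨s, c⟩ ⟨hs, h1, h2⟩
    exact ⟨hs, (neg_le_of_abs_le (hM s hs)).trans h1, h2.trans (le_of_abs_le (hN s hs))⟩
  -- `α` and `β` are monotone, so a line `c = const` meets the region in an interval
  have hconv : ∀ c s₁ s₂, (s₁, c) ∈ D → (s₂, c) ∈ D → ∀ s ∈ Icc s₁ s₂, (s, c) ∈ D := by
    rintro c s₁ s₂ ⟨h1, h1α, h1β⟩ ⟨h2, h2α, h2β⟩ s hs
    refine ⟨⟨h1.1.trans hs.1, hs.2.trans h2.2⟩, ?_, ?_⟩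
    · rcases mono hα hαs with h | h
      · exact (h hs.2).trans h2α
      · exact (h hs.1).trans h1α
    · rcases mono hβ hβs with h | h
      · exact h1β.trans (h hs.1)
      · exact h2β.trans (h hs.2)
  -- the point at which the line `c` enters the region
  set l : ℝ → ℝ := fun c => sInf {s | (s, c) ∈ D} with hl
  have hDc : ∀ c, IsCompact {s | (s, c) ∈ D} := fun c => by
    refine isCompact_Icc.of_isClosed_subset (hDcl.preimage (by fun_prop)) fun s hs => hs.1
  have hlD : ∀ s c, (s, c) ∈ D → (l c, c) ∈ D ∧ l c ≤ s := fun s c h =>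
    ⟨(hDc c).sInf_mem ⟨s, h⟩, csInf_le (hDc c).bddBelow h⟩
  have hproj : MeasurableSet (Prod.snd '' D) :=
    (hDco.image continuous_snd).isClosed.measurableSet
  -- sublevel sets of `l` are projections of compact sets, up to the lines that miss the region,
  -- where `l` is `sInf ∅ = 0`
  have hlm : Measurable l := by
    refine measurable_of_Iic fun x => ?_
    have : l ⁻¹' Iic x = (Prod.snd '' (D ∩ {q | q.1 ≤ x})) ∪
        ((Prod.snd '' D)ᶜ ∩ {_c | (0 : ℝ) ≤ x}) := by
      ext c
      by_cases hc : ∃ s, (s, c) ∈ D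
      · obtain ⟨s, hs⟩ := hc
        have h1 : c ∈ Prod.snd '' D := ⟨(s, c), hs, rfl⟩
        simp only [mem_preimage, mem_Iic, mem_union, mem_inter_iff, mem_compl_iff, h1,
          not_true_eq_false, false_and, or_false]
        constructor
        · intro h
          exact ⟨(l c, c), ⟨(hlD s c hs).1, h⟩, rfl⟩
        · rintro ⟨⟨s', c'⟩, ⟨h, h'⟩, rfl⟩
          exact (hlD s' c' h).2.trans h'
      · have h1 : c ∉ Prod.snd '' D := by
          rintro ⟨⟨s, c'⟩, h, rfl⟩
          exact hc ⟨s, h⟩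
        have h2 : c ∉ Prod.snd '' (D ∩ {q | q.1 ≤ x}) := fun h =>
          h1 (image_mono inter_subset_left h)
        have h3 : l c = 0 := by
          have : {s | (s, c) ∈ D} = ∅ := eq_empty_of_forall_notMem fun s hs => hc ⟨s, hs⟩
          simp only [hl, this, Real.sInf_empty]
        simp only [mem_preimage, mem_Iic, mem_union, mem_inter_iff, mem_compl_iff, h1, h2, h3,
          not_false_eq_true, true_and, false_or, mem_ofPred_eq]
    rw [this]
    refine MeasurableSet.union ?_ (hproj.compl.inter (MeasurableSet.const _))
    exact ((hDco.inter_right (isClosed_le continuous_fst continuous_const)).image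
      continuous_snd).isClosed.measurableSet
  -- the extension of `G` is `g₀ c + ∫ r in a..s, h r c`: it stays at the entry value `G (l c) c`
  -- until the line enters the region and is constant again once the line has left it
  set g₀ : ℝ → ℝ := (Prod.snd '' D).indicator fun c => G (l c) c with hg₀
  set h : ℝ → ℝ → ℝ := fun s c => D.indicator (Function.uncurry H) (s, c) with hh
  have hg₀m : BddMeas g₀ := (hGm.comp (hlm.prodMk measurable_id)).indicator hproj
  have hhm : BddMeas (Function.uncurry h) := hHm.indicator hDcl.measurableSet
  have hr : ∀ c, BddMeas fun r => h r c := fun c => hhm.comp measurable_prodMk_right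
  have hr' : ∀ s, BddMeas (h s) := fun s => hhm.comp measurable_prodMk_left
  have key : ∀ s c, (s, c) ∈ D → g₀ c + ∫ r in a..s, h r c = G s c := by
    intro s c hsc
    obtain ⟨h1, h2⟩ := hlD s c hsc
    have e0 : g₀ c = G (l c) c := indicator_of_mem (mem_image_of_mem Prod.snd hsc) _
    have e1 : ∫ r in a..l c, h r c = 0 := by
      rw [intervalIntegral.integral_congr_ae (g := fun _ => 0)]
      · simp
      · have : ∀ᵐ r : ℝ, r ≠ l c := by simp [ae_iff]
        filter_upwards [this] with r hne hr
        rw [uIoc_of_le h1.1.1] at hr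
        refine indicator_of_notMem (fun hmem => hne ?_) _
        exact le_antisymm hr.2 (hlD r c hmem).2
    have e2 : ∫ r in l c..s, h r c = ∫ r in l c..s, H r c := by
      refine intervalIntegral.integral_congr fun r hr => ?_
      rw [uIcc_of_le h2] at hr
      exact indicator_of_mem (hconv c _ _ h1 hsc r hr) (Function.uncurry H)
    rw [← intervalIntegral.integral_add_adjacent_intervals ((hr c).intervalIntegrable a (l c))
      ((hr c).intervalIntegrable (l c) s), e1, e2, e0, zero_add,
      ← hG c _ h1.1 _ hsc.1 h2 fun r hr => (hconv c _ _ h1 hsc r hr).2]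
    ring
  have hB := leibniz_one_boundary hg₀m hhm hab hβ hβc hβs
  have hA := leibniz_one_boundary hg₀m hhm hab hα hαc hαs
  have hin : BddMeas fun c => g₀ c + ∫ r in a..b, h r c :=
    hg₀m.add (BddMeas.intervalIntegral (F := fun c r => h r c) (hhm.comp measurable_swap)
      measurable_const measurable_const fun _ => le_rfl)
  have a_mem : a ∈ Icc a b := ⟨le_rfl, hab⟩
  have b_mem : b ∈ Icc a b := ⟨hab, le_rfl⟩
  have f1 : ∫ c in α b..β b, G b c = (∫ c in (0 : ℝ)..β b, (g₀ c + ∫ r in a..b, h r c)) -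
      ∫ c in (0 : ℝ)..α b, (g₀ c + ∫ r in a..b, h r c) := by
    rw [intervalIntegral.integral_interval_sub_left (hin.intervalIntegrable _ _)
      (hin.intervalIntegrable _ _)]
    refine intervalIntegral.integral_congr fun c hc => ?_
    rw [uIcc_of_le (hle b b_mem)] at hc
    exact (key b c ⟨b_mem, hc.1, hc.2⟩).symm
  have f2 : ∫ c in α a..β a, G a c = (∫ c in (0 : ℝ)..β a, g₀ c) - ∫ c in (0 : ℝ)..α a, g₀ c := by
    rw [intervalIntegral.integral_interval_sub_left (hg₀m.intervalIntegrable _ _)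
      (hg₀m.intervalIntegrable _ _)]
    refine intervalIntegral.integral_congr fun c hc => ?_
    rw [uIcc_of_le (hle a a_mem)] at hc
    have := key a c ⟨a_mem, hc.1, hc.2⟩
    rw [intervalIntegral.integral_same, add_zero] at this
    exact this.symm
  have f3 : ∫ s in a..b, G s (β s) * β' s =
      ∫ s in a..b, (g₀ (β s) + ∫ r in a..s, h r (β s)) * β' s := by
    refine intervalIntegral.integral_congr fun s hs => ?_
    rw [uIcc_of_le hab] at hs
    simp only [key s (β s) ⟨hs, hle s hs, le_rfl⟩]
  have f4 : ∫ s in a..b, G s (α s) * α' s =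
      ∫ s in a..b, (g₀ (α s) + ∫ r in a..s, h r (α s)) * α' s := by
    refine intervalIntegral.integral_congr fun s hs => ?_
    rw [uIcc_of_le hab] at hs
    simp only [key s (α s) ⟨hs, le_rfl, hle s hs⟩]
  have f5 : ∫ s in a..b, ∫ c in α s..β s, H s c =
      (∫ s in a..b, ∫ c in (0 : ℝ)..β s, h s c) - ∫ s in a..b, ∫ c in (0 : ℝ)..α s, h s c := by
    rw [← intervalIntegral.integral_sub
      (intervalIntegrable_integral_of_continuous hhm hab continuous_const hβm)
      (intervalIntegrable_integral_of_continuous hhm hab continuous_const hαm)]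
    refine intervalIntegral.integral_congr fun s hs => ?_
    rw [uIcc_of_le hab] at hs
    rw [intervalIntegral.integral_interval_sub_left ((hr' s).intervalIntegrable _ _)
      ((hr' s).intervalIntegrable _ _)]
    refine intervalIntegral.integral_congr fun c hc => ?_
    rw [uIcc_of_le (hle s hs)] at hc
    exact (indicator_of_mem (show (s, c) ∈ D from ⟨hs, hc.1, hc.2⟩) (Function.uncurry H)).symm
  rw [f1, f2, f3, f4, f5]
  linear_combination hB - hA

/-! ### Volterra equations of the second kind -/

/-- The triangle `0 ≤ ζ ≤ z ≤ 1` on which kernels are given. -/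
def triangle : Set (ℝ × ℝ) := {q | 0 ≤ q.2 ∧ q.2 ≤ q.1 ∧ q.1 ≤ 1}

lemma measurableSet_triangle : MeasurableSet triangle :=
  (measurableSet_le measurable_const measurable_snd).inter
    ((measurableSet_le measurable_snd measurable_fst).inter
      (measurableSet_le measurable_fst measurable_const))

/-- The entry `(k, j)` of a kernel, extended by zero from the triangle to the plane. -/
noncomputable def extK (K : ℝ → ℝ → Matrix Idx Idx ℝ) (k j : Idx) (z ζ : ℝ) : ℝ :=
  triangle.indicator (fun q : ℝ × ℝ => K q.1 q.2 k j) (z, ζ)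

lemma extK_of_mem {K : ℝ → ℝ → Matrix Idx Idx ℝ} {k j : Idx} {z ζ : ℝ} (h0 : 0 ≤ ζ) (h : ζ ≤ z)
    (h1 : z ≤ 1) : extK K k j z ζ = K z ζ k j :=
  indicator_of_mem (show (z, ζ) ∈ triangle from ⟨h0, h, h1⟩) _

lemma RiemannSystem.IsKernel.bddMeas_extK {S : RiemannSystem} {K : ℝ → ℝ → Matrix Idx Idx ℝ}
    (hK : S.IsKernel K) (k j : Idx) : BddMeas (Function.uncurry (extK K k j)) := by
  obtain ⟨C, hC⟩ := hK.bounded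
  exact BddMeas.of_indicator measurableSet_triangle (hK.measurable k j)
    fun q hq => hC q.1 q.2 hq.1 hq.2.1 hq.2.2 k j

/-- The integral part of the Volterra transformation. -/
noncomputable def volterraInt (K : ℝ → ℝ → Matrix Idx Idx ℝ) (x : Idx → ℝ → ℝ) (k : Idx)
    (z : ℝ) : ℝ :=
  ∫ ζ in (0 : ℝ)..1, ∑ j, extK K k j z ζ * x j ζ

lemma integral_kernel_eq_volterraInt (K : ℝ → ℝ → Matrix Idx Idx ℝ) (x : Idx → ℝ → ℝ) (k : Idx)
    {z : ℝ} (hz : z ∈ Icc (0 : ℝ) 1) :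
    ∫ ζ in (0 : ℝ)..z, ∑ j, K z ζ k j * x j ζ = volterraInt K x k z := by
  have h1 : ∫ ζ in (0 : ℝ)..z, ∑ j, K z ζ k j * x j ζ =
      ∫ ζ in (0 : ℝ)..z, ∑ j, extK K k j z ζ * x j ζ := by
    refine intervalIntegral.integral_congr fun ζ hζ => ?_
    rw [uIcc_of_le hz.1] at hζ
    exact Finset.sum_congr rfl fun j _ => by rw [extK_of_mem hζ.1 hζ.2 hz.2]
  rw [h1, volterraInt, intervalIntegral.integral_of_le hz.1,
    intervalIntegral.integral_of_le zero_le_one]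
  refine (setIntegral_eq_of_subset_of_forall_sdiff_eq_zero measurableSet_Ioc
    (Ioc_subset_Ioc_right hz.2) fun ζ hζ => ?_).symm
  have : ∀ j, extK K k j z ζ = 0 := fun j =>
    indicator_of_notMem (fun h => hζ.2 ⟨hζ.1.1, h.2.1⟩) _
  simp [this]

lemma RiemannSystem.volterra_eq (K : ℝ → ℝ → Matrix Idx Idx ℝ) (x : Idx → ℝ → ℝ) (k : Idx)
    {z : ℝ} (hz : z ∈ Icc (0 : ℝ) 1) :
    RiemannSystem.volterra K x k z = x k z - volterraInt K x k z := by
  rw [RiemannSystem.volterra, integral_kernel_eq_volterraInt K x k hz]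

/-- In the weighted norm `sup |w k z| exp (-8 C z)` the Volterra operator with a `4 × 4` kernel
bounded by `C` is a contraction with constant `1 / 2`. -/
lemma abs_volterraInt_le {K : ℝ → ℝ → Matrix Idx Idx ℝ} {C : ℝ} (hC0 : 0 ≤ C)
    (hC : ∀ z ζ : ℝ, 0 ≤ ζ → ζ ≤ z → z ≤ 1 → ∀ k j, |K z ζ k j| ≤ C) {w : Idx → ℝ → ℝ} {N : ℝ}
    (hw : ∀ j, ∀ ζ ∈ Icc (0 : ℝ) 1, |w j ζ| ≤ N * Real.exp (8 * C * ζ)) (k : Idx) {z : ℝ}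
    (hz : z ∈ Icc (0 : ℝ) 1) :
    |volterraInt K w k z| ≤ N / 2 * Real.exp (8 * C * z) := by
  have hN : 0 ≤ N := by
    have := (abs_nonneg _).trans (hw k 0 ⟨le_rfl, zero_le_one⟩)
    simpa using this
  rw [← integral_kernel_eq_volterraInt K w k hz]
  have hd : ∀ ζ : ℝ, HasDerivAt (fun ζ => N / 2 * Real.exp (8 * C * ζ))
      (4 * C * N * Real.exp (8 * C * ζ)) ζ := fun ζ => by
    have := (((hasDerivAt_id ζ).const_mul (8 * C)).exp).const_mul (N / 2)
    exact this.congr_deriv (by simp only [id_eq]; ring)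
  have hint : ∫ ζ in (0 : ℝ)..z, 4 * C * N * Real.exp (8 * C * ζ) =
      N / 2 * Real.exp (8 * C * z) - N / 2 := by
    rw [intervalIntegral.integral_eq_sub_of_hasDerivAt (fun ζ _ => hd ζ)
      (Continuous.intervalIntegrable (by fun_prop) _ _)]
    simp
  have := intervalIntegral.norm_integral_le_of_norm_le (μ := volume)
    (f := fun ζ => ∑ j, K z ζ k j * w j ζ) (g := fun ζ => 4 * C * N * Real.exp (8 * C * ζ)) hz.1
    (Filter.Eventually.of_forall fun ζ hζ => ?_)
    (Continuous.intervalIntegrable (by fun_prop) _ _)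
  · rw [hint] at this
    rw [← Real.norm_eq_abs]
    linarith
  · have h1 : ∀ j : Idx, |K z ζ k j * w j ζ| ≤ C * (N * Real.exp (8 * C * ζ)) := fun j => by
      rw [abs_mul]
      exact mul_le_mul (hC z ζ hζ.1.le hζ.2 hz.2 k j) (hw j ζ ⟨hζ.1.le, hζ.2.trans hz.2⟩)
        (abs_nonneg _) hC0
    refine (Finset.abs_sum_le_sum_abs _ _).trans ((Finset.sum_le_sum fun j _ => h1 j).trans ?_)
    rw [Finset.sum_const, Finset.card_univ, Fintype.card_sum, Fintype.card_fin, nsmul_eq_mul]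
    push_cast
    nlinarith

/-- Stability of the inverse Volterra transformation (Gronwall's inequality). -/
lemma abs_le_of_volterra_le {K : ℝ → ℝ → Matrix Idx Idx ℝ} {C : ℝ} (hC0 : 0 ≤ C)
    (hC : ∀ z ζ : ℝ, 0 ≤ ζ → ζ ≤ z → z ≤ 1 → ∀ k j, |K z ζ k j| ≤ C) {d : Idx → ℝ → ℝ} {R : ℝ}
    (hR : ∀ k, ∀ z ∈ Icc (0 : ℝ) 1, |d k z| ≤ R) {ε : ℝ}
    (hε : ∀ k, ∀ z ∈ Icc (0 : ℝ) 1, |RiemannSystem.volterra K d k z| ≤ ε) (k : Idx) {z : ℝ}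
    (hz : z ∈ Icc (0 : ℝ) 1) : |d k z| ≤ 2 * ε * Real.exp (8 * C) := by
  set V : Set ℝ := {r | ∃ k, ∃ z ∈ Icc (0 : ℝ) 1, r = |d k z| * Real.exp (-(8 * C * z))} with hV
  have hbdd : BddAbove V := by
    refine ⟨R, ?_⟩
    rintro _ ⟨k, z, hz, rfl⟩
    have h1 : Real.exp (-(8 * C * z)) ≤ 1 :=
      Real.exp_le_one_iff.2 (by nlinarith [mul_nonneg hC0 hz.1])
    exact (mul_le_of_le_one_right (abs_nonneg _) h1).trans (hR k z hz)
  set N := sSup V with hN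
  have hle : ∀ k, ∀ z ∈ Icc (0 : ℝ) 1, |d k z| ≤ N * Real.exp (8 * C * z) := by
    intro k z hz
    have h : |d k z| * Real.exp (-(8 * C * z)) ≤ N := le_csSup hbdd ⟨k, z, hz, rfl⟩
    rwa [Real.exp_neg, ← div_eq_mul_inv, div_le_iff₀ (Real.exp_pos _)] at h
  have hε0 : 0 ≤ ε := (abs_nonneg _).trans (hε k z hz)
  have hNe : N ≤ ε + N / 2 := by
    refine csSup_le ⟨_, k, z, hz, rfl⟩ ?_
    rintro _ ⟨k, z, hz, rfl⟩
    have h1 := abs_volterraInt_le hC0 hC hle k hz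
    have h2 := hε k z hz
    rw [RiemannSystem.volterra_eq K d k hz] at h2
    have h3 : |d k z| ≤ ε + N / 2 * Real.exp (8 * C * z) := by
      have := abs_add_le (d k z - volterraInt K d k z) (volterraInt K d k z)
      rw [sub_add_cancel] at this
      linarith
    have h4 : 1 ≤ Real.exp (8 * C * z) := Real.one_le_exp (by nlinarith [mul_nonneg hC0 hz.1])
    rw [Real.exp_neg, ← div_eq_mul_inv, div_le_iff₀ (Real.exp_pos _)]
    nlinarith
  refine (hle k z hz).trans (mul_le_mul (by linarith) ?_ (Real.exp_pos _).le (by linarith))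
  exact Real.exp_le_exp.2 (by nlinarith [hz.1, hz.2])

/-- A Volterra equation of the second kind with bounded Borel kernel and right-hand side has a
bounded Borel solution, the limit of the Picard iterates. -/
lemma exists_volterra_eq {K : ℝ → ℝ → Matrix Idx Idx ℝ} {C : ℝ} (hC0 : 0 ≤ C)
    (hC : ∀ z ζ : ℝ, 0 ≤ ζ → ζ ≤ z → z ≤ 1 → ∀ k j, |K z ζ k j| ≤ C)
    (hKm : ∀ k j, BddMeas (Function.uncurry (extK K k j))) {f : Idx → ℝ → ℝ}
    (hf : ∀ k, BddMeas (f k)) :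
    ∃ d : Idx → ℝ → ℝ, (∀ k, BddMeas (d k)) ∧
      ∀ k, ∀ z ∈ Icc (0 : ℝ) 1, RiemannSystem.volterra K d k z = f k z := by
  set D : ℕ → Idx → ℝ → ℝ := fun n => Nat.rec f (fun _ w k z => f k z + volterraInt K w k z) n
    with hD
  have hD0 : D 0 = f := rfl
  have hDs : ∀ n k z, D (n + 1) k z = f k z + volterraInt K (D n) k z := fun n k z => rfl
  have hint : ∀ w : Idx → ℝ → ℝ, (∀ j, BddMeas (w j)) → ∀ k,
      BddMeas (Function.uncurry fun z ζ => ∑ j, extK K k j z ζ * w j ζ) := fun w hw k =>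
    BddMeas.sum fun j _ => (hKm k j).mul ((hw j).comp measurable_snd)
  have hDm : ∀ n k, BddMeas (D n k) := by
    intro n
    induction n with
    | zero => exact hf
    | succ n ih =>
      intro k
      exact (hf k).add (BddMeas.intervalIntegral (hint _ ih k) measurable_const measurable_const
        fun _ => le_rfl)
  have hlin : ∀ v w : Idx → ℝ → ℝ, (∀ j, BddMeas (v j)) → (∀ j, BddMeas (w j)) → ∀ k z,
      volterraInt K v k z - volterraInt K w k z = volterraInt K (fun j ζ => v j ζ - w j ζ) k z := by
    intro v w hv hw k z
    have e : ∀ {u : Idx → ℝ → ℝ}, (∀ j, BddMeas (u j)) →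
        IntervalIntegrable (fun ζ => ∑ j, extK K k j z ζ * u j ζ) volume 0 1 := fun hu =>
      ((hint _ hu k).comp measurable_prodMk_left).intervalIntegrable 0 1
    rw [volterraInt, volterraInt, ← intervalIntegral.integral_sub (e hv) (e hw), volterraInt]
    simp only [← Finset.sum_sub_distrib, mul_sub]
  have hzero : ∀ (w : Idx → ℝ → ℝ) k z, z ∉ Icc (0 : ℝ) 1 → volterraInt K w k z = 0 := by
    intro w k z hz
    have : ∀ j ζ, extK K k j z ζ = 0 := fun j ζ =>
      indicator_of_notMem (fun h => hz ⟨h.1.trans h.2.1, h.2.2⟩) _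
    simp [volterraInt, this]
  obtain ⟨N, hN⟩ : ∃ N, ∀ k z, |D 1 k z - D 0 k z| ≤ N := by
    choose N hN using fun k => ((hDm 1 k).sub (hDm 0 k)).2
    exact ⟨∑ k, |N k|, fun k z => (hN k z).trans ((le_abs_self _).trans
      (Finset.single_le_sum (f := fun k => |N k|) (fun k _ => abs_nonneg _) (Finset.mem_univ k)))⟩
  have hN0 : 0 ≤ N := (abs_nonneg _).trans (hN (Sum.inl 0) 0)
  -- in the norm weighted by `exp (-8 C z)` the integral operator is a contraction by `1 / 2`
  have hstep : ∀ n k, ∀ z ∈ Icc (0 : ℝ) 1,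
      |D (n + 1) k z - D n k z| ≤ N / 2 ^ n * Real.exp (8 * C * z) := by
    intro n
    induction n with
    | zero =>
      intro k z hz
      have h4 : 1 ≤ Real.exp (8 * C * z) := Real.one_le_exp (by nlinarith [mul_nonneg hC0 hz.1])
      have := hN k z
      simp only [zero_add, pow_zero, div_one]
      nlinarith
    | succ n ih =>
      intro k z hz
      rw [hDs (n + 1), hDs n, add_sub_add_left_eq_sub,
        hlin (D (n + 1)) (D n) (hDm (n + 1)) (hDm n)]
      refine (abs_volterraInt_le hC0 hC ih k hz).trans (le_of_eq ?_)
      rw [pow_succ, div_div]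
  have hstep2 : ∀ k z n, dist (D n k z) (D (n + 1) k z) ≤
      2 * (N * Real.exp (8 * C)) / 2 / 2 ^ n := by
    intro k z n
    rw [dist_comm, Real.dist_eq]
    have e : 2 * (N * Real.exp (8 * C)) / 2 / 2 ^ n = N / 2 ^ n * Real.exp (8 * C) := by ring
    rw [e]
    by_cases hz : z ∈ Icc (0 : ℝ) 1
    · refine (hstep n k z hz).trans (mul_le_mul_of_nonneg_left ?_ (by positivity))
      exact Real.exp_le_exp.2 (by nlinarith [hz.1, hz.2])
    · cases n with
      | zero =>
        rw [hDs 0, hzero _ _ _ hz, hD0]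
        simp only [add_zero, sub_self, abs_zero]
        positivity
      | succ n =>
        rw [hDs (n + 1), hDs n, hzero _ _ _ hz, hzero _ _ _ hz]
        simp only [sub_self, abs_zero]
        positivity
  choose d hd using fun k z => cauchySeq_tendsto_of_complete
    (cauchySeq_of_le_geometric_two (hstep2 k z))
  have hDd : ∀ n k z, |D n k z - d k z| ≤ 2 * (N * Real.exp (8 * C)) / 2 ^ n := fun n k z =>
    dist_le_of_le_geometric_two_of_tendsto (hstep2 k z) (hd k z) n
  choose B hB using fun k => (hf k).2
  have hdm : ∀ k, BddMeas (d k) := fun k => by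
    refine ⟨measurable_of_tendsto_metrizable (fun n => (hDm n k).1)
      (tendsto_pi_nhds.2 fun z => hd k z), B k + 2 * (N * Real.exp (8 * C)), fun z => ?_⟩
    have h1 := hDd 0 k z
    rw [hD0, pow_zero, div_one] at h1
    have h2 := abs_sub_abs_le_abs_sub (d k z) (f k z)
    rw [abs_sub_comm] at h2
    linarith [hB k z]
  refine ⟨d, hdm, fun k z hz => ?_⟩
  -- the integral operator is Lipschitz for the sup norm, so it commutes with the limit
  have hlim : Filter.Tendsto (fun n => volterraInt K (D n) k z) Filter.atTop
      (nhds (volterraInt K d k z)) := by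
    rw [tendsto_iff_dist_tendsto_zero]
    have hpow : Filter.Tendsto (fun n : ℕ => 2 * (N * Real.exp (8 * C)) / 2 ^ n / 2
        * Real.exp (8 * C * z)) Filter.atTop (nhds 0) := by
      have h := tendsto_pow_atTop_nhds_zero_of_lt_one (r := (1 / 2 : ℝ)) (by norm_num) (by norm_num)
      have h2 := h.const_mul (2 * (N * Real.exp (8 * C)) / 2 * Real.exp (8 * C * z))
      rw [mul_zero] at h2
      refine h2.congr fun n => ?_
      rw [one_div, inv_pow]
      ring
    refine squeeze_zero (fun _ => dist_nonneg) (fun n => ?_) hpow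
    rw [Real.dist_eq, hlin _ _ (hDm n) hdm]
    refine abs_volterraInt_le hC0 hC (fun j ζ hζ => (hDd n j ζ).trans ?_) k hz
    have h4 : 1 ≤ Real.exp (8 * C * ζ) := Real.one_le_exp (by nlinarith [mul_nonneg hC0 hζ.1])
    exact le_mul_of_one_le_right (by positivity) h4
  have h1 : Filter.Tendsto (fun n => D (n + 1) k z) Filter.atTop
      (nhds (f k z + volterraInt K d k z)) := by
    simp only [hDs]
    exact hlim.const_add _
  have h2 := tendsto_nhds_unique ((Filter.tendsto_add_atTop_iff_nat 1).2 (hd k z)) h1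
  rw [RiemannSystem.volterra_eq K d k hz, h2]
  ring

/-! ### Transport speeds and travel times on the whole line -/

/-- The sign of the velocity of a Riemann coordinate, as it enters `slam` and `sphi`. -/
def sgn : Idx → ℝ := Sum.elim (fun _ => 1) fun _ => -1

/-- The family (`0` or `1`) of a Riemann coordinate. -/
def fam : Idx → Fin 2 := Sum.elim id id

lemma sgn_mul_self (j : Idx) : sgn j * sgn j = 1 := by
  rcases j with j | j <;> simp [sgn]

lemma sgn_eq (j : Idx) : sgn j = 1 ∨ sgn j = -1 := by
  rcases j with j | j <;> simp [sgn]

lemma sgn_ne_zero (j : Idx) : sgn j ≠ 0 := by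
  rcases j with j | j <;> simp [sgn]

namespace RiemannSystem

variable (S : RiemannSystem)

lemma slam_eq (j : Idx) (z : ℝ) : S.slam j z = sgn j * S.lam (fam j) z := by
  rcases j with j | j <;> simp [sgn, fam, slam]

lemma sphi_eq (j : Idx) (z : ℝ) : S.sphi j z = sgn j * S.phi (fam j) z := by
  rcases j with j | j <;> simp [sgn, fam, sphi]

/-- `λ_i`, continued to the real line by its boundary values. -/
noncomputable def lamE (i : Fin 2) (z : ℝ) : ℝ := S.lam i (max 0 (min z 1))

lemma clamp_mem (z : ℝ) : max 0 (min z 1) ∈ Icc (0 : ℝ) 1 :=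
  ⟨le_max_left _ _, max_le zero_le_one (min_le_right _ _)⟩

lemma lamE_eq {z : ℝ} (hz : z ∈ Icc (0 : ℝ) 1) (i : Fin 2) : S.lamE i z = S.lam i z := by
  rw [lamE, min_eq_left hz.2, max_eq_right hz.1]

lemma continuous_lamE (i : Fin 2) : Continuous (S.lamE i) :=
  (S.lam_contDiffOn i).continuousOn.comp_continuous (by fun_prop) clamp_mem

lemma lamE_lt (z : ℝ) : S.lamE 1 z < S.lamE 0 z := S.lam_lt _ (clamp_mem z)

lemma lamE_pos (i : Fin 2) (z : ℝ) : 0 < S.lamE i z := by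
  have h := S.lam_pos _ (clamp_mem z)
  fin_cases i
  · exact h.trans (S.lamE_lt z)
  · exact h

lemma exists_lamE_le (i : Fin 2) : ∃ M, 0 < M ∧ ∀ z, S.lamE i z ≤ M := by
  obtain ⟨M, hM⟩ := isCompact_Icc.exists_bound_of_continuousOn (s := Icc (0 : ℝ) 1)
    (S.lam_contDiffOn i).continuousOn
  have h : ∀ z, S.lamE i z ≤ M := fun z => (le_abs_self _).trans (hM _ (clamp_mem z))
  exact ⟨M, (S.lamE_pos i 0).trans_le (h 0), h⟩

lemma bddMeas_lamE (i : Fin 2) : BddMeas (S.lamE i) := by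
  obtain ⟨M, _, hM⟩ := S.exists_lamE_le i
  exact ⟨(S.continuous_lamE i).measurable, M, fun z => by
    rw [abs_of_pos (S.lamE_pos i z)]; exact hM z⟩

/-- The travel time `φ_i`, continued to a diffeomorphism of the real line. -/
noncomputable def phiE (i : Fin 2) (z : ℝ) : ℝ := ∫ ζ in (0 : ℝ)..z, 1 / S.lamE i ζ

lemma phiE_eq {z : ℝ} (hz : z ∈ Icc (0 : ℝ) 1) (i : Fin 2) : S.phiE i z = S.phi i z := by
  refine intervalIntegral.integral_congr fun ζ hζ => ?_
  rw [uIcc_of_le hz.1] at hζ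
  simp only [S.lamE_eq ⟨hζ.1, hζ.2.trans hz.2⟩]

lemma phiE_zero (i : Fin 2) : S.phiE i 0 = 0 := intervalIntegral.integral_same

lemma phiE_one (i : Fin 2) : S.phiE i 1 = S.tau i := S.phiE_eq ⟨zero_le_one, le_rfl⟩ i

lemma hasDerivAt_phiE (i : Fin 2) (z : ℝ) : HasDerivAt (S.phiE i) (1 / S.lamE i z) z := by
  have hc : Continuous fun ζ => 1 / S.lamE i ζ :=
    continuous_const.div (S.continuous_lamE i) fun ζ => (S.lamE_pos i ζ).ne'
  exact (hc.integral_hasStrictDerivAt 0 z).hasDerivAt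

lemma strictMono_phiE (i : Fin 2) : StrictMono (S.phiE i) :=
  strictMono_of_deriv_pos fun z => by
    rw [(S.hasDerivAt_phiE i z).deriv]
    exact one_div_pos.2 (S.lamE_pos i z)

lemma continuous_phiE (i : Fin 2) : Continuous (S.phiE i) :=
  continuous_iff_continuousAt.2 fun z => (S.hasDerivAt_phiE i z).continuousAt

lemma surjective_phiE (i : Fin 2) : Function.Surjective (S.phiE i) := by
  obtain ⟨M, hM, hle⟩ := S.exists_lamE_le i
  have hmono : Monotone fun z => S.phiE i z - z / M := by
    have hd : ∀ z, HasDerivAt (fun z => S.phiE i z - z / M) (1 / S.lamE i z - 1 / M) z := fun z =>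
      (S.hasDerivAt_phiE i z).sub ((hasDerivAt_id z).div_const M)
    refine monotone_of_deriv_nonneg (fun z => (hd z).differentiableAt) fun z => ?_
    rw [(hd z).deriv, sub_nonneg]
    exact one_div_le_one_div_of_le (S.lamE_pos i z) (hle z)
  have h0 : S.phiE i 0 - 0 / M = 0 := by rw [S.phiE_zero]; simp
  refine (S.continuous_phiE i).surjective ?_ ?_
  · refine Filter.tendsto_atTop_mono' _ ?_ (Filter.tendsto_id.atTop_div_const hM)
    filter_upwards [Filter.eventually_ge_atTop 0] with z hz
    have := hmono hz
    simp only [h0] at this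
    simpa using this
  · refine Filter.tendsto_atBot_mono' _ ?_ (Filter.tendsto_id.atBot_div_const hM)
    filter_upwards [Filter.eventually_le_atBot 0] with z hz
    have := hmono hz
    simp only [h0] at this
    simpa using this

/-- The inverse of `phiE`. -/
noncomputable def psiE (i : Fin 2) : ℝ ≃o ℝ :=
  ((S.strictMono_phiE i).orderIsoOfSurjective _ (S.surjective_phiE i)).symm

lemma psiE_phiE (i : Fin 2) (z : ℝ) : S.psiE i (S.phiE i z) = z :=
  StrictMono.orderIsoOfSurjective_symm_apply_self _ _ _ _

lemma phiE_psiE (i : Fin 2) (σ : ℝ) : S.phiE i (S.psiE i σ) = σ :=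
  StrictMono.orderIsoOfSurjective_self_symm_apply _ _ _ _

lemma continuous_psiE (i : Fin 2) : Continuous (S.psiE i) := (S.psiE i).continuous

lemma hasDerivAt_psiE (i : Fin 2) (σ : ℝ) :
    HasDerivAt (S.psiE i) (S.lamE i (S.psiE i σ)) σ := by
  have h := HasDerivAt.of_local_left_inverse (S.continuous_psiE i).continuousAt
    (S.hasDerivAt_phiE i (S.psiE i σ)) (one_div_pos.2 (S.lamE_pos i _)).ne'
    (Filter.Eventually.of_forall (S.phiE_psiE i))
  simpa using h

lemma psiE_zero (i : Fin 2) : S.psiE i 0 = 0 := by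
  rw [← S.phiE_zero i, psiE_phiE, S.phiE_zero]

lemma psiE_tau (i : Fin 2) : S.psiE i (S.tau i) = 1 := by rw [← S.phiE_one, psiE_phiE]

lemma psiE_le_iff (i : Fin 2) (σ z : ℝ) : S.psiE i σ ≤ z ↔ σ ≤ S.phiE i z := by
  rw [← (S.strictMono_phiE i).le_iff_le, phiE_psiE]

lemma le_psiE_iff (i : Fin 2) (σ z : ℝ) : z ≤ S.psiE i σ ↔ S.phiE i z ≤ σ := by
  rw [← (S.strictMono_phiE i).le_iff_le, phiE_psiE]

lemma psiE_mem {i : Fin 2} {σ : ℝ} (h : σ ∈ Icc 0 (S.tau i)) : S.psiE i σ ∈ Icc (0 : ℝ) 1 := by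
  constructor
  · rw [le_psiE_iff, phiE_zero]; exact h.1
  · rw [psiE_le_iff, phiE_one]; exact h.2

lemma phiE_mem {i : Fin 2} {z : ℝ} (hz : z ∈ Icc (0 : ℝ) 1) : S.phiE i z ∈ Icc 0 (S.tau i) := by
  rw [← S.phiE_one, ← S.phiE_zero i]
  exact ⟨(S.strictMono_phiE i).monotone hz.1, (S.strictMono_phiE i).monotone hz.2⟩

lemma psi_eq {i : Fin 2} {σ : ℝ} (h : σ ∈ Icc 0 (S.tau i)) : S.psi i σ = S.psiE i σ := by
  have hex : ∃ z ∈ Icc (0 : ℝ) 1, S.phi i z = σ :=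
    ⟨S.psiE i σ, S.psiE_mem h, by rw [← S.phiE_eq (S.psiE_mem h), phiE_psiE]⟩
  have h1 : S.psi i σ ∈ Icc (0 : ℝ) 1 := Function.invFunOn_mem hex
  have h2 : S.phi i (S.psi i σ) = σ := Function.invFunOn_eq hex
  rw [← S.phiE_eq h1] at h2
  rw [← h2, psiE_phiE, h2]

lemma tau_pos (i : Fin 2) : 0 < S.tau i := by
  rw [← S.phiE_one, ← S.phiE_zero i]
  exact S.strictMono_phiE i zero_lt_one

lemma tau_le : S.tau 0 ≤ S.tau 1 := by
  have hd : ∀ z, HasDerivAt (fun z => S.phiE 1 z - S.phiE 0 z)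
      (1 / S.lamE 1 z - 1 / S.lamE 0 z) z := fun z =>
    (S.hasDerivAt_phiE 1 z).sub (S.hasDerivAt_phiE 0 z)
  have hmono : Monotone fun z => S.phiE 1 z - S.phiE 0 z := by
    refine monotone_of_deriv_nonneg (fun z => (hd z).differentiableAt) fun z => ?_
    rw [(hd z).deriv, sub_nonneg]
    exact one_div_le_one_div_of_le (S.lamE_pos 1 z) (S.lamE_lt z).le
  have := hmono (zero_le_one (α := ℝ))
  simp only [phiE_zero, phiE_one] at this
  linarith

end RiemannSystem

/-! ### The Volterra transformation along characteristics -/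

namespace RiemannSystem

variable (S : RiemannSystem)

/-- The characteristics of the component `j`, parametrized by the travel time `s` (the time is
`T - s`); `c` labels the curve, and the curves with `c = 0` start in `z = 0` at `s = 0`. -/
noncomputable def charCurve (j : Idx) (c s : ℝ) : ℝ := S.psiE (fam j) (sgn j * s + c)

lemma continuous_charCurve (j : Idx) : Continuous fun q : ℝ × ℝ => S.charCurve j q.1 q.2 :=
  (S.continuous_psiE (fam j)).comp (by fun_prop)

lemma hasDerivAt_charCurve (j : Idx) (c s : ℝ) :
    HasDerivAt (S.charCurve j c) (sgn j * S.lamE (fam j) (S.charCurve j c s)) s := by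
  have h1 : HasDerivAt (fun s => sgn j * s + c) (sgn j) s := by
    simpa using ((hasDerivAt_id s).const_mul (sgn j)).add_const c
  exact ((S.hasDerivAt_psiE (fam j) (sgn j * s + c)).comp s h1).congr_deriv
    (by rw [mul_comm]; rfl)

lemma hasDerivAt_charCurve_label (j : Idx) (c s : ℝ) :
    HasDerivAt (fun c => S.charCurve j c s) (S.lamE (fam j) (S.charCurve j c s)) c := by
  have h1 : HasDerivAt (fun c => sgn j * s + c) 1 c := by
    simpa using (hasDerivAt_id c).const_add (sgn j * s)
  exact ((S.hasDerivAt_psiE (fam j) (sgn j * s + c)).comp c h1).congr_deriv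
    (by rw [mul_one]; rfl)

lemma sphi_charCurve {j : Idx} {c s : ℝ} (h : S.charCurve j c s ∈ Icc (0 : ℝ) 1) :
    S.sphi j (S.charCurve j c s) = s + sgn j * c := by
  rw [sphi_eq, ← S.phiE_eq h, charCurve, phiE_psiE]
  linear_combination s * sgn_mul_self j

lemma slam_eq_lamE {j : Idx} {z : ℝ} (hz : z ∈ Icc (0 : ℝ) 1) :
    S.slam j z = sgn j * S.lamE (fam j) z := by
  rw [slam_eq, S.lamE_eq hz]

/-- The entries of `A`, extended by zero. -/
noncomputable def extA (k j : Idx) : ℝ → ℝ := (Icc (0 : ℝ) 1).indicator fun z => S.A z k j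

lemma bddMeas_extA (k j : Idx) : BddMeas (S.extA k j) := by
  obtain ⟨C, hC⟩ := isCompact_Icc.exists_bound_of_continuousOn (S.A_continuousOn k j)
  exact BddMeas.of_indicator measurableSet_Icc
    (continuousOn_iff_continuous_domRestrict.1 (S.A_continuousOn k j)).measurable hC

lemma extA_of_mem {k j : Idx} {z : ℝ} (hz : z ∈ Icc (0 : ℝ) 1) : S.extA k j z = S.A z k j :=
  indicator_of_mem hz _

/-- A trajectory up to the time `T`, extended by zero. -/
noncomputable def extX (x : Idx → ℝ → ℝ → ℝ) (T : ℝ) (j : Idx) (z t : ℝ) : ℝ :=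
  (Icc (0 : ℝ) 1 ×ˢ Icc (0 : ℝ) T).indicator (fun q : ℝ × ℝ => x j q.1 q.2) (z, t)

lemma extX_of_mem {x : Idx → ℝ → ℝ → ℝ} {T : ℝ} {j : Idx} {z t : ℝ} (hz : z ∈ Icc (0 : ℝ) 1)
    (ht : t ∈ Icc 0 T) : extX x T j z t = x j z t :=
  indicator_of_mem (show (z, t) ∈ Icc (0 : ℝ) 1 ×ˢ Icc (0 : ℝ) T from ⟨hz, ht⟩) _

variable {S}
variable {K : ℝ → ℝ → Matrix Idx Idx ℝ} {x : Idx → ℝ → ℝ → ℝ} {u : ℝ → Fin 2 → ℝ}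

lemma IsSolution.bddMeas_extX (hx : S.IsSolution x u) (T : ℝ) (j : Idx) :
    BddMeas (Function.uncurry (extX x T j)) := by
  obtain ⟨C, hC⟩ := hx.bounded T
  refine BddMeas.of_indicator (C := C) (measurableSet_Icc.prod measurableSet_Icc) ?_
    fun q hq => hC j q.1 hq.1 q.2 hq.2
  have h := measurable_indicator_of_domRestrict (measurableSet_Icc.prod measurableSet_Ici)
    (hx.measurable j)
  exact measurable_domRestrict_of_eqOn h fun q hq =>
    (indicator_of_mem (show q ∈ Icc (0 : ℝ) 1 ×ˢ Ici (0 : ℝ) from ⟨hq.1, hq.2.1⟩)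
      fun q : ℝ × ℝ => x j q.1 q.2).symm

/-- The transport equation of the component `k`, with the travel time as parameter. -/
lemma IsSolution.transport_charCurve (hx : S.IsSolution x u) (k : Idx) (c : ℝ) {a b T T₁ : ℝ}
    (hab : a ≤ b) (hz : ∀ s ∈ Icc a b, S.charCurve k c s ∈ Icc (0 : ℝ) 1) (hT : 0 ≤ T - b)
    (hT₁ : T - a ≤ T₁) :
    extX x T₁ k (S.charCurve k c b) (T - b) - extX x T₁ k (S.charCurve k c a) (T - a) =
      ∫ s in a..b, -∑ j, S.extA k j (S.charCurve k c s) * extX x T₁ j (S.charCurve k c s) (T - s) := by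
  have ha := hz a ⟨le_rfl, hab⟩
  have hb := hz b ⟨hab, le_rfl⟩
  have htime : ∀ s ∈ Icc a b, T - s ∈ Icc 0 T₁ := fun s hs =>
    ⟨by linarith [hs.2], by linarith [hs.1]⟩
  have hphi : ∀ s ∈ Icc a b, T + sgn k * c - S.sphi k (S.charCurve k c s) = T - s := fun s hs => by
    rw [S.sphi_charCurve (hz s hs)]; ring
  have h := hx.transport k (T + sgn k * c) _ ha _ hb
    (by rw [hphi a ⟨le_rfl, hab⟩]; linarith) (by rw [hphi b ⟨hab, le_rfl⟩]; linarith)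
  rw [hphi a ⟨le_rfl, hab⟩, hphi b ⟨hab, le_rfl⟩] at h
  rw [extX_of_mem hb (htime b ⟨hab, le_rfl⟩), extX_of_mem ha (htime a ⟨le_rfl, hab⟩), h,
    intervalIntegral.integral_neg, neg_inj]
  have hsign : (∀ s, 0 ≤ sgn k * S.lamE (fam k) (S.charCurve k c s)) ∨
      ∀ s, sgn k * S.lamE (fam k) (S.charCurve k c s) ≤ 0 := by
    rcases sgn_eq k with e | e
    · exact Or.inl fun s => by rw [e, one_mul]; exact (S.lamE_pos _ _).le
    · exact Or.inr fun s => by rw [e]; linarith [S.lamE_pos (fam k) (S.charCurve k c s)]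
  rw [← integral_comp_mul_of_sign (S.hasDerivAt_charCurve k c) hsign]
  refine intervalIntegral.integral_congr fun s hs => ?_
  rw [uIcc_of_le hab] at hs
  have hne : sgn k * S.lamE (fam k) (S.charCurve k c s) ≠ 0 :=
    mul_ne_zero (sgn_ne_zero k) (S.lamE_pos _ _).ne'
  simp only [S.slam_eq_lamE (hz s hs), hphi s hs, div_mul_cancel₀ _ hne]
  exact Finset.sum_congr rfl fun j _ => by
    rw [S.extA_of_mem (hz s hs), extX_of_mem (hz s hs) (htime s hs)]

/-- The kernel equation of the entry `(k, j)`, with the travel time as parameter. -/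
lemma IsKernel.pde_charCurve (hK : S.IsKernel K) (k j : Idx) (c : ℝ) {a b : ℝ} (hab : a ≤ b)
    (h : ∀ s ∈ Icc a b, 0 ≤ S.charCurve j c s ∧ S.charCurve j c s ≤ S.charCurve k 0 s ∧
      S.charCurve k 0 s ≤ 1) :
    extK K k j (S.charCurve k 0 b) (S.charCurve j c b) * S.lamE (fam j) (S.charCurve j c b)
      - extK K k j (S.charCurve k 0 a) (S.charCurve j c a) * S.lamE (fam j) (S.charCurve j c a) =
      ∫ s in a..b, S.lamE (fam j) (S.charCurve j c s) *
        ∑ i, extK K k i (S.charCurve k 0 s) (S.charCurve j c s) * S.extA i j (S.charCurve j c s) := by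
  have hW : ∀ s ∈ Icc a b, S.charCurve j c s ∈ Icc (0 : ℝ) 1 := fun s hs =>
    ⟨(h s hs).1, (h s hs).2.1.trans (h s hs).2.2⟩
  have hZ : ∀ s ∈ Icc a b, S.charCurve k 0 s ∈ Icc (0 : ℝ) 1 := fun s hs =>
    ⟨(h s hs).1.trans (h s hs).2.1, (h s hs).2.2⟩
  have ha : a ∈ Icc a b := ⟨le_rfl, hab⟩
  have hb : b ∈ Icc a b := ⟨hab, le_rfl⟩
  have hp := hK.pde k j a b (S.charCurve k 0) (S.charCurve j c) hab h
    (fun s hs => by rw [S.sphi_charCurve (hZ s hs), S.sphi_charCurve (hZ a ha)]; ring)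
    (fun s hs => by rw [S.sphi_charCurve (hW s hs), S.sphi_charCurve (hW a ha)]; ring)
  have hI : ∫ s in a..b, S.slam j (S.charCurve j c s) *
        (K (S.charCurve k 0 s) (S.charCurve j c s) * S.A (S.charCurve j c s)) k j =
      sgn j * ∫ s in a..b, S.lamE (fam j) (S.charCurve j c s) *
        ∑ i, extK K k i (S.charCurve k 0 s) (S.charCurve j c s)
          * S.extA i j (S.charCurve j c s) := by
    rw [← intervalIntegral.integral_const_mul]
    refine intervalIntegral.integral_congr fun s hs => ?_
    rw [uIcc_of_le hab] at hs
    have e : (K (S.charCurve k 0 s) (S.charCurve j c s) * S.A (S.charCurve j c s)) k j =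
        ∑ i, extK K k i (S.charCurve k 0 s) (S.charCurve j c s)
          * S.extA i j (S.charCurve j c s) := by
      rw [Matrix.mul_apply]
      exact Finset.sum_congr rfl fun i _ => by
        rw [S.extA_of_mem (hW s hs), extK_of_mem (h s hs).1 (h s hs).2.1 (h s hs).2.2]
    simp only [e, S.slam_eq_lamE (hW s hs)]
    ring
  rw [hI, S.slam_eq_lamE (hW a ha), S.slam_eq_lamE (hW b hb)] at hp
  rw [extK_of_mem (h a ha).1 (h a ha).2.1 (h a ha).2.2,
    extK_of_mem (h b hb).1 (h b hb).2.1 (h b hb).2.2]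
  exact mul_left_cancel₀ (sgn_ne_zero j) (by linear_combination hp)

/-- The rate of change of `φ_j` along a characteristic of the component `k`, relative to a
characteristic of the component `j`, does not change its sign. -/
lemma relative_speed_sign (S : RiemannSystem) (k j : Idx) :
    (∀ s, 0 ≤ 1 / S.lamE (fam j) (S.charCurve k 0 s)
      * (sgn k * S.lamE (fam k) (S.charCurve k 0 s)) - sgn j) ∨
    ∀ s, 1 / S.lamE (fam j) (S.charCurve k 0 s)
      * (sgn k * S.lamE (fam k) (S.charCurve k 0 s)) - sgn j ≤ 0 := by
  have e : ∀ s, 1 / S.lamE (fam j) (S.charCurve k 0 s)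
      * (sgn k * S.lamE (fam k) (S.charCurve k 0 s)) - sgn j =
      (sgn k * S.lamE (fam k) (S.charCurve k 0 s) - sgn j * S.lamE (fam j) (S.charCurve k 0 s))
        / S.lamE (fam j) (S.charCurve k 0 s) := fun s => by
    have := (S.lamE_pos (fam j) (S.charCurve k 0 s)).ne'
    field_simp
  suffices h : (∀ z, 0 ≤ sgn k * S.lamE (fam k) z - sgn j * S.lamE (fam j) z) ∨
      ∀ z, sgn k * S.lamE (fam k) z - sgn j * S.lamE (fam j) z ≤ 0 by
    simp only [e]
    rcases h with h | h
    · exact Or.inl fun s => div_nonneg (h _) (S.lamE_pos _ _).le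
    · exact Or.inr fun s => div_nonpos_of_nonpos_of_nonneg (h _) (S.lamE_pos _ _).le
  have hp := S.lamE_pos
  have hl := S.lamE_lt
  rcases sgn_eq k with ek | ek <;> rcases sgn_eq j with ej | ej <;> rw [ek, ej]
  · rcases Fin.exists_fin_two.1 ⟨fam k, rfl⟩ with fk | fk <;>
      rcases Fin.exists_fin_two.1 ⟨fam j, rfl⟩ with fj | fj <;> rw [fk, fj]
    · exact Or.inl fun z => by linarith
    · exact Or.inl fun z => by linarith [hl z]
    · exact Or.inr fun z => by linarith [hl z]
    · exact Or.inl fun z => by linarith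
  · exact Or.inl fun z => by linarith [hp (fam k) z, hp (fam j) z]
  · exact Or.inr fun z => by linarith [hp (fam k) z, hp (fam j) z]
  · rcases Fin.exists_fin_two.1 ⟨fam k, rfl⟩ with fk | fk <;>
      rcases Fin.exists_fin_two.1 ⟨fam j, rfl⟩ with fj | fj <;> rw [fk, fj]
    · exact Or.inl fun z => by linarith
    · exact Or.inr fun z => by linarith [hl z]
    · exact Or.inl fun z => by linarith [hl z]
    · exact Or.inl fun z => by linarith

/-- Rate of change of `∫₀ᶻ K_kj(z,ζ) x_j(ζ,t) dζ` along a characteristic of the component `k`: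
a contribution of the diagonal, one of the edge `ζ = 0`, and one of the source terms. -/
lemma IsKernel.volterra_summand_charCurve (hK : S.IsKernel K) (hx : S.IsSolution x u) (k j : Idx)
    {a b T : ℝ} (hab : a ≤ b) (hz : ∀ s ∈ Icc a b, S.charCurve k 0 s ∈ Icc (0 : ℝ) 1)
    (hT : 0 ≤ T - b) :
    (∫ ζ in (0 : ℝ)..S.charCurve k 0 b,
        extK K k j (S.charCurve k 0 b) ζ * extX x (T - a) j ζ (T - b))
      - (∫ ζ in (0 : ℝ)..S.charCurve k 0 a,
          extK K k j (S.charCurve k 0 a) ζ * extX x (T - a) j ζ (T - a)) =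
      (∫ s in a..b, -(S.extA k j (S.charCurve k 0 s) * extX x (T - a) j (S.charCurve k 0 s) (T - s)))
        + (∫ s in a..b, S.slam j 0 * extK K k j (S.charCurve k 0 s) 0 * extX x (T - a) j 0 (T - s))
        + ∫ s in a..b, ∫ ζ in (0 : ℝ)..S.charCurve k 0 s,
          ((∑ i, extK K k i (S.charCurve k 0 s) ζ * S.extA i j ζ) * extX x (T - a) j ζ (T - s)
            - extK K k j (S.charCurve k 0 s) ζ
              * ∑ i, S.extA j i ζ * extX x (T - a) i ζ (T - s)) := by
  set Z : ℝ → ℝ := S.charCurve k 0 with hZ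
  set X := extX x (T - a) with hX
  have hKm := hK.bddMeas_extK
  have hXm := hx.bddMeas_extX (T - a)
  have hAm := S.bddMeas_extA
  have hZc : Continuous Z :=
    (S.continuous_charCurve k).comp (by fun_prop : Continuous fun s : ℝ => ((0 : ℝ), s))
  -- functions of `(s, ζ)` in the new variables `(s, c)`, `ζ = charCurve j c s`
  have hsub : ∀ (f : ℝ → ℝ → ℝ) s, ∫ ζ in (0 : ℝ)..Z s, f s ζ =
      ∫ c in (-(sgn j * s))..(S.phiE (fam j) (Z s) - sgn j * s),
        f s (S.charCurve j c s) * S.lamE (fam j) (S.charCurve j c s) := by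
    intro f s
    have h := integral_comp_mul_of_sign (fun c => S.hasDerivAt_charCurve_label j c s)
      (Or.inl fun c => (S.lamE_pos _ _).le) (f s) (-(sgn j * s))
      (S.phiE (fam j) (Z s) - sgn j * s)
    rw [h]
    congr 1
    · simp [charCurve, psiE_zero]
    · simp [charCurve, psiE_phiE]
  have hWm : Measurable fun q : ℝ × ℝ => S.charCurve j q.2 q.1 :=
    ((S.continuous_charCurve j).comp continuous_swap).measurable
  have hZm : Measurable fun q : ℝ × ℝ => Z q.1 := hZc.measurable.comp measurable_fst
  have hTm : Measurable fun q : ℝ × ℝ => T - q.1 := by fun_prop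
  have hK' : ∀ i, BddMeas fun q : ℝ × ℝ => extK K k i (Z q.1) (S.charCurve j q.2 q.1) := fun i =>
    (hKm k i).comp (hZm.prodMk hWm)
  have hX' : ∀ i, BddMeas fun q : ℝ × ℝ => X i (S.charCurve j q.2 q.1) (T - q.1) := fun i =>
    (hXm i).comp (hWm.prodMk hTm)
  have hA' : ∀ i l, BddMeas fun q : ℝ × ℝ => S.extA i l (S.charCurve j q.2 q.1) := fun i l =>
    (hAm i l).comp hWm
  have hl' : BddMeas fun q : ℝ × ℝ => S.lamE (fam j) (S.charCurve j q.2 q.1) :=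
    (S.bddMeas_lamE _).comp hWm
  -- on the line `c = const`, `f` is the kernel times the speed, `g` is the state, and `f'`, `g'`
  -- are their derivatives in `s`, according to the kernel equations and the system
  obtain ⟨f, hf⟩ : ∃ f : ℝ → ℝ → ℝ, ∀ s c, f s c =
    extK K k j (Z s) (S.charCurve j c s) * S.lamE (fam j) (S.charCurve j c s) :=
    ⟨_, fun _ _ => rfl⟩
  obtain ⟨g, hg⟩ : ∃ g : ℝ → ℝ → ℝ, ∀ s c, g s c = X j (S.charCurve j c s) (T - s) :=
    ⟨_, fun _ _ => rfl⟩
  obtain ⟨f', hf'⟩ : ∃ f' : ℝ → ℝ → ℝ, ∀ s c, f' s c = S.lamE (fam j) (S.charCurve j c s)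
      * ∑ i, extK K k i (Z s) (S.charCurve j c s) * S.extA i j (S.charCurve j c s) :=
    ⟨_, fun _ _ => rfl⟩
  obtain ⟨g', hg'⟩ : ∃ g' : ℝ → ℝ → ℝ, ∀ s c, g' s c =
      -∑ i, S.extA j i (S.charCurve j c s) * X i (S.charCurve j c s) (T - s) :=
    ⟨_, fun _ _ => rfl⟩
  have hfm : BddMeas (Function.uncurry f) := by
    have := (hK' j).mul hl'
    convert this with q
    exact hf q.1 q.2
  have hgm : BddMeas (Function.uncurry g) := by
    convert hX' j with q
    exact hg q.1 q.2
  have hf'm : BddMeas (Function.uncurry f') := by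
    have := hl'.mul (BddMeas.sum (s := Finset.univ) fun i _ => (hK' i).mul (hA' i j))
    convert this with q
    exact hf' q.1 q.2
  have hg'm : BddMeas (Function.uncurry g') := by
    have := (BddMeas.sum (s := Finset.univ) fun i _ => (hA' j i).mul (hX' i)).neg
    convert this with q
    exact hg' q.1 q.2
  have hGm : BddMeas (Function.uncurry fun s c => f s c * g s c) := hfm.mul hgm
  have hHm : BddMeas (Function.uncurry fun s c => f' s c * g s c + f s c * g' s c) :=
    (hf'm.mul hgm).add (hfm.mul hg'm)
  have hα : ∀ s, HasDerivAt (fun s => -(sgn j * s)) (-sgn j) s := fun s => by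
    exact ((hasDerivAt_id s).const_mul (sgn j)).neg.congr_deriv (by simp)
  have hαs : (∀ _s : ℝ, 0 ≤ -sgn j) ∨ ∀ _s : ℝ, -sgn j ≤ 0 := by
    rcases sgn_eq j with e | e <;> rw [e]
    · exact Or.inr fun _ => by norm_num
    · exact Or.inl fun _ => by norm_num
  have hβ : ∀ s, HasDerivAt (fun s => S.phiE (fam j) (Z s) - sgn j * s)
      (1 / S.lamE (fam j) (Z s) * (sgn k * S.lamE (fam k) (Z s)) - sgn j) s := fun s => by
    have h1 := (S.hasDerivAt_phiE (fam j) (Z s)).comp s (S.hasDerivAt_charCurve k 0 s)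
    have h2 : HasDerivAt (fun s => sgn j * s) (sgn j) s := by
      simpa using (hasDerivAt_id s).const_mul (sgn j)
    exact h1.sub h2
  have hβc : Continuous fun s =>
      1 / S.lamE (fam j) (Z s) * (sgn k * S.lamE (fam k) (Z s)) - sgn j := by
    have h1 := (S.continuous_lamE (fam j)).comp hZc
    have h2 := (S.continuous_lamE (fam k)).comp hZc
    exact ((continuous_const.div h1 fun s => (S.lamE_pos _ _).ne').mul
      (continuous_const.mul h2)).sub continuous_const
  have hle : ∀ s ∈ Icc a b, -(sgn j * s) ≤ S.phiE (fam j) (Z s) - sgn j * s := fun s hs => by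
    linarith [(S.phiE_mem (i := fam j) (hz s hs)).1]
  have hlines : ∀ c, ∀ s₁ ∈ Icc a b, ∀ s₂ ∈ Icc a b, s₁ ≤ s₂ →
      (∀ s ∈ Icc s₁ s₂, -(sgn j * s) ≤ c ∧ c ≤ S.phiE (fam j) (Z s) - sgn j * s) →
      f s₂ c * g s₂ c - f s₁ c * g s₁ c = ∫ s in s₁..s₂, (f' s c * g s c + f s c * g' s c) := by
    intro c s₁ hs₁ s₂ hs₂ h12 hc
    have htri : ∀ s ∈ Icc s₁ s₂, 0 ≤ S.charCurve j c s ∧ S.charCurve j c s ≤ Z s ∧ Z s ≤ 1 := by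
      intro s hs
      refine ⟨?_, ?_, (hz s ⟨hs₁.1.trans hs.1, hs.2.trans hs₂.2⟩).2⟩
      · rw [charCurve, le_psiE_iff, phiE_zero]; linarith [(hc s hs).1]
      · rw [charCurve, psiE_le_iff]; linarith [(hc s hs).2]
    refine mul_sub_mul_of_primitive (f := fun s => f s c) (g := fun s => g s c) h12
      (hf'm.section_right c) (hg'm.section_right c) (fun s hs => ?_) (fun s hs => ?_)
    all_goals simp only [hf, hg, hf', hg']
    · exact hK.pde_charCurve k j c hs.1 fun r hr => htri r ⟨hr.1, hr.2.trans hs.2⟩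
    · refine hx.transport_charCurve j c hs.1 (fun r hr => ?_) ?_ (by linarith [hs₁.1])
      · have := htri r ⟨hr.1, hr.2.trans hs.2⟩
        exact ⟨this.1, this.2.1.trans this.2.2⟩
      · linarith [hs.2, hs₂.2]
  have main := leibniz_two_boundaries hGm hHm hab hα continuous_const hαs hβ hβc
    (S.relative_speed_sign k j) hle hlines
  have eG : ∀ s, ∫ ζ in (0 : ℝ)..Z s, extK K k j (Z s) ζ * X j ζ (T - s) =
      ∫ c in (-(sgn j * s))..(S.phiE (fam j) (Z s) - sgn j * s), f s c * g s c := fun s => by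
    rw [hsub (fun s ζ => extK K k j (Z s) ζ * X j ζ (T - s))]
    refine intervalIntegral.integral_congr fun c _ => ?_
    simp only [hf, hg]; ring
  have eH : ∀ s, ∫ ζ in (0 : ℝ)..Z s, ((∑ i, extK K k i (Z s) ζ * S.extA i j ζ) * X j ζ (T - s)
        - extK K k j (Z s) ζ * ∑ i, S.extA j i ζ * X i ζ (T - s)) =
      ∫ c in (-(sgn j * s))..(S.phiE (fam j) (Z s) - sgn j * s),
        (f' s c * g s c + f s c * g' s c) := fun s => by
    rw [hsub (fun s ζ => (∑ i, extK K k i (Z s) ζ * S.extA i j ζ) * X j ζ (T - s)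
        - extK K k j (Z s) ζ * ∑ i, S.extA j i ζ * X i ζ (T - s))]
    refine intervalIntegral.integral_congr fun c _ => ?_
    simp only [hf, hg, hf', hg']; ring
  rw [eG, eG, main]
  simp only [eH]
  congr 1
  rw [sub_eq_add_neg, ← intervalIntegral.integral_neg]
  congr 1
  · refine intervalIntegral.integral_congr fun s hs => ?_
    rw [uIcc_of_le hab] at hs
    have hW : S.charCurve j (S.phiE (fam j) (Z s) - sgn j * s) s = Z s := by
      simp [charCurve, psiE_phiE]
    have hd := congrFun (congrFun (hK.bc_diag (Z s) (hz s hs)) k) j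
    rw [Matrix.sub_apply, Matrix.mul_diagonal, Matrix.diagonal_mul, S.slam_eq_lamE (hz s hs),
      S.slam_eq_lamE (hz s hs)] at hd
    simp only [hf, hg, hW]
    rw [S.extA_of_mem (hz s hs), extK_of_mem (hz s hs).1 le_rfl (hz s hs).2]
    have := (S.lamE_pos (fam j) (Z s)).ne'
    field_simp
    linear_combination -(X j (Z s) (T - s)) * hd
  · refine intervalIntegral.integral_congr fun s _ => ?_
    have hW : S.charCurve j (-(sgn j * s)) s = 0 := by simp [charCurve, psiE_zero]
    simp only [hf, hg, hW]
    rw [S.slam_eq_lamE ⟨le_rfl, zero_le_one⟩]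
    ring

/-- The transport equation of the transformed state `x̄`: along the characteristics of the
component `k`, only the boundary values at `z = 0` act on `x̄_k`. -/
lemma IsKernel.volterra_charCurve (hK : S.IsKernel K) (hx : S.IsSolution x u) (k : Idx)
    {a b T : ℝ} (hab : a ≤ b) (hz : ∀ s ∈ Icc a b, S.charCurve k 0 s ∈ Icc (0 : ℝ) 1)
    (hT : 0 ≤ T - b) :
    volterra K (fun j ζ => x j ζ (T - b)) k (S.charCurve k 0 b)
      - volterra K (fun j ζ => x j ζ (T - a)) k (S.charCurve k 0 a) =
      -∫ s in a..b, ∑ j, S.slam j 0 * K (S.charCurve k 0 s) 0 k j * x j 0 (T - s) := by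
  set Z : ℝ → ℝ := S.charCurve k 0 with hZ
  set X := extX x (T - a) with hX
  have hKm := hK.bddMeas_extK
  have hXm := hx.bddMeas_extX (T - a)
  have hAm := S.bddMeas_extA
  have hZc : Continuous Z :=
    (S.continuous_charCurve k).comp (by fun_prop : Continuous fun s : ℝ => ((0 : ℝ), s))
  have htime : ∀ s ∈ Icc a b, T - s ∈ Icc 0 (T - a) := fun s hs =>
    ⟨by linarith [hs.2], by linarith [hs.1]⟩
  have hTm : Measurable fun s : ℝ => T - s := by fun_prop
  have hv : ∀ s ∈ Icc a b, volterra K (fun j ζ => x j ζ (T - s)) k (Z s) =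
      X k (Z s) (T - s) - ∑ j, ∫ ζ in (0 : ℝ)..Z s, extK K k j (Z s) ζ * X j ζ (T - s) := by
    intro s hs
    have hi : ∀ j ∈ Finset.univ, IntervalIntegrable
        (fun ζ => extK K k j (Z s) ζ * X j ζ (T - s)) volume 0 (Z s) := fun j _ =>
      BddMeas.intervalIntegrable
        (((hKm k j).comp measurable_prodMk_left).mul ((hXm j).comp measurable_prodMk_right)) _ _
    rw [← intervalIntegral.integral_finsetSum hi, volterra, hX,
      extX_of_mem (hz s hs) (htime s hs)]
    congr 1
    refine intervalIntegral.integral_congr fun ζ hζ => ?_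
    rw [uIcc_of_le (hz s hs).1] at hζ
    exact Finset.sum_congr rfl fun j _ => by
      rw [extK_of_mem hζ.1 hζ.2 (hz s hs).2,
        extX_of_mem ⟨hζ.1, hζ.2.trans (hz s hs).2⟩ (htime s hs)]
  rw [hv b ⟨hab, le_rfl⟩, hv a ⟨le_rfl, hab⟩]
  have hsum := Finset.sum_congr (rfl : (Finset.univ : Finset Idx) = Finset.univ)
    fun j _ => hK.volterra_summand_charCurve hx k j hab hz hT
  rw [Finset.sum_sub_distrib, Finset.sum_add_distrib, Finset.sum_add_distrib] at hsum
  have hxk := hx.transport_charCurve k 0 (T₁ := T - a) hab hz hT le_rfl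
  have hZX : ∀ j, BddMeas fun s => X j (Z s) (T - s) := fun j =>
    (hXm j).comp (hZc.measurable.prodMk hTm)
  -- the contribution of the diagonal cancels the coupling terms of `x_k`
  have s1 : ∑ j, ∫ s in a..b, -(S.extA k j (Z s) * X j (Z s) (T - s)) =
      ∫ s in a..b, -∑ j, S.extA k j (Z s) * X j (Z s) (T - s) := by
    have hi : ∀ j ∈ Finset.univ, IntervalIntegrable
        (fun s => -(S.extA k j (Z s) * X j (Z s) (T - s))) volume a b := fun j _ =>
      (((hAm k j).comp hZc.measurable).mul (hZX j)).neg.intervalIntegrable _ _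
    rw [← intervalIntegral.integral_finsetSum hi]
    simp only [Finset.sum_neg_distrib]
  have s2 : ∑ j, ∫ s in a..b, S.slam j 0 * extK K k j (Z s) 0 * X j 0 (T - s) =
      ∫ s in a..b, ∑ j, S.slam j 0 * K (Z s) 0 k j * x j 0 (T - s) := by
    have hi : ∀ j ∈ Finset.univ, IntervalIntegrable
        (fun s => S.slam j 0 * extK K k j (Z s) 0 * X j 0 (T - s)) volume a b := fun j _ =>
      BddMeas.intervalIntegrable (((BddMeas.const (S.slam j 0)).mul
        ((hKm k j).comp (hZc.measurable.prodMk measurable_const))).mul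
        ((hXm j).comp (measurable_const.prodMk hTm))) _ _
    rw [← intervalIntegral.integral_finsetSum hi]
    refine intervalIntegral.integral_congr fun s hs => ?_
    rw [uIcc_of_le hab] at hs
    exact Finset.sum_congr rfl fun j _ => by
      rw [extK_of_mem le_rfl (hz s hs).1 (hz s hs).2, hX,
        extX_of_mem ⟨le_rfl, zero_le_one⟩ (htime s hs)]
  -- the source terms add up to the trace of a commutator
  have s3 : ∑ j, ∫ s in a..b, ∫ ζ in (0 : ℝ)..Z s,
      ((∑ i, extK K k i (Z s) ζ * S.extA i j ζ) * X j ζ (T - s)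
        - extK K k j (Z s) ζ * ∑ i, S.extA j i ζ * X i ζ (T - s)) = 0 := by
    have hm : ∀ j, BddMeas (Function.uncurry fun s ζ =>
        ((∑ i, extK K k i (Z s) ζ * S.extA i j ζ) * X j ζ (T - s)
          - extK K k j (Z s) ζ * ∑ i, S.extA j i ζ * X i ζ (T - s))) := by
      intro j
      have k1 : ∀ i, BddMeas fun q : ℝ × ℝ => extK K k i (Z q.1) q.2 := fun i =>
        (hKm k i).comp ((hZc.measurable.comp measurable_fst).prodMk measurable_snd)
      have k2 : ∀ i, BddMeas fun q : ℝ × ℝ => X i q.2 (T - q.1) := fun i =>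
        (hXm i).comp (measurable_snd.prodMk (hTm.comp measurable_fst))
      have k3 : ∀ i l, BddMeas fun q : ℝ × ℝ => S.extA i l q.2 := fun i l =>
        (hAm i l).comp measurable_snd
      exact ((BddMeas.sum fun i _ => (k1 i).mul (k3 i j)).mul (k2 j)).sub
        ((k1 j).mul (BddMeas.sum fun i _ => (k3 j i).mul (k2 i)))
    have hi : ∀ j ∈ Finset.univ, IntervalIntegrable (fun s => ∫ ζ in (0 : ℝ)..Z s,
        ((∑ i, extK K k i (Z s) ζ * S.extA i j ζ) * X j ζ (T - s)
          - extK K k j (Z s) ζ * ∑ i, S.extA j i ζ * X i ζ (T - s))) volume a b := fun j _ =>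
      intervalIntegrable_integral_of_continuous (hm j) hab continuous_const hZc
    rw [← intervalIntegral.integral_finsetSum hi]
    have : ∀ s, ∑ j, ∫ ζ in (0 : ℝ)..Z s,
        ((∑ i, extK K k i (Z s) ζ * S.extA i j ζ) * X j ζ (T - s)
          - extK K k j (Z s) ζ * ∑ i, S.extA j i ζ * X i ζ (T - s)) = 0 := by
      intro s
      have hi : ∀ j ∈ Finset.univ, IntervalIntegrable (fun ζ =>
          (∑ i, extK K k i (Z s) ζ * S.extA i j ζ) * X j ζ (T - s)
            - extK K k j (Z s) ζ * ∑ i, S.extA j i ζ * X i ζ (T - s)) volume 0 (Z s) :=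
        fun j _ => BddMeas.intervalIntegrable ((hm j).comp measurable_prodMk_left) _ _
      rw [← intervalIntegral.integral_finsetSum hi]
      have hc : ∀ ζ, ∑ j, ((∑ i, extK K k i (Z s) ζ * S.extA i j ζ) * X j ζ (T - s)
          - extK K k j (Z s) ζ * ∑ i, S.extA j i ζ * X i ζ (T - s)) = 0 := by
        intro ζ
        rw [Finset.sum_sub_distrib, sub_eq_zero]
        simp only [Finset.sum_mul, Finset.mul_sum]
        rw [Finset.sum_comm]
        simp only [mul_assoc]
      simp only [hc, intervalIntegral.integral_zero]
    simp only [this, intervalIntegral.integral_zero]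
  rw [s1, s2, s3, ← hxk] at hsum
  linear_combination -hsum

end RiemannSystem

/-! ### Flatness of the transformed system -/

namespace RiemannSystem

variable {S : RiemannSystem}
variable {K : ℝ → ℝ → Matrix Idx Idx ℝ} {x : Idx → ℝ → ℝ → ℝ} {u : ℝ → Fin 2 → ℝ}

lemma fin_two_cases (i : Fin 2) : i = 0 ∨ i = 1 := by
  fin_cases i <;> simp

lemma psiE_phi (S : RiemannSystem) {i : Fin 2} {z : ℝ} (hz : z ∈ Icc (0 : ℝ) 1) :
    S.psiE i (S.phi i z) = z := by rw [← S.phiE_eq hz, psiE_phiE]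

/-- The coefficient with which the boundary value `x₁⁻(0,t)` acts on the component `k` of `x̄`. -/
noncomputable def edgeCoeff (S : RiemannSystem) (K : ℝ → ℝ → Matrix Idx Idx ℝ) (k : Idx) (z : ℝ) :
    ℝ :=
  Sum.elim ![0, S.a0m K z] ![0, -S.a0p K z] k

lemma IsKernel.sum_edge (hK : S.IsKernel K) (k : Idx) {z : ℝ} (hz : z ∈ Ioc (0 : ℝ) 1)
    {v : Idx → ℝ} (hv : ∀ i, v (Sum.inr i) = -v (Sum.inl i)) :
    ∑ j, S.slam j 0 * K z 0 k j * v j = S.edgeCoeff K k z * v (Sum.inl 0) := by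
  have hm := fun i j => congrFun (congrFun (hK.bc_minus z hz) i) j
  have hp := fun i j => congrFun (congrFun (hK.bc_plus z hz) i) j
  simp only [Matrix.mul_diagonal, Matrix.add_apply, Matrix.toBlocks₁₁, Matrix.toBlocks₁₂,
    Matrix.of_apply] at hm
  simp only [Matrix.neg_apply, Matrix.mul_diagonal, Matrix.add_apply, Matrix.toBlocks₂₁,
    Matrix.toBlocks₂₂, Matrix.of_apply] at hp
  simp only [Fintype.sum_sum_type, Fin.sum_univ_two, slam, hv]
  rcases k with i | i
  · have h0 := hm i 0
    have h1 := hm i 1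
    obtain rfl | rfl := fin_two_cases i <;>
      simp only [edgeCoeff, Sum.elim_inl, Matrix.cons_val_zero, Matrix.cons_val_one,
        Matrix.cons_val_fin_one] at h0 h1 ⊢ <;>
      linear_combination v (Sum.inl 0) * h0 + v (Sum.inl 1) * h1
  · have h0 := hp i 0
    have h1 := hp i 1
    obtain rfl | rfl := fin_two_cases i <;>
      simp only [edgeCoeff, Sum.elim_inr, Matrix.cons_val_zero, Matrix.cons_val_one,
        Matrix.cons_val_fin_one] at h0 h1 ⊢ <;>
      linear_combination -v (Sum.inl 0) * h0 - v (Sum.inl 1) * h1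

lemma IsKernel.volterra_charCurve_edge (hK : S.IsKernel K) (hx : S.IsSolution x u) (k : Idx)
    {a b T : ℝ} (hab : a ≤ b) (hz : ∀ s ∈ Icc a b, S.charCurve k 0 s ∈ Icc (0 : ℝ) 1)
    (hT : 0 ≤ T - b) :
    volterra K (fun j ζ => x j ζ (T - b)) k (S.charCurve k 0 b)
      - volterra K (fun j ζ => x j ζ (T - a)) k (S.charCurve k 0 a) =
      -∫ s in a..b, S.edgeCoeff K k (S.charCurve k 0 s) * x (Sum.inl 0) 0 (T - s) := by
  rw [hK.volterra_charCurve hx k hab hz hT, neg_inj]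
  refine intervalIntegral.integral_congr_ae ?_
  -- the boundary condition of the kernel is not imposed at the corner, that is, for `s = 0`
  have hne : ∀ᵐ s : ℝ, s ≠ 0 := by simp [ae_iff]
  filter_upwards [hne] with s hs0 hs
  rw [uIoc_of_le hab] at hs
  have h := hz s ⟨hs.1.le, hs.2⟩
  have hpos : S.charCurve k 0 s ≠ 0 := by
    intro h0
    rw [charCurve, add_zero, ← S.psiE_zero (fam k)] at h0
    have := (S.psiE (fam k)).injective h0
    exact hs0 ((mul_eq_zero.1 this).resolve_left (sgn_ne_zero k))
  exact hK.sum_edge k ⟨lt_of_le_of_ne h.1 hpos.symm, h.2⟩ (v := fun j => x j 0 (T - s))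
    fun i => hx.bc_zero (T - s) (by linarith [hs.2]) i

/-- Substitution of the position for the travel time. -/
lemma integral_travel_time (S : RiemannSystem) (i : Fin 2) (f : ℝ → ℝ) {z₁ z₂ : ℝ}
    (h₁ : z₁ ∈ Icc (0 : ℝ) 1) (h₂ : z₂ ∈ Icc (0 : ℝ) 1) :
    ∫ σ in S.phi i z₁..S.phi i z₂, f σ = ∫ ζ in z₁..z₂, f (S.phi i ζ) / S.lam i ζ := by
  rw [← S.phiE_eq h₁, ← S.phiE_eq h₂, ← integral_comp_mul_of_sign (S.hasDerivAt_phiE i)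
    (Or.inl fun z => (one_div_pos.2 (S.lamE_pos i z)).le)]
  refine intervalIntegral.integral_congr fun ζ hζ => ?_
  have h : ζ ∈ Icc (0 : ℝ) 1 := uIcc_subset_Icc h₁ h₂ hζ
  simp only [S.phiE_eq h, S.lamE_eq h]
  ring

/-- Transport of `x̄⁻`, from `z = 0` backwards in time. -/
lemma IsKernel.volterra_inl (hK : S.IsKernel K) (hx : S.IsSolution x u) (i : Fin 2) {z t : ℝ}
    (hz : z ∈ Icc (0 : ℝ) 1) (ht : 0 ≤ t) :
    volterra K (fun j ζ => x j ζ t) (Sum.inl i) z =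
      volterra K (fun j ζ => x j ζ (t + S.phi i z)) (Sum.inl i) 0
        - ∫ ζ in (0 : ℝ)..z, S.edgeCoeff K (Sum.inl i) ζ / S.lam i ζ
          * x (Sum.inl 0) 0 (t + S.phi i z - S.phi i ζ) := by
  have hc : ∀ s, S.charCurve (Sum.inl i) 0 s = S.psiE i s := fun s => by
    simp [charCurve, sgn, fam]
  have hmem := S.phiE_mem (i := i) hz
  have h := hK.volterra_charCurve_edge hx (Sum.inl i) (T := t + S.phi i z) hmem.1
    (fun s hs => by rw [hc]; exact S.psiE_mem ⟨hs.1, hs.2.trans hmem.2⟩)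
    (by rw [S.phiE_eq hz]; linarith)
  simp only [hc, psiE_zero, S.phiE_eq hz, S.psiE_phi hz, add_sub_cancel_right, sub_zero] at h
  have h0 : S.phi i 0 = 0 := by rw [← S.phiE_eq ⟨le_rfl, zero_le_one⟩, phiE_zero]
  have hI := S.integral_travel_time i (fun σ => S.edgeCoeff K (Sum.inl i) (S.psiE i σ)
    * x (Sum.inl 0) 0 (t + S.phi i z - σ)) ⟨le_rfl, zero_le_one⟩ hz
  rw [h0] at hI
  rw [hI] at h
  have hJ : ∫ ζ in (0 : ℝ)..z, S.edgeCoeff K (Sum.inl i) (S.psiE i (S.phi i ζ))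
      * x (Sum.inl 0) 0 (t + S.phi i z - S.phi i ζ) / S.lam i ζ =
      ∫ ζ in (0 : ℝ)..z, S.edgeCoeff K (Sum.inl i) ζ / S.lam i ζ
          * x (Sum.inl 0) 0 (t + S.phi i z - S.phi i ζ) := by
    refine intervalIntegral.integral_congr fun ζ hζ => ?_
    have hm : ζ ∈ Icc (0 : ℝ) 1 := uIcc_subset_Icc ⟨le_rfl, zero_le_one⟩ hz hζ
    rw [S.psiE_phi hm]
    ring
  rw [hJ] at h
  linear_combination h

/-- Transport of `x̄⁺`, from `z = 1` backwards in time. -/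
lemma IsKernel.volterra_inr (hK : S.IsKernel K) (hx : S.IsSolution x u) (i : Fin 2) {z t : ℝ}
    (hz : z ∈ Icc (0 : ℝ) 1) (ht : 0 ≤ t) :
    volterra K (fun j ζ => x j ζ t) (Sum.inr i) z =
      flatOutput K x i (t + S.tau i - S.phi i z)
        - ∫ ζ in z..1, S.edgeCoeff K (Sum.inr i) ζ / S.lam i ζ
          * x (Sum.inl 0) 0 (t - S.phi i z + S.phi i ζ) := by
  have hc : ∀ s, S.charCurve (Sum.inr i) 0 s = S.psiE i (-s) := fun s => by
    simp [charCurve, sgn, fam]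
  have hmem := S.phiE_mem (i := i) hz
  have h := hK.volterra_charCurve_edge hx (Sum.inr i) (T := t - S.phi i z)
    (a := -S.tau i) (b := -S.phiE i z) (neg_le_neg hmem.2)
    (fun s hs => by
      rw [hc]
      exact S.psiE_mem ⟨by linarith [hs.2, hmem.1], by linarith [hs.1]⟩)
    (by rw [S.phiE_eq hz]; linarith)
  rw [← intervalIntegral.integral_comp_neg] at h
  simp only [hc, neg_neg, psiE_tau, S.phiE_eq hz, S.psiE_phi hz, sub_neg_eq_add,
    sub_add_cancel] at h
  have hI := S.integral_travel_time i (fun σ => S.edgeCoeff K (Sum.inr i) (S.psiE i σ)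
    * x (Sum.inl 0) 0 (t - S.phi i z + σ)) hz ⟨zero_le_one, le_rfl⟩
  have hJ : ∫ ζ in z..1, S.edgeCoeff K (Sum.inr i) (S.psiE i (S.phi i ζ))
      * x (Sum.inl 0) 0 (t - S.phi i z + S.phi i ζ) / S.lam i ζ =
      ∫ ζ in z..1, S.edgeCoeff K (Sum.inr i) ζ / S.lam i ζ
          * x (Sum.inl 0) 0 (t - S.phi i z + S.phi i ζ) := by
    refine intervalIntegral.integral_congr fun ζ hζ => ?_
    have hm : ζ ∈ Icc (0 : ℝ) 1 := uIcc_subset_Icc hz ⟨zero_le_one, le_rfl⟩ hζ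
    rw [S.psiE_phi hm]
    ring
  change _ = -∫ σ in S.phi i z..S.phi i 1, _ at h
  rw [hI, hJ] at h
  rw [flatOutput, add_sub_right_comm]
  linear_combination h

lemma phi_mem (S : RiemannSystem) {i : Fin 2} {z : ℝ} (hz : z ∈ Icc (0 : ℝ) 1) :
    S.phi i z ∈ Icc 0 (S.tau i) := by
  rw [← S.phiE_eq hz]
  exact S.phiE_mem hz

lemma phi_zero (S : RiemannSystem) (i : Fin 2) : S.phi i 0 = 0 := by
  rw [← S.phiE_eq ⟨le_rfl, zero_le_one⟩, phiE_zero]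

lemma volterra_zero (K : ℝ → ℝ → Matrix Idx Idx ℝ) (w : Idx → ℝ → ℝ) (k : Idx) :
    volterra K w k 0 = w k 0 := by
  simp [volterra]

/-- Differential flatness: for `t ≥ 0` the transformed state of any solution is determined by the
output `y`, through `flatState`. -/
lemma IsKernel.volterra_eq_flatState (hK : S.IsKernel K) (hx : S.IsSolution x u) {z t : ℝ}
    (hz : z ∈ Icc (0 : ℝ) 1) (ht : 0 ≤ t) (k : Idx) :
    volterra K (fun j ζ => x j ζ t) k z = S.flatState K (flatOutput K x) z t k := by
  have h01 : (0 : ℝ) ∈ Icc (0 : ℝ) 1 := ⟨le_rfl, zero_le_one⟩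
  -- `x₁⁻(0,·)`, the only boundary value that acts on `x̄`
  have hw : ∀ t, 0 ≤ t → x (Sum.inl 0) 0 t = -flatOutput K x 0 (t + S.tau 0) := by
    intro t ht
    have h := hK.volterra_inr hx 0 h01 ht
    simp only [volterra_zero, hx.bc_zero t ht 0, S.phi_zero, edgeCoeff, Sum.elim_inr,
      Matrix.cons_val_zero, zero_div, zero_mul, intervalIntegral.integral_zero, sub_zero] at h
    linear_combination -h
  have hplus : ∀ {z t : ℝ}, z ∈ Icc (0 : ℝ) 1 → 0 ≤ t →
      volterra K (fun j ζ => x j ζ t) (Sum.inr 1) z =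
        flatOutput K x 1 (t + S.tau 1 - S.phi 1 z) - ∫ ζ in z..1, S.a0p K ζ / S.lam 1 ζ
          * flatOutput K x 0 (t + S.tau 0 - S.phi 1 z + S.phi 1 ζ) := by
    intro z t hz ht
    rw [hK.volterra_inr hx 1 hz ht]
    congr 1
    refine intervalIntegral.integral_congr fun ζ hζ => ?_
    rw [uIcc_of_le hz.2] at hζ
    have hζ' : ζ ∈ Icc (0 : ℝ) 1 := ⟨hz.1.trans hζ.1, hζ.2⟩
    have hmono : S.phi 1 z ≤ S.phi 1 ζ := by
      rw [← S.phiE_eq hz, ← S.phiE_eq hζ']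
      exact (S.strictMono_phiE 1).monotone hζ.1
    simp only [edgeCoeff, Sum.elim_inr, Matrix.cons_val_one, Matrix.cons_val_fin_one]
    rw [hw _ (by linarith), show t - S.phi 1 z + S.phi 1 ζ + S.tau 0 =
      t + S.tau 0 - S.phi 1 z + S.phi 1 ζ by ring]
    ring
  rcases k with i | i
  · rw [hK.volterra_inl hx i hz ht, volterra_zero]
    have hT : 0 ≤ t + S.phi i z := add_nonneg ht (S.phi_mem hz).1
    have hneg : x (Sum.inl i) 0 (t + S.phi i z) = -x (Sum.inr i) 0 (t + S.phi i z) := by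
      rw [hx.bc_zero _ hT]; ring
    obtain rfl | rfl := fin_two_cases i
    · simp only [edgeCoeff, Sum.elim_inl, Matrix.cons_val_zero, zero_div, zero_mul,
        intervalIntegral.integral_zero, sub_zero, flatState]
      rw [hw _ hT, add_right_comm]
    · have h1 := hplus h01 hT
      rw [volterra_zero] at h1
      rw [hneg, h1]
      simp only [edgeCoeff, Sum.elim_inl, Matrix.cons_val_one, Matrix.cons_val_fin_one, flatState,
        S.phi_zero, sub_zero]
      have hI : ∫ ζ in (0 : ℝ)..z, S.a0m K ζ / S.lam 1 ζ
            * x (Sum.inl 0) 0 (t + S.phi 1 z - S.phi 1 ζ) =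
          -∫ ζ in (0 : ℝ)..z, S.a0m K ζ / S.lam 1 ζ
            * flatOutput K x 0 (t + S.tau 0 + S.phi 1 z - S.phi 1 ζ) := by
        rw [← intervalIntegral.integral_neg]
        refine intervalIntegral.integral_congr fun ζ hζ => ?_
        rw [uIcc_of_le hz.1] at hζ
        have hζ' : ζ ∈ Icc (0 : ℝ) 1 := ⟨hζ.1, hζ.2.trans hz.2⟩
        have hmono : S.phi 1 ζ ≤ S.phi 1 z := by
          rw [← S.phiE_eq hz, ← S.phiE_eq hζ']
          exact (S.strictMono_phiE 1).monotone hζ.2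
        rw [hw _ (by linarith), show t + S.phi 1 z - S.phi 1 ζ + S.tau 0 =
          t + S.tau 0 + S.phi 1 z - S.phi 1 ζ by ring]
        ring
      rw [hI, show t + S.phi 1 z + S.tau 1 = t + S.tau 1 + S.phi 1 z by ring,
        show t + S.phi 1 z + S.tau 0 = t + S.tau 0 + S.phi 1 z by ring]
      ring
  · fin_cases i
    · have := hK.volterra_inr hx 0 hz ht
      simpa [edgeCoeff, flatState] using this
    · have := hplus hz ht
      simpa [flatState] using this

/-! ### The hyperbolic controller form of the closed loop -/

/-- Borel measurable and locally bounded on `[0, ∞)`. -/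
def LocBddMeas (y : ℝ → ℝ) : Prop := ∀ T : ℝ, BddMeas ((Icc 0 T).indicator y)

lemma LocBddMeas.measurable {y : ℝ → ℝ} (hy : LocBddMeas y) :
    Measurable ((Ici (0 : ℝ)).indicator y) := by
  refine measurable_of_tendsto_metrizable (fun n : ℕ => (hy n).1) (tendsto_pi_nhds.2 fun t => ?_)
  refine tendsto_const_nhds.congr' ?_
  filter_upwards [Filter.eventually_ge_atTop ⌈t⌉₊] with n hn
  by_cases ht : 0 ≤ t
  · rw [indicator_of_mem (show t ∈ Ici (0 : ℝ) from ht),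
      indicator_of_mem (show t ∈ Icc (0 : ℝ) n from ⟨ht, Nat.ceil_le.1 hn⟩)]
  · rw [indicator_of_notMem (show t ∉ Ici (0 : ℝ) from ht),
      indicator_of_notMem (show t ∉ Icc (0 : ℝ) n from fun h => ht h.1)]

lemma LocBddMeas.exists_bound {y : ℝ → ℝ} (hy : LocBddMeas y) (T : ℝ) :
    ∃ C, ∀ t ∈ Icc 0 T, |y t| ≤ C := by
  obtain ⟨C, hC⟩ := (hy T).2
  exact ⟨C, fun t ht => by simpa [indicator_of_mem ht] using hC t⟩

lemma LocBddMeas.intervalIntegrable_mul {y ω r : ℝ → ℝ} (hy : LocBddMeas y) (hω : BddMeas ω)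
    (hr : Measurable r) {p q T : ℝ} (h : ∀ ζ ∈ uIcc p q, r ζ ∈ Icc 0 T) :
    IntervalIntegrable (fun ζ => ω ζ * y (r ζ)) volume p q := by
  refine ((hω.mul ((hy T).comp hr)).intervalIntegrable p q).congr fun ζ hζ => ?_
  simp only [indicator_of_mem (h ζ (uIoc_subset_uIcc hζ))]

lemma LocBddMeas.of_continuous {y : ℝ → ℝ} (hy : Continuous y) : LocBddMeas y := fun T => by
  obtain ⟨C, hC⟩ := isCompact_Icc.exists_bound_of_continuousOn (s := Icc 0 T) hy.continuousOn
  exact BddMeas.of_indicator measurableSet_Icc (hy.measurable.comp measurable_subtype_coe) hC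

lemma IsKernel.locBddMeas_flatOutput (hK : S.IsKernel K) (hx : S.IsSolution x u) (i : Fin 2) :
    LocBddMeas (flatOutput K x i) := by
  intro T
  have hb : BddMeas fun t => extX x T (Sum.inr i) 1 t
      - ∫ ζ in (0 : ℝ)..1, ∑ j, extK K (Sum.inr i) j 1 ζ * extX x T j ζ t := by
    refine ((hx.bddMeas_extX T (Sum.inr i)).section_left 1).sub ?_
    refine BddMeas.intervalIntegral
      (F := fun t ζ => ∑ j, extK K (Sum.inr i) j 1 ζ * extX x T j ζ t) ?_ measurable_const
      measurable_const fun _ => le_rfl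
    exact BddMeas.sum fun j _ => (((hK.bddMeas_extK (Sum.inr i) j).section_left 1).comp
      measurable_snd).mul ((hx.bddMeas_extX T j).comp measurable_swap)
  have : (Icc 0 T).indicator (flatOutput K x i) = (Icc 0 T).indicator fun t =>
      extX x T (Sum.inr i) 1 t
        - ∫ ζ in (0 : ℝ)..1, ∑ j, extK K (Sum.inr i) j 1 ζ * extX x T j ζ t := by
    refine indicator_congr fun t ht => ?_
    have h1 : (1 : ℝ) ∈ Icc (0 : ℝ) 1 := ⟨zero_le_one, le_rfl⟩
    rw [flatOutput, volterra_eq K _ _ h1, extX_of_mem h1 ht, volterraInt]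
    congr 1
    refine intervalIntegral.integral_congr fun ζ hζ => ?_
    rw [uIcc_of_le zero_le_one] at hζ
    exact Finset.sum_congr rfl fun j _ => by rw [extX_of_mem hζ ht]
  rw [this]
  exact hb.indicator measurableSet_Icc

/-- `a₀⁻` as a bounded Borel function on the real line. -/
lemma IsKernel.exists_a0m (hK : S.IsKernel K) :
    ∃ m : ℝ → ℝ, BddMeas m ∧ ∀ z ∈ Icc (0 : ℝ) 1, S.a0m K z = m z := by
  refine ⟨fun z => (extK K (Sum.inl 1) (Sum.inl 0) z 0 + extK K (Sum.inl 1) (Sum.inr 0) z 0)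
    * S.lam 0 0, (((hK.bddMeas_extK _ _).section_right 0).add
      ((hK.bddMeas_extK _ _).section_right 0)).mul (BddMeas.const _), fun z hz => ?_⟩
  simp only [a0m, extK_of_mem le_rfl hz.1 hz.2]

/-- `a₀⁺` as a bounded Borel function on the real line. -/
lemma IsKernel.exists_a0p (hK : S.IsKernel K) :
    ∃ m : ℝ → ℝ, BddMeas m ∧ ∀ z ∈ Icc (0 : ℝ) 1, S.a0p K z = m z := by
  refine ⟨fun z => -(extK K (Sum.inr 1) (Sum.inl 0) z 0 + extK K (Sum.inr 1) (Sum.inr 0) z 0)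
    * S.lam 0 0, (((hK.bddMeas_extK _ _).section_right 0).add
      ((hK.bddMeas_extK _ _).section_right 0)).neg.mul (BddMeas.const _), fun z hz => ?_⟩
  simp only [a0p, extK_of_mem le_rfl hz.1 hz.2]

lemma dtau_nonneg (S : RiemannSystem) : 0 ≤ S.dtau := sub_nonneg.2 S.tau_le

/-- The delays in the parametrization of `ū₂` by the output, rewritten in the form in which they
occur in the HCF: the part with delays up to `2 τ₁` in terms of the HCF state, the rest as a
prediction. -/
lemma IsKernel.hcf_integral_identity (hK : S.IsKernel K) {Y : ℝ → ℝ} (hY : LocBddMeas Y) {t : ℝ}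
    (ht : 0 ≤ t) :
    (∫ ζ in (0 : ℝ)..1, S.a0p K ζ / S.lam 1 ζ * Y (t + S.tau 0 + S.phi 1 1 + S.phi 1 ζ))
      + (∫ ζ in (0 : ℝ)..1, S.a0m K ζ / S.lam 1 ζ * Y (t + S.tau 0 + S.phi 1 1 - S.phi 1 ζ)) =
    (∫ τ in (S.tau 0)..(2 * S.tau 0), S.abm K (S.tau 0 + S.tau 1 - τ) * Y (t + τ))
      + ∫ τ in (0 : ℝ)..(S.dtau + S.tau 1), S.atil K τ * Y (t + τ + 2 * S.tau 0) := by
  obtain ⟨m, hm, hme⟩ := hK.exists_a0m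
  obtain ⟨p, hp, hpe⟩ := hK.exists_a0p
  have h0 := S.tau_pos 0
  have h1 := S.tau_pos 1
  have hd := S.dtau_nonneg
  have hdd : S.dtau = S.tau 1 - S.tau 0 := rfl
  have hmm : BddMeas fun σ => m (S.psiE 1 σ) := hm.comp (S.continuous_psiE 1).measurable
  have hpm : BddMeas fun σ => p (S.psiE 1 σ) := hp.comp (S.continuous_psiE 1).measurable
  have hab : ∀ σ ∈ Icc 0 (S.tau 1), S.abm K σ = m (S.psiE 1 σ) := fun σ hσ => by
    rw [abm, S.psi_eq hσ, hme _ (S.psiE_mem hσ)]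
  have hap : ∀ σ ∈ Icc 0 (S.tau 1), S.abp K σ = p (S.psiE 1 σ) := fun σ hσ => by
    rw [abp, S.psi_eq hσ, hpe _ (S.psiE_mem hσ)]
  have h00 : (0 : ℝ) ∈ Icc (0 : ℝ) 1 := ⟨le_rfl, zero_le_one⟩
  have h11 : (1 : ℝ) ∈ Icc (0 : ℝ) 1 := ⟨zero_le_one, le_rfl⟩
  have hphi1 : S.phi 1 1 = S.tau 1 := rfl
  -- in the travel time `σ = φ₂(ζ)` all integrals have the weights `ā₀⁺` and `ā₀⁻`
  have eP : ∫ ζ in (0 : ℝ)..1, S.a0p K ζ / S.lam 1 ζ * Y (t + S.tau 0 + S.phi 1 1 + S.phi 1 ζ) =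
      ∫ σ in (0 : ℝ)..S.tau 1, p (S.psiE 1 σ) * Y (t + S.tau 0 + S.tau 1 + σ) := by
    have h := S.integral_travel_time 1
      (fun σ => p (S.psiE 1 σ) * Y (t + S.tau 0 + S.tau 1 + σ)) h00 h11
    rw [S.phi_zero, hphi1] at h
    rw [h]
    refine intervalIntegral.integral_congr fun ζ hζ => ?_
    rw [uIcc_of_le zero_le_one] at hζ
    rw [S.psiE_phi hζ, hpe ζ hζ, hphi1]
    ring
  have eM : ∫ ζ in (0 : ℝ)..1, S.a0m K ζ / S.lam 1 ζ * Y (t + S.tau 0 + S.phi 1 1 - S.phi 1 ζ) =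
      ∫ σ in (0 : ℝ)..S.tau 1, m (S.psiE 1 σ) * Y (t + S.tau 0 + S.tau 1 - σ) := by
    have h := S.integral_travel_time 1
      (fun σ => m (S.psiE 1 σ) * Y (t + S.tau 0 + S.tau 1 - σ)) h00 h11
    rw [S.phi_zero, hphi1] at h
    rw [h]
    refine intervalIntegral.integral_congr fun ζ hζ => ?_
    rw [uIcc_of_le zero_le_one] at hζ
    rw [S.psiE_phi hζ, hme ζ hζ, hphi1]
    ring
  have eA : ∫ τ in (S.tau 0)..(2 * S.tau 0), S.abm K (S.tau 0 + S.tau 1 - τ) * Y (t + τ) =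
      ∫ σ in S.dtau..S.tau 1, m (S.psiE 1 σ) * Y (t + S.tau 0 + S.tau 1 - σ) := by
    have h := intervalIntegral.integral_comp_sub_left
      (fun σ => m (S.psiE 1 σ) * Y (t + S.tau 0 + S.tau 1 - σ)) (S.tau 0 + S.tau 1)
      (a := S.tau 0) (b := 2 * S.tau 0)
    rw [show S.tau 0 + S.tau 1 - 2 * S.tau 0 = S.dtau by rw [hdd]; ring,
      show S.tau 0 + S.tau 1 - S.tau 0 = S.tau 1 by ring] at h
    rw [← h]
    refine intervalIntegral.integral_congr fun τ hτ => ?_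
    rw [uIcc_of_le (by linarith)] at hτ
    rw [hab _ ⟨by linarith [hτ.2], by linarith [hτ.1]⟩,
      show t + S.tau 0 + S.tau 1 - (S.tau 0 + S.tau 1 - τ) = t + τ by ring]
  -- the two branches of `ã₀` overlap in a single point only
  have hne : ∀ᵐ τ : ℝ, τ ≠ S.dtau := by simp [ae_iff]
  have eB1 : ∀ᵐ τ : ℝ, τ ∈ uIoc 0 S.dtau → m (S.psiE 1 (S.dtau - τ)) * Y (t + τ + 2 * S.tau 0) =
      S.atil K τ * Y (t + τ + 2 * S.tau 0) := by
    filter_upwards [hne] with τ hτ hmem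
    rw [uIoc_of_le hd] at hmem
    have hlt : τ < S.dtau := lt_of_le_of_ne hmem.2 hτ
    have e1 : heaviside (S.dtau - τ) = 1 := if_pos (by linarith)
    have e2 : heaviside (τ - S.dtau) = 0 := if_neg (by linarith)
    rw [atil, e1, e2, hab _ ⟨by linarith, by linarith [hmem.1]⟩]
    ring
  have eB2 : ∀ᵐ τ : ℝ, τ ∈ uIoc S.dtau (S.dtau + S.tau 1) →
      p (S.psiE 1 (τ - S.dtau)) * Y (t + τ + 2 * S.tau 0) =
      S.atil K τ * Y (t + τ + 2 * S.tau 0) := by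
    refine Filter.Eventually.of_forall fun τ hmem => ?_
    rw [uIoc_of_le (by linarith)] at hmem
    have e1 : heaviside (S.dtau - τ) = 0 := if_neg (by linarith [hmem.1])
    have e2 : heaviside (τ - S.dtau) = 1 := if_pos (by linarith [hmem.1])
    rw [atil, e1, e2, hap _ ⟨by linarith [hmem.1], by linarith [hmem.2]⟩]
    ring
  have i1 : IntervalIntegrable (fun τ => S.atil K τ * Y (t + τ + 2 * S.tau 0)) volume 0 S.dtau := by
    have : IntervalIntegrable (fun τ => m (S.psiE 1 (S.dtau - τ)) * Y (t + τ + 2 * S.tau 0)) volume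
        0 S.dtau := by
      refine hY.intervalIntegrable_mul (T := t + S.dtau + 2 * S.tau 0)
        (hmm.comp (by fun_prop : Measurable fun τ : ℝ => S.dtau - τ)) (by fun_prop) fun τ hτ => ?_
      rw [uIcc_of_le hd] at hτ
      exact ⟨by linarith [hτ.1], by linarith [hτ.2]⟩
    refine this.congr_ae ?_
    rw [Filter.EventuallyEq, ae_restrict_iff' measurableSet_uIoc]
    exact eB1
  have i2 : IntervalIntegrable (fun τ => S.atil K τ * Y (t + τ + 2 * S.tau 0)) volume S.dtau
      (S.dtau + S.tau 1) := by
    have : IntervalIntegrable (fun τ => p (S.psiE 1 (τ - S.dtau)) * Y (t + τ + 2 * S.tau 0)) volume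
        S.dtau (S.dtau + S.tau 1) := by
      refine hY.intervalIntegrable_mul (T := t + (S.dtau + S.tau 1) + 2 * S.tau 0)
        (hpm.comp (by fun_prop : Measurable fun τ : ℝ => τ - S.dtau)) (by fun_prop) fun τ hτ => ?_
      rw [uIcc_of_le (by linarith)] at hτ
      exact ⟨by linarith [hτ.1], by linarith [hτ.2]⟩
    refine this.congr_ae ?_
    rw [Filter.EventuallyEq, ae_restrict_iff' measurableSet_uIoc]
    exact eB2
  have eB1' : ∫ τ in (0 : ℝ)..S.dtau, S.atil K τ * Y (t + τ + 2 * S.tau 0) =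
      ∫ σ in (0 : ℝ)..S.dtau, m (S.psiE 1 σ) * Y (t + S.tau 0 + S.tau 1 - σ) := by
    have h := intervalIntegral.integral_comp_sub_left
      (fun σ => m (S.psiE 1 σ) * Y (t + S.tau 0 + S.tau 1 - σ)) S.dtau (a := 0) (b := S.dtau)
    rw [sub_self, sub_zero] at h
    rw [← h, ← intervalIntegral.integral_congr_ae eB1]
    refine intervalIntegral.integral_congr fun τ _ => ?_
    simp only [hdd]
    rw [show t + S.tau 0 + S.tau 1 - (S.tau 1 - S.tau 0 - τ) = t + τ + 2 * S.tau 0 by ring]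
  have eB2' : ∫ τ in S.dtau..(S.dtau + S.tau 1), S.atil K τ * Y (t + τ + 2 * S.tau 0) =
      ∫ σ in (0 : ℝ)..S.tau 1, p (S.psiE 1 σ) * Y (t + S.tau 0 + S.tau 1 + σ) := by
    have h := intervalIntegral.integral_comp_sub_right
      (fun σ => p (S.psiE 1 σ) * Y (t + S.tau 0 + S.tau 1 + σ)) S.dtau (a := S.dtau)
      (b := S.dtau + S.tau 1)
    rw [sub_self, add_sub_cancel_left] at h
    rw [← h, ← intervalIntegral.integral_congr_ae eB2]
    refine intervalIntegral.integral_congr fun τ _ => ?_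
    simp only [hdd]
    rw [show t + S.tau 0 + S.tau 1 + (τ - (S.tau 1 - S.tau 0)) = t + τ + 2 * S.tau 0 by ring]
  have j : ∀ {c d : ℝ}, 0 ≤ c → c ≤ d → d ≤ S.tau 1 → IntervalIntegrable
      (fun σ => m (S.psiE 1 σ) * Y (t + S.tau 0 + S.tau 1 - σ)) volume c d := by
    intro c d hc hcd hd1
    refine hY.intervalIntegrable_mul (T := t + S.tau 0 + S.tau 1) hmm (by fun_prop) fun σ hσ => ?_
    rw [uIcc_of_le hcd] at hσ
    exact ⟨by linarith [hσ.2], by linarith [hσ.1]⟩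
  -- `[0, τ₂]` is split at `Δτ`: for `σ = Δτ` the argument of `Y` is `t + 2 τ₁`, the end of the
  -- profile `η₁(·, t)`
  rw [eP, eM, eA, ← intervalIntegral.integral_add_adjacent_intervals i1 i2, eB1', eB2',
    ← intervalIntegral.integral_add_adjacent_intervals (j le_rfl hd (by linarith))
      (j hd (by linarith) le_rfl)]
  ring

lemma inputFeedback_boundary (S : RiemannSystem) (w : Idx → ℝ → ℝ) (ubar : Fin 2 → ℝ) (i : Fin 2) :
    (S.B.mulVec (S.inputFeedback K w ubar)) i =
      ubar i - w (Sum.inr i) 1 + ∫ ζ in (0 : ℝ)..1, ∑ j, K 1 ζ (Sum.inl i) j * w j ζ := by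
  rw [inputFeedback, Matrix.mulVec_mulVec, Matrix.mul_nonsing_inv _ S.B_isUnit, Matrix.one_mulVec]

/-- The output of the closed loop solves the HCF. -/
lemma IsKernel.isHCFSolution (hK : S.IsKernel K) {γ : Fin 2 → ℝ} {yr : Fin 2 → ℝ → ℝ}
    (hx : S.IsClosedLoop K γ yr x) :
    S.IsHCFSolution K (hcfState K x) (S.loopInput K γ yr x) := by
  have hsol : S.IsSolution x _ := hx
  have hY := hK.locBddMeas_flatOutput hsol
  -- in the new input, the actuated boundary condition is `x̄⁻(1,t) = ū(t)`
  have hbc : ∀ t, 0 ≤ t → ∀ i, S.loopInput K γ yr x t i =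
      S.flatState K (flatOutput K x) 1 t (Sum.inl i) := by
    intro t ht i
    rw [← hK.volterra_eq_flatState hsol ⟨zero_le_one, le_rfl⟩ ht, volterra, hsol.bc_one t ht i,
      inputFeedback_boundary]
    ring
  have hbc0 : ∀ t, 0 ≤ t → S.loopInput K γ yr x t 0 = -flatOutput K x 0 (t + 2 * S.tau 0) := by
    intro t ht
    rw [hbc t ht 0]
    simp only [flatState, Sum.elim_inl, Matrix.cons_val_zero]
    rw [show t + S.tau 0 + S.phi 0 1 = t + 2 * S.tau 0 by rw [tau]; ring]
  refine ⟨fun i => ?_, fun T => ?_, fun i τ _ τ' _ t t' _ _ h => ?_, fun t ht => ?_, fun t ht => ?_⟩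
  · refine measurable_domRestrict_of_eqOn
      (g := fun q : ℝ × ℝ => (Ici (0 : ℝ)).indicator (flatOutput K x i) (q.2 + q.1))
      ((hY i).measurable.comp (measurable_snd.add measurable_fst)) fun q hq => ?_
    rw [indicator_of_mem (show q.2 + q.1 ∈ Ici (0 : ℝ) from add_nonneg hq.2 hq.1.1)]
    rfl
  · obtain ⟨C0, hC0⟩ := (hY 0).exists_bound (T + 2 * S.tau 0)
    obtain ⟨C1, hC1⟩ := (hY 1).exists_bound (T + 2 * S.tau 1)
    refine ⟨max C0 C1, fun i τ hτ t ht => ?_⟩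
    have hm : t + τ ∈ Icc 0 (T + 2 * S.tau i) :=
      ⟨add_nonneg ht.1 hτ.1, add_le_add ht.2 hτ.2⟩
    obtain rfl | rfl := fin_two_cases i
    · exact (hC0 _ hm).trans (le_max_left _ _)
    · exact (hC1 _ hm).trans (le_max_right _ _)
  · rw [hcfState, hcfState, add_comm t, h, add_comm t']
  · rw [hbc0 t ht, neg_neg, hcfState]
  · have h1 := hbc t ht 1
    simp only [flatState, Sum.elim_inl, Matrix.cons_val_one, Matrix.cons_val_fin_one] at h1
    have hid := hK.hcf_integral_identity (hY 0) ht
    have hB : ∫ τ in (0 : ℝ)..(S.dtau + S.tau 1), S.atil K τ * S.loopInput K γ yr x (t + τ) 0 =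
        -∫ τ in (0 : ℝ)..(S.dtau + S.tau 1), S.atil K τ
          * flatOutput K x 0 (t + τ + 2 * S.tau 0) := by
      rw [← intervalIntegral.integral_neg]
      refine intervalIntegral.integral_congr fun τ hτ => ?_
      rw [uIcc_of_le (add_nonneg S.dtau_nonneg (S.tau_pos 1).le)] at hτ
      rw [hbc0 _ (add_nonneg ht hτ.1)]
      ring
    rw [hB]
    simp only [hcfState]
    rw [show t + S.tau 1 + S.phi 1 1 = t + 2 * S.tau 1 by rw [tau]; ring] at h1
    linear_combination h1 + hid

/-! ### Tracking error -/

variable {η : Fin 2 → ℝ → ℝ → ℝ} {ubar : ℝ → Fin 2 → ℝ}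

lemma IsHCFSolution.eq_zero_shift (hη : S.IsHCFSolution K η ubar) (i : Fin 2) {τ t : ℝ}
    (hτ : τ ∈ Icc 0 (2 * S.tau i)) (ht : 0 ≤ t) : η i τ t = η i 0 (t + τ) :=
  hη.transport i τ hτ 0 ⟨le_rfl, hτ.1.trans hτ.2⟩ t (t + τ) ht (add_nonneg ht hτ.1) (by ring)

/-- Along a trajectory on which the first component of the error dynamics holds, the prediction is
exact. -/
lemma IsHCFSolution.predict_eq (hη : S.IsHCFSolution K η ubar) {g : ℝ} {yr : ℝ → ℝ}
    (he : ∀ t, 0 ≤ t → η 0 (2 * S.tau 0) t - yr (t + 2 * S.tau 0) = -g * (η 0 0 t - yr t))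
    {t σ : ℝ} (ht : 0 ≤ t) (hσ : 0 ≤ σ) :
    S.predict g yr t (fun τ => η 0 τ t) σ = η 0 0 (t + σ) := by
  have hpos : 0 < 2 * S.tau 0 := by linarith [S.tau_pos 0]
  have key : ∀ n : ℕ, ∀ σ, 0 ≤ σ → σ ≤ n * (2 * S.tau 0) →
      S.predictAux g yr t (fun τ => η 0 τ t) n σ = η 0 0 (t + σ) := by
    intro n
    induction n with
    | zero =>
      intro σ h0 h1
      have : σ = 0 := le_antisymm (by simpa using h1) h0
      subst this
      rw [add_zero]
      rfl
    | succ n ih =>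
      intro σ h0 h1
      rw [predictAux]
      split_ifs with h
      · exact hη.eq_zero_shift 0 ⟨h0, h⟩ ht
      · push Not at h
        push_cast at h1
        rw [ih _ (by linarith) (by linarith)]
        have hs : 0 ≤ t + (σ - 2 * S.tau 0) := by linarith
        have e1 := hη.eq_zero_shift 0 ⟨hpos.le, le_rfl⟩ hs
        have e2 := he _ hs
        rw [e1, show t + (σ - 2 * S.tau 0) + 2 * S.tau 0 = t + σ by ring] at e2
        rw [show t + (σ - 2 * S.tau 0) = t + σ - 2 * S.tau 0 by ring] at e2 ⊢
        linear_combination -e2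
  refine key _ σ hσ ?_
  rw [← div_le_iff₀ hpos]
  exact Nat.le_ceil _

lemma IsHCFSolution.errorDynamics (hη : S.IsHCFSolution K η ubar) {γ : Fin 2 → ℝ}
    {yr : Fin 2 → ℝ → ℝ}
    (hu : ∀ t, 0 ≤ t → ubar t = S.controller K γ yr t (fun i τ => η i τ t)) :
    S.ErrorDynamics γ yr η := by
  have hu0 : ∀ t, 0 ≤ t → ubar t 0 = -S.trackV γ yr t (fun i τ => η i τ t) 0 := fun t ht => by
    rw [hu t ht]; rfl
  have h0 : ∀ t, 0 ≤ t → η 0 (2 * S.tau 0) t - yr 0 (t + 2 * S.tau 0) =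
      -γ 0 * (η 0 0 t - yr 0 t) := by
    intro t ht
    rw [hη.bc_one t ht, hu0 t ht, trackV]
    ring
  intro i t ht
  obtain rfl | rfl := fin_two_cases i
  · exact h0 t ht
  · have hu1 : ubar t 1 = -S.trackV γ yr t (fun i τ => η i τ t) 1
        + (∫ τ in (S.tau 0)..(2 * S.tau 0), S.abm K (S.tau 0 + S.tau 1 - τ) * η 0 τ t)
        + ∫ τ in (0 : ℝ)..(S.dtau + S.tau 1), S.atil K τ
          * S.predictV γ yr t (fun i τ => η i τ t) τ := by
      rw [hu t ht]; rfl
    have hI : ∫ τ in (0 : ℝ)..(S.dtau + S.tau 1), S.atil K τ * ubar (t + τ) 0 =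
        -∫ τ in (0 : ℝ)..(S.dtau + S.tau 1), S.atil K τ
          * S.predictV γ yr t (fun i τ => η i τ t) τ := by
      rw [← intervalIntegral.integral_neg]
      refine intervalIntegral.integral_congr fun τ hτ => ?_
      rw [uIcc_of_le (add_nonneg S.dtau_nonneg (S.tau_pos 1).le)] at hτ
      rw [hu0 _ (add_nonneg ht hτ.1), trackV, predictV, hη.predict_eq h0 ht hτ.1,
        show t + 2 * S.tau 0 + τ = t + τ + 2 * S.tau 0 by ring]
      ring
    rw [hη.bc_two t ht, hu1, hI, trackV]
    ring

/-- A function with `e (s + d) = -g e(s)` and `|g| ≤ exp (-μ d)` decays with rate `μ`. -/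
lemma exists_exp_bound {e : ℝ → ℝ} {g d μ M : ℝ} (hd : 0 < d) (hg : |g| ≤ Real.exp (-μ * d))
    (hμ : 0 ≤ μ) (he : ∀ s, 0 ≤ s → e (s + d) = -g * e s) (hM : ∀ s ∈ Icc 0 d, |e s| ≤ M) :
    ∀ s, 0 ≤ s → |e s| ≤ M * Real.exp (μ * d) * Real.exp (-μ * s) := by
  have hM0 : 0 ≤ M := (abs_nonneg _).trans (hM 0 ⟨le_rfl, hd.le⟩)
  have key : ∀ n : ℕ, ∀ s, 0 ≤ s → s ≤ (n + 1) * d →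
      |e s| ≤ M * Real.exp (μ * d) * Real.exp (-μ * s) := by
    intro n
    induction n with
    | zero =>
      intro s h0 h1
      have hs : s ≤ d := by simpa using h1
      refine (hM s ⟨h0, hs⟩).trans ?_
      rw [mul_assoc, ← Real.exp_add]
      refine le_mul_of_one_le_right hM0 (Real.one_le_exp ?_)
      nlinarith
    | succ n ih =>
      intro s h0 h1
      push_cast at h1
      by_cases hs : s ≤ d
      · refine ih s h0 (hs.trans ?_)
        nlinarith [Nat.cast_nonneg (α := ℝ) n]
      · have h2 := ih (s - d) (by linarith) (by linarith)
        have h3 := he (s - d) (by linarith)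
        rw [sub_add_cancel] at h3
        rw [h3, abs_mul, abs_neg]
        calc |g| * |e (s - d)|
            ≤ Real.exp (-μ * d) * (M * Real.exp (μ * d) * Real.exp (-μ * (s - d))) :=
              mul_le_mul hg h2 (abs_nonneg _) (Real.exp_pos _).le
          _ = M * Real.exp (μ * d) * Real.exp (-μ * s) := by
              rw [show -μ * s = -μ * d + -μ * (s - d) by ring, Real.exp_add (-μ * d)]
              ring
  intro s hs
  refine key ⌈s / d⌉₊ s hs ?_
  have := (div_le_iff₀ hd).1 (Nat.le_ceil (s / d))
  linarith

lemma IsHCFSolution.converges (hη : S.IsHCFSolution K η ubar) {γ : Fin 2 → ℝ} {yr : Fin 2 → ℝ → ℝ}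
    (hyr : ∀ i, Continuous (yr i)) (he : S.ErrorDynamics γ yr η) {μ : ℝ} (hμ : 0 ≤ μ)
    (hγ : ∀ i, |γ i| ≤ Real.exp (-μ * (2 * S.tau i))) : HCFConverges S μ yr η := by
  obtain ⟨Cη, hCη⟩ := hη.bounded 0
  have hex : ∀ i, ∃ C, ∀ s, 0 ≤ s → |η i 0 s - yr i s| ≤ C * Real.exp (-μ * s) := by
    intro i
    have hd : 0 < 2 * S.tau i := by linarith [S.tau_pos i]
    obtain ⟨Cr, hCr⟩ := isCompact_Icc.exists_bound_of_continuousOn (s := Icc 0 (2 * S.tau i))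
      (hyr i).continuousOn
    refine ⟨_, exists_exp_bound (e := fun s => η i 0 s - yr i s) (M := Cη + Cr) hd (hγ i) hμ
      (fun s hs => ?_) fun s hs => ?_⟩
    · have := he i s hs
      rwa [hη.eq_zero_shift i ⟨hd.le, le_rfl⟩ hs] at this
    · have h1 := hη.eq_zero_shift i hs (le_refl 0)
      rw [zero_add] at h1
      simp only [← h1]
      exact (abs_sub _ _).trans (add_le_add (hCη i s hs 0 ⟨le_rfl, le_rfl⟩) (hCr s hs))
  choose C hC using hex
  have hC0 : ∀ i, 0 ≤ C i := fun i => by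
    have := (abs_nonneg _).trans (hC i 0 le_rfl)
    simpa using this
  refine ⟨C 0 + C 1, fun t ht i τ hτ => ?_⟩
  rw [hη.eq_zero_shift i hτ ht]
  refine (hC i _ (add_nonneg ht hτ.1)).trans (mul_le_mul ?_ ?_ (Real.exp_pos _).le
    (add_nonneg (hC0 0) (hC0 1)))
  · obtain rfl | rfl := fin_two_cases i <;> linarith [hC0 0, hC0 1]
  · exact Real.exp_le_exp.2 (by nlinarith [hτ.1])

/-! ### The reference state -/

lemma continuous_reference {t0 tT : ℝ} {y0 yT : Fin 2 → ℝ} {p : Fin 2 → ℝ → ℝ} (h : t0 < tT)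
    (hp : ∀ i, ContinuousOn (p i) (Icc t0 tT)) (h0 : ∀ i, p i t0 = y0 i) (hT : ∀ i, p i tT = yT i)
    (i : Fin 2) : Continuous (reference t0 tT y0 yT p i) := by
  have he : reference t0 tT y0 yT p i = fun t => p i (max t0 (min t tT)) := by
    ext t
    rw [reference]
    split_ifs with h1 h2
    · rw [min_eq_left (h1.trans h).le, max_eq_left h1.le, h0]
    · rw [min_eq_left h2, max_eq_right (not_lt.1 h1)]
    · rw [min_eq_right (not_le.1 h2).le, max_eq_right h.le, hT]
  rw [he]
  exact (hp i).comp_continuous (by fun_prop) fun t =>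
    ⟨le_max_left _ _, max_le h.le (min_le_right _ _)⟩

/-- The flatness-based parametrization with the continued travel times, for weights `ωp`, `ωm`
in place of `a₀⁺ / λ₂`, `a₀⁻ / λ₂`. -/
noncomputable def flatStateE (S : RiemannSystem) (ωp ωm : ℝ → ℝ) (y : Fin 2 → ℝ → ℝ) (z t : ℝ) :
    Idx → ℝ :=
  Sum.elim
    ![-y 0 (t + S.tau 0 + S.phiE 0 z),
      -y 1 (t + S.tau 1 + S.phiE 1 z)
        + (∫ ζ in (0 : ℝ)..1, ωp ζ * y 0 (t + S.tau 0 + S.phiE 1 z + S.phiE 1 ζ))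
        + ∫ ζ in (0 : ℝ)..max 0 (min z 1), ωm ζ * y 0 (t + S.tau 0 + S.phiE 1 z - S.phiE 1 ζ)]
    ![y 0 (t + S.tau 0 - S.phiE 0 z),
      y 1 (t + S.tau 1 - S.phiE 1 z)
        - ∫ ζ in (max 0 (min z 1))..1, ωp ζ * y 0 (t + S.tau 0 - S.phiE 1 z + S.phiE 1 ζ)]

lemma flatState_eq_flatStateE {ωp ωm : ℝ → ℝ}
    (hp : ∀ ζ ∈ Icc (0 : ℝ) 1, S.a0p K ζ / S.lam 1 ζ = ωp ζ)
    (hm : ∀ ζ ∈ Icc (0 : ℝ) 1, S.a0m K ζ / S.lam 1 ζ = ωm ζ) {Y y : Fin 2 → ℝ → ℝ} {t : ℝ}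
    (hY : ∀ i, ∀ s ∈ Icc t (t + S.tau 0 + 2 * S.tau 1), Y i s = y i s) {z : ℝ}
    (hz : z ∈ Icc (0 : ℝ) 1) : S.flatState K y z t = S.flatStateE ωp ωm Y z t := by
  have h0 := S.tau_pos 0
  have h1 := S.tau_pos 1
  have h01 := S.tau_le
  have p0 := S.phi_mem (i := 0) hz
  have p1 := S.phi_mem (i := 1) hz
  have mono : ∀ {a b : ℝ}, a ∈ Icc (0 : ℝ) 1 → b ∈ Icc (0 : ℝ) 1 → a ≤ b → S.phi 1 a ≤ S.phi 1 b :=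
    fun {a b} ha hb hab => by
      rw [← S.phiE_eq ha, ← S.phiE_eq hb]
      exact (S.strictMono_phiE 1).monotone hab
  have i1 : ∫ ζ in (0 : ℝ)..1, S.a0p K ζ / S.lam 1 ζ
        * y 0 (t + S.tau 0 + S.phi 1 z + S.phi 1 ζ) =
      ∫ ζ in (0 : ℝ)..1, ωp ζ * Y 0 (t + S.tau 0 + S.phi 1 z + S.phiE 1 ζ) := by
    refine intervalIntegral.integral_congr fun ζ hζ => ?_
    rw [uIcc_of_le zero_le_one] at hζ
    have := S.phi_mem (i := 1) hζ
    rw [hp ζ hζ, S.phiE_eq hζ, hY 0 _ ⟨by linarith [p1.1, this.1], by linarith [p1.2, this.2]⟩]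
  have i2 : ∫ ζ in (0 : ℝ)..z, S.a0m K ζ / S.lam 1 ζ
        * y 0 (t + S.tau 0 + S.phi 1 z - S.phi 1 ζ) =
      ∫ ζ in (0 : ℝ)..z, ωm ζ * Y 0 (t + S.tau 0 + S.phi 1 z - S.phiE 1 ζ) := by
    refine intervalIntegral.integral_congr fun ζ hζ => ?_
    rw [uIcc_of_le hz.1] at hζ
    have hζ' : ζ ∈ Icc (0 : ℝ) 1 := ⟨hζ.1, hζ.2.trans hz.2⟩
    have := S.phi_mem (i := 1) hζ'
    rw [hm ζ hζ', S.phiE_eq hζ', hY 0 _ ⟨by linarith [mono hζ' hz hζ.2],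
      by linarith [p1.2, this.1]⟩]
  have i3 : ∫ ζ in z..1, S.a0p K ζ / S.lam 1 ζ
        * y 0 (t + S.tau 0 - S.phi 1 z + S.phi 1 ζ) =
      ∫ ζ in z..1, ωp ζ * Y 0 (t + S.tau 0 - S.phi 1 z + S.phiE 1 ζ) := by
    refine intervalIntegral.integral_congr fun ζ hζ => ?_
    rw [uIcc_of_le hz.2] at hζ
    have hζ' : ζ ∈ Icc (0 : ℝ) 1 := ⟨hz.1.trans hζ.1, hζ.2⟩
    have := S.phi_mem (i := 1) hζ'
    rw [hp ζ hζ', S.phiE_eq hζ', hY 0 _ ⟨by linarith [mono hz hζ' hζ.1],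
      by linarith [p1.1, this.2]⟩]
  rw [flatState, flatStateE, i1, i2, i3, min_eq_left hz.2, max_eq_right hz.1, S.phiE_eq hz,
    S.phiE_eq hz, hY 0 _ ⟨by linarith [p0.1], by linarith [p0.2]⟩,
    hY 1 _ ⟨by linarith [p1.1], by linarith [p1.2]⟩,
    hY 0 _ ⟨by linarith [p0.2], by linarith [p0.1]⟩,
    hY 1 _ ⟨by linarith [p1.2], by linarith [p1.1]⟩]

lemma bddMeas_inv_lamE (S : RiemannSystem) (i : Fin 2) : BddMeas fun z => (S.lamE i z)⁻¹ := by
  obtain ⟨C, hC⟩ := isCompact_Icc.exists_bound_of_continuousOn (s := Icc (0 : ℝ) 1)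
    (f := fun z => (S.lamE i z)⁻¹)
    ((S.continuous_lamE i).inv₀ fun z => (S.lamE_pos i z).ne').continuousOn
  refine ⟨(S.continuous_lamE i).measurable.inv, C, fun z => ?_⟩
  have h := hC _ (clamp_mem z)
  rwa [S.lamE_eq (clamp_mem z)] at h

lemma IsKernel.exists_weights (hK : S.IsKernel K) :
    ∃ ωp ωm : ℝ → ℝ, BddMeas ωp ∧ BddMeas ωm ∧
      (∀ ζ ∈ Icc (0 : ℝ) 1, S.a0p K ζ / S.lam 1 ζ = ωp ζ) ∧
      ∀ ζ ∈ Icc (0 : ℝ) 1, S.a0m K ζ / S.lam 1 ζ = ωm ζ := by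
  obtain ⟨m, hm, hme⟩ := hK.exists_a0m
  obtain ⟨p, hp, hpe⟩ := hK.exists_a0p
  refine ⟨_, _, hp.mul (S.bddMeas_inv_lamE 1), hm.mul (S.bddMeas_inv_lamE 1), fun ζ hζ => ?_,
    fun ζ hζ => ?_⟩
  · rw [hpe ζ hζ, S.lamE_eq hζ, div_eq_mul_inv]
  · rw [hme ζ hζ, S.lamE_eq hζ, div_eq_mul_inv]

lemma bddMeas_flatStateE {ωp ωm : ℝ → ℝ} (hp : BddMeas ωp) (hm : BddMeas ωm) {y : Fin 2 → ℝ → ℝ}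
    (hy : ∀ i, BddMeas (y i)) (t : ℝ) (k : Idx) : BddMeas fun z => S.flatStateE ωp ωm y z t k := by
  have hφ : ∀ i, Measurable (S.phiE i) := fun i => (S.continuous_phiE i).measurable
  have hcl : Measurable fun z : ℝ => max 0 (min z 1) := by fun_prop
  have k1 : ∀ q : ℝ → ℝ, Measurable q → ∀ i, BddMeas fun z => y i (q z) := fun q hq i =>
    (hy i).comp hq
  have k2 : ∀ (ω : ℝ → ℝ) (r : ℝ → ℝ → ℝ) (a b : ℝ → ℝ), BddMeas ω →
      Measurable (Function.uncurry r) → Measurable a → Measurable b →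
      (∀ z, a z ∈ Icc (0 : ℝ) 1) → (∀ z, b z ∈ Icc (0 : ℝ) 1) →
      BddMeas fun z => ∫ ζ in a z..b z, ω ζ * y 0 (r z ζ) := by
    intro ω r a b hω hr ha hb ha1 hb1
    refine BddMeas.intervalIntegral (F := fun z ζ => ω ζ * y 0 (r z ζ))
      ((hω.comp measurable_snd).mul ((hy 0).comp hr)) ha hb (L := 1) fun z => ?_
    rw [abs_le]
    constructor <;> linarith [(ha1 z).1, (ha1 z).2, (hb1 z).1, (hb1 z).2]
  have h0 : ∀ _z : ℝ, (0 : ℝ) ∈ Icc (0 : ℝ) 1 := fun _ => ⟨le_rfl, zero_le_one⟩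
  have h1 : ∀ _z : ℝ, (1 : ℝ) ∈ Icc (0 : ℝ) 1 := fun _ => ⟨zero_le_one, le_rfl⟩
  have m1 : Measurable fun q : ℝ × ℝ => S.phiE 1 q.1 := (hφ 1).comp measurable_fst
  have m2 : Measurable fun q : ℝ × ℝ => S.phiE 1 q.2 := (hφ 1).comp measurable_snd
  rcases k with i | i
  · obtain rfl | rfl := fin_two_cases i
    · exact (k1 _ (measurable_const.add (hφ 0)) 0).neg
    · exact ((k1 _ (measurable_const.add (hφ 1)) 1).neg.add
        (k2 ωp (fun z ζ => t + S.tau 0 + S.phiE 1 z + S.phiE 1 ζ) (fun _ => 0) (fun _ => 1) hp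
          ((measurable_const.add m1).add m2) measurable_const measurable_const h0 h1)).add
        (k2 ωm (fun z ζ => t + S.tau 0 + S.phiE 1 z - S.phiE 1 ζ) (fun _ => 0)
          (fun z => max 0 (min z 1)) hm ((measurable_const.add m1).sub m2) measurable_const hcl
          h0 clamp_mem)
  · obtain rfl | rfl := fin_two_cases i
    · exact k1 _ (measurable_const.sub (hφ 0)) 0
    · exact (k1 _ (measurable_const.sub (hφ 1)) 1).sub
        (k2 ωp (fun z ζ => t + S.tau 0 - S.phiE 1 z + S.phiE 1 ζ) (fun z => max 0 (min z 1))
          (fun _ => 1) hp ((measurable_const.sub m1).add m2) hcl measurable_const clamp_mem h1)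

lemma IsKernel.exists_bddMeas_flatState (hK : S.IsKernel K) {y : Fin 2 → ℝ → ℝ}
    (hy : ∀ i, LocBddMeas (y i)) {t : ℝ} (ht : 0 ≤ t) :
    ∃ f : Idx → ℝ → ℝ, (∀ k, BddMeas (f k)) ∧
      ∀ k, ∀ z ∈ Icc (0 : ℝ) 1, f k z = S.flatState K y z t k := by
  obtain ⟨ωp, ωm, hp, hm, hpe, hme⟩ := hK.exists_weights
  refine ⟨_, bddMeas_flatStateE (S := S) hp hm (fun i => hy i (t + S.tau 0 + 2 * S.tau 1)) t,
    fun k z hz => ?_⟩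
  rw [flatState_eq_flatStateE hpe hme (fun i s hs => ?_) hz]
  exact indicator_of_mem (show s ∈ Icc 0 _ from ⟨ht.trans hs.1, hs.2⟩) _

/-- The parametrization is Lipschitz for the sup norm on `[t, ∞)`, uniformly in `t`: it depends
only on values of the output at times `≥ t`. -/
lemma IsKernel.exists_flatState_lipschitz (hK : S.IsKernel K) :
    ∃ L : ℝ, 0 ≤ L ∧ ∀ y y' : Fin 2 → ℝ → ℝ, (∀ i, LocBddMeas (y i)) → (∀ i, LocBddMeas (y' i)) →
      ∀ t, 0 ≤ t → ∀ D : ℝ, (∀ i s, t ≤ s → |y i s - y' i s| ≤ D) →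
      ∀ z ∈ Icc (0 : ℝ) 1, ∀ k,
        |S.flatState K y z t k - S.flatState K y' z t k| ≤ L * D := by
  obtain ⟨ωp, ωm, hp, hm, hpe, hme⟩ := hK.exists_weights
  obtain ⟨P, hP⟩ := hp.2
  obtain ⟨M, hM⟩ := hm.2
  have hP0 : 0 ≤ P := (abs_nonneg _).trans (hP 0)
  have hM0 : 0 ≤ M := (abs_nonneg _).trans (hM 0)
  refine ⟨1 + P + M, by positivity, fun y y' hy hy' t ht D hD z hz k => ?_⟩
  have hD0 : 0 ≤ D := (abs_nonneg _).trans (hD 0 t le_rfl)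
  set T := t + S.tau 0 + 2 * S.tau 1 with hT
  have hext : ∀ (v : Fin 2 → ℝ → ℝ) i, ∀ s ∈ Icc t T, (Icc 0 T).indicator (v i) s = v i s :=
    fun v i s hs => indicator_of_mem (show s ∈ Icc 0 T from ⟨ht.trans hs.1, hs.2⟩) _
  rw [flatState_eq_flatStateE hpe hme (hext y) hz, flatState_eq_flatStateE hpe hme (hext y') hz]
  have hYm : ∀ i, BddMeas ((Icc 0 T).indicator (y i)) := fun i => hy i T
  have hYm' : ∀ i, BddMeas ((Icc 0 T).indicator (y' i)) := fun i => hy' i T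
  have key : ∀ i s, t ≤ s →
      |(Icc 0 T).indicator (y i) s - (Icc 0 T).indicator (y' i) s| ≤ D := by
    intro i s hs
    by_cases h : s ∈ Icc 0 T
    · rw [indicator_of_mem h, indicator_of_mem h]
      exact hD i s hs
    · rw [indicator_of_notMem h, indicator_of_notMem h, sub_self, abs_zero]
      exact hD0
  have keyI : ∀ (ω : ℝ → ℝ) (C : ℝ), BddMeas ω → (∀ ζ, |ω ζ| ≤ C) → ∀ r : ℝ → ℝ, Measurable r →
      ∀ a b : ℝ, 0 ≤ a → a ≤ b → b ≤ 1 → (∀ ζ ∈ Icc a b, t ≤ r ζ) →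
      |(∫ ζ in a..b, ω ζ * (Icc 0 T).indicator (y 0) (r ζ))
        - ∫ ζ in a..b, ω ζ * (Icc 0 T).indicator (y' 0) (r ζ)| ≤ C * D := by
    intro ω C hω hC r hr a b ha hab hb htr
    have hC0 : 0 ≤ C := (abs_nonneg _).trans (hC 0)
    rw [← intervalIntegral.integral_sub
      ((hω.mul ((hYm 0).comp hr)).intervalIntegrable a b)
      ((hω.mul ((hYm' 0).comp hr)).intervalIntegrable a b)]
    have h := intervalIntegral.norm_integral_le_of_norm_le_const (a := a) (b := b) (C := C * D)
      (f := fun ζ => ω ζ * (Icc 0 T).indicator (y 0) (r ζ)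
        - ω ζ * (Icc 0 T).indicator (y' 0) (r ζ)) fun ζ hζ => by
          rw [uIoc_of_le hab] at hζ
          rw [← mul_sub, Real.norm_eq_abs, abs_mul]
          exact mul_le_mul (hC ζ) (key 0 _ (htr ζ ⟨hζ.1.le, hζ.2⟩)) (abs_nonneg _) hC0
    refine h.trans ?_
    rw [abs_of_nonneg (sub_nonneg.2 hab)]
    exact mul_le_of_le_one_right (mul_nonneg hC0 hD0) (by linarith)
  have hφ : ∀ i, Measurable (S.phiE i) := fun i => (S.continuous_phiE i).measurable
  have hmono := (S.strictMono_phiE 1).monotone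
  have p0 := S.phiE_mem (i := 0) hz
  have p1 := S.phiE_mem (i := 1) hz
  have h0 := S.tau_pos 0
  have h1 := S.tau_pos 1
  have hPD := mul_nonneg hP0 hD0
  have hMD := mul_nonneg hM0 hD0
  have expand : (1 + P + M) * D = D + P * D + M * D := by ring
  rw [expand]
  rcases k with i | i
  · obtain rfl | rfl := fin_two_cases i
    · simp only [flatStateE, Sum.elim_inl, Matrix.cons_val_zero]
      have e := key 0 (t + S.tau 0 + S.phiE 0 z) (by linarith [p0.1])
      rw [abs_le] at e ⊢
      constructor <;> linarith [e.1, e.2]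
    · simp only [flatStateE, Sum.elim_inl, Matrix.cons_val_one, Matrix.cons_val_fin_one,
        min_eq_left hz.2, max_eq_right hz.1]
      have e1 := key 1 (t + S.tau 1 + S.phiE 1 z) (by linarith [p1.1])
      have e2 := keyI ωp P hp hP (fun ζ => t + S.tau 0 + S.phiE 1 z + S.phiE 1 ζ)
        (measurable_const.add (hφ 1)) 0 1 le_rfl zero_le_one le_rfl fun ζ hζ => by
          linarith [p1.1, (S.phiE_mem (i := 1) hζ).1]
      have e3 := keyI ωm M hm hM (fun ζ => t + S.tau 0 + S.phiE 1 z - S.phiE 1 ζ)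
        (measurable_const.sub (hφ 1)) 0 z le_rfl hz.1 hz.2 fun ζ hζ => by linarith [hmono hζ.2]
      rw [abs_le] at e1 e2 e3 ⊢
      constructor <;> linarith [e1.1, e1.2, e2.1, e2.2, e3.1, e3.2]
  · obtain rfl | rfl := fin_two_cases i
    · simp only [flatStateE, Sum.elim_inr, Matrix.cons_val_zero]
      have e := key 0 (t + S.tau 0 - S.phiE 0 z) (by linarith [p0.2])
      rw [abs_le] at e ⊢
      constructor <;> linarith [e.1, e.2]
    · simp only [flatStateE, Sum.elim_inr, Matrix.cons_val_one, Matrix.cons_val_fin_one,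
        min_eq_left hz.2, max_eq_right hz.1]
      have e1 := key 1 (t + S.tau 1 - S.phiE 1 z) (by linarith [p1.2])
      have e2 := keyI ωp P hp hP (fun ζ => t + S.tau 0 - S.phiE 1 z + S.phiE 1 ζ)
        (measurable_const.add (hφ 1)) z 1 hz.1 hz.2 le_rfl fun ζ hζ => by linarith [hmono hζ.1]
      rw [abs_le] at e1 e2 ⊢
      constructor <;> linarith [e1.1, e1.2, e2.1, e2.2]

lemma IsKernel.volterra_sub (hK : S.IsKernel K) {v w : Idx → ℝ → ℝ}
    (hv : ∀ j, BddMeas ((Icc (0 : ℝ) 1).indicator (v j)))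
    (hw : ∀ j, BddMeas ((Icc (0 : ℝ) 1).indicator (w j))) (k : Idx) {z : ℝ}
    (hz : z ∈ Icc (0 : ℝ) 1) :
    volterra K (fun j ζ => v j ζ - w j ζ) k z = volterra K v k z - volterra K w k z := by
  have hi : ∀ {f : Idx → ℝ → ℝ}, (∀ j, BddMeas ((Icc (0 : ℝ) 1).indicator (f j))) →
      IntervalIntegrable (fun ζ => ∑ j, extK K k j z ζ * f j ζ) volume 0 1 := by
    intro f hf
    have := (BddMeas.sum (s := Finset.univ) fun j _ =>
      ((hK.bddMeas_extK k j).section_left z).mul (hf j)).intervalIntegrable 0 1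
    refine this.congr fun ζ hζ => ?_
    rw [uIoc_of_le zero_le_one] at hζ
    exact Finset.sum_congr rfl fun j _ => by rw [indicator_of_mem (Ioc_subset_Icc_self hζ)]
  rw [volterra_eq K _ k hz, volterra_eq K _ k hz, volterra_eq K _ k hz]
  have : volterraInt K (fun j ζ => v j ζ - w j ζ) k z =
      volterraInt K v k z - volterraInt K w k z := by
    rw [volterraInt, volterraInt, volterraInt, ← intervalIntegral.integral_sub (hi hv) (hi hw)]
    simp only [← Finset.sum_sub_distrib, mul_sub]
  rw [this]
  ring

lemma IsReferenceState.bddMeas {yr : Fin 2 → ℝ → ℝ} {xr : Idx → ℝ → ℝ → ℝ}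
    (h : S.IsReferenceState K yr xr) {t : ℝ} (ht : 0 ≤ t) (k : Idx) :
    BddMeas ((Icc (0 : ℝ) 1).indicator fun z => xr k z t) := by
  obtain ⟨C, hC⟩ := h.bounded t ht
  exact BddMeas.of_indicator measurableSet_Icc (h.measurable t ht k) (hC k)

lemma IsSolution.bddMeas (hx : S.IsSolution x u) {t : ℝ} (ht : 0 ≤ t) (k : Idx) :
    BddMeas ((Icc (0 : ℝ) 1).indicator fun z => x k z t) := by
  have h := ((hx.bddMeas_extX t k).section_right t).indicator (s := Icc (0 : ℝ) 1) measurableSet_Icc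
  convert h using 1
  exact indicator_congr fun z hz => (extX_of_mem hz ⟨ht, le_rfl⟩).symm

lemma IsKernel.exists_isReferenceState (hK : S.IsKernel K) {yr : Fin 2 → ℝ → ℝ}
    (hyr : ∀ i, LocBddMeas (yr i)) : ∃ xr, S.IsReferenceState K yr xr := by
  obtain ⟨C, hC⟩ := hK.bounded
  have hC' : ∀ z ζ : ℝ, 0 ≤ ζ → ζ ≤ z → z ≤ 1 → ∀ k j, |K z ζ k j| ≤ |C| :=
    fun z ζ h0 h h1 k j => (hC z ζ h0 h h1 k j).trans (le_abs_self C)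
  have hex : ∀ t, ∃ d : Idx → ℝ → ℝ, 0 ≤ t → (∀ k, BddMeas (d k)) ∧
      ∀ k, ∀ z ∈ Icc (0 : ℝ) 1, volterra K d k z = S.flatState K yr z t k := by
    intro t
    by_cases ht : 0 ≤ t
    · obtain ⟨f, hf, hfe⟩ := hK.exists_bddMeas_flatState hyr ht
      obtain ⟨d, hd, hde⟩ := exists_volterra_eq (abs_nonneg C) hC' hK.bddMeas_extK hf
      exact ⟨d, fun _ => ⟨hd, fun k z hz => (hde k z hz).trans (hfe k z hz)⟩⟩
    · exact ⟨0, fun h => absurd h ht⟩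
  choose d hd using hex
  refine ⟨fun k z t => d t k z, fun t ht k => ((hd t ht).1 k).1.comp measurable_subtype_coe,
    fun t ht => ?_, fun t ht z hz k => (hd t ht).2 k z hz⟩
  choose B hB using fun k => ((hd t ht).1 k).2
  exact ⟨∑ k, |B k|, fun k z _ => (hB k z).trans ((le_abs_self _).trans
    (Finset.single_le_sum (f := fun k => |B k|) (fun k _ => abs_nonneg _) (Finset.mem_univ k)))⟩

/-- Two profiles at the same time differ by at most a constant times the difference of their
Volterra transforms. -/
lemma IsKernel.exists_inverse_bound (hK : S.IsKernel K) :
    ∃ Q : ℝ, 0 ≤ Q ∧ ∀ v w : Idx → ℝ → ℝ, (∀ j, BddMeas ((Icc (0 : ℝ) 1).indicator (v j))) →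
      (∀ j, BddMeas ((Icc (0 : ℝ) 1).indicator (w j))) → ∀ ε : ℝ,
      (∀ k, ∀ z ∈ Icc (0 : ℝ) 1, |volterra K v k z - volterra K w k z| ≤ ε) →
      ∀ k, ∀ z ∈ Icc (0 : ℝ) 1, |v k z - w k z| ≤ Q * ε := by
  obtain ⟨C, hC⟩ := hK.bounded
  have hC' : ∀ z ζ : ℝ, 0 ≤ ζ → ζ ≤ z → z ≤ 1 → ∀ k j, |K z ζ k j| ≤ |C| :=
    fun z ζ h0 h h1 k j => (hC z ζ h0 h h1 k j).trans (le_abs_self C)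
  refine ⟨2 * Real.exp (8 * |C|), by positivity, fun v w hv hw ε hε k z hz => ?_⟩
  choose V hV using fun k => (hv k).2
  choose W hW using fun k => (hw k).2
  have hb : ∀ k, ∀ z ∈ Icc (0 : ℝ) 1, |v k z - w k z| ≤ ∑ k, (V k + W k) := by
    intro k z hz
    have h1 := hV k z
    have h2 := hW k z
    rw [indicator_of_mem hz] at h1 h2
    refine (abs_sub _ _).trans ((add_le_add h1 h2).trans ?_)
    exact Finset.single_le_sum (f := fun k => V k + W k)
      (fun k _ => add_nonneg ((abs_nonneg _).trans (hV k 0)) ((abs_nonneg _).trans (hW k 0)))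
      (Finset.mem_univ k)
  have h := abs_le_of_volterra_le (abs_nonneg C) hC' (d := fun j ζ => v j ζ - w j ζ) hb
    (fun k z hz => by rw [hK.volterra_sub hv hw k hz]; exact hε k z hz) k hz
  linarith

/-- The distance to the reference state is controlled by the tracking error at later times. -/
lemma IsKernel.stateConverges (hK : S.IsKernel K) (hx : S.IsSolution x u) {yr : Fin 2 → ℝ → ℝ}
    (hyr : ∀ i, LocBddMeas (yr i)) {xr : Idx → ℝ → ℝ → ℝ} (hxr : S.IsReferenceState K yr xr) {μ : ℝ}
    (hμ : 0 ≤ μ) (hc : HCFConverges S μ yr (hcfState K x)) : StateConverges μ x xr := by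
  obtain ⟨C, hC⟩ := hc
  obtain ⟨L, hL0, hL⟩ := hK.exists_flatState_lipschitz
  obtain ⟨Q, hQ0, hQ⟩ := hK.exists_inverse_bound
  have hC' : ∀ i s, 0 ≤ s → |flatOutput K x i s - yr i s| ≤ C * Real.exp (-μ * s) := by
    intro i s hs
    have := hC s hs i 0 ⟨le_rfl, by linarith [S.tau_pos i]⟩
    simpa [hcfState] using this
  have hC0 : 0 ≤ C := by
    have := (abs_nonneg _).trans (hC' 0 0 le_rfl)
    simpa using this
  refine ⟨Q * (L * C), fun t ht k z hz => ?_⟩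
  have h1 : ∀ i s, t ≤ s → |flatOutput K x i s - yr i s| ≤ C * Real.exp (-μ * t) := fun i s hs =>
    (hC' i s (ht.trans hs)).trans
      (mul_le_mul_of_nonneg_left (Real.exp_le_exp.2 (by nlinarith)) hC0)
  have h2 := hL _ _ (hK.locBddMeas_flatOutput hx) hyr t ht _ h1
  have h3 := hQ (fun k z => x k z t) (fun k z => xr k z t) (hx.bddMeas ht) (hxr.bddMeas ht)
    (L * (C * Real.exp (-μ * t))) (fun k z hz => by
      rw [hK.volterra_eq_flatState hx hz ht, hxr.transform t ht z hz k]
      exact h2 z hz k) k z hz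
  refine h3.trans (le_of_eq (by ring))

lemma exists_rate (S : RiemannSystem) {γ : Fin 2 → ℝ} (hγ : ∀ i, |γ i| < 1) :
    ∃ μ : ℝ, 0 < μ ∧ ∀ i, |γ i| ≤ Real.exp (-μ * (2 * S.tau i)) := by
  -- `1 / 2` keeps the logarithm finite when both gains vanish
  set G := max (max |γ 0| |γ 1|) (1 / 2) with hG
  have hG0 : 0 < G := lt_of_lt_of_le (by norm_num) (le_max_right _ _)
  have hG1 : G < 1 := max_lt (max_lt (hγ 0) (hγ 1)) (by norm_num)
  have h1 := S.tau_pos 1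
  have hμ : 0 < -Real.log G / (2 * S.tau 1) :=
    div_pos (neg_pos.2 (Real.log_neg hG0 hG1)) (by linarith)
  refine ⟨_, hμ, fun i => ?_⟩
  have hle : S.tau i ≤ S.tau 1 := by
    obtain rfl | rfl := fin_two_cases i
    · exact S.tau_le
    · exact le_rfl
  have hGi : |γ i| ≤ G := by
    obtain rfl | rfl := fin_two_cases i
    · exact (le_max_left _ _).trans (le_max_left _ _)
    · exact (le_max_right _ _).trans (le_max_left _ _)
  refine hGi.trans ?_
  have e : G = Real.exp (-(-Real.log G / (2 * S.tau 1)) * (2 * S.tau 1)) := by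
    rw [neg_mul, div_mul_cancel₀ _ (by linarith), neg_neg, Real.exp_log hG0]
  nth_rewrite 1 [e]
  exact Real.exp_le_exp.2 (by nlinarith)

end RiemannSystem

end Beam

theorem theorem1 (S : Beam.RiemannSystem) (K : ℝ → ℝ → Matrix Beam.Idx Beam.Idx ℝ)
    (hK : S.IsKernel K) (γ : Fin 2 → ℝ) (hγ : ∀ i, |γ i| < 1) :
    ∃ μ : ℝ, 0 < μ ∧
      ∀ (t0 tT : ℝ) (y0 yT : Fin 2 → ℝ) (p : Fin 2 → ℝ → ℝ), t0 < tT →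
        (∀ i, ContinuousOn (p i) (Set.Icc t0 tT)) →
        (∀ i, p i t0 = y0 i) → (∀ i, p i tT = yT i) →
        ∀ yr : Fin 2 → ℝ → ℝ, yr = Beam.RiemannSystem.reference t0 tT y0 yT p →
          (∀ (η : Fin 2 → ℝ → ℝ → ℝ) (ubar : ℝ → Fin 2 → ℝ),
            S.IsHCFSolution K η ubar →
            (∀ t, 0 ≤ t → ubar t = S.controller K γ yr t (fun i τ => η i τ t)) →
              S.ErrorDynamics γ yr η ∧ S.HCFConverges μ yr η) ∧
          ∃ xr : Beam.Idx → ℝ → ℝ → ℝ,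
            S.IsReferenceState K yr xr ∧
            (∀ xr' : Beam.Idx → ℝ → ℝ → ℝ, S.IsReferenceState K yr xr' →
              ∀ t, 0 ≤ t → ∀ z ∈ Set.Icc (0 : ℝ) 1, ∀ k, xr' k z t = xr k z t) ∧
            ∀ x : Beam.Idx → ℝ → ℝ → ℝ, S.IsClosedLoop K γ yr x →
              S.IsHCFSolution K (Beam.RiemannSystem.hcfState K x) (S.loopInput K γ yr x) ∧
              S.ErrorDynamics γ yr (Beam.RiemannSystem.hcfState K x) ∧
              S.HCFConverges μ yr (Beam.RiemannSystem.hcfState K x) ∧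
              Beam.RiemannSystem.StateConverges μ x xr := by
  obtain ⟨μ, hμ, hrate⟩ := S.exists_rate hγ
  refine ⟨μ, hμ, fun t0 tT y0 yT p ht hp h0 hT yr hyr => ?_⟩
  have hcont : ∀ i, Continuous (yr i) := fun i => by
    rw [hyr]
    exact Beam.RiemannSystem.continuous_reference ht hp h0 hT i
  have hloc := fun i => Beam.RiemannSystem.LocBddMeas.of_continuous (hcont i)
  have part1 : ∀ (η : Fin 2 → ℝ → ℝ → ℝ) (ubar : ℝ → Fin 2 → ℝ), S.IsHCFSolution K η ubar →
      (∀ t, 0 ≤ t → ubar t = S.controller K γ yr t (fun i τ => η i τ t)) →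
        S.ErrorDynamics γ yr η ∧ S.HCFConverges μ yr η := fun η ubar hη hu =>
    ⟨hη.errorDynamics hu, hη.converges hcont (hη.errorDynamics hu) hμ.le hrate⟩
  refine ⟨part1, ?_⟩
  obtain ⟨xr, hxr⟩ := hK.exists_isReferenceState hloc
  refine ⟨xr, hxr, fun xr' hxr' t ht z hz k => ?_, fun x hx => ?_⟩
  · obtain ⟨Q, _, hQ⟩ := hK.exists_inverse_bound
    have h := hQ (fun k z => xr' k z t) (fun k z => xr k z t) (hxr'.bddMeas ht) (hxr.bddMeas ht) 0
      (fun k z hz => by rw [hxr.transform t ht z hz k, hxr'.transform t ht z hz k]; simp) k z hz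
    rw [mul_zero] at h
    exact sub_eq_zero.1 (abs_eq_zero.1 (le_antisymm h (abs_nonneg _)))
  · have hhcf := hK.isHCFSolution hx
    obtain ⟨he, hc⟩ := part1 _ _ hhcf fun t _ => rfl
    exact ⟨hhcf, he, hc, hK.stateConverges hx hloc hxr hμ.le hc⟩
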